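/- Let $(A,\Delta)$ be a regular multiplier Hopf algebra over $\mathbb C$ with a fixed non-zero left integral $\varphi$, that is, $(\iota\otimes\varphi)\Delta(a)=\varphi(a)1$ in the multiplier algebra $M(A)$ for all $a\in A$. Here $A$ is a (possibly non-unital) algebra with non-degenerate product, $\Delta:A\to M(A\otimes A)$ is a coassociative homomorphism, and the maps $a\otimes b\mapsto \Delta(a)(1\otimes b),\ (a\otimes 1)\Delta(b),\ \Delta(a)(b\otimes 1),\ (1\otimes a)\Delta(b)$ are bijections of $A\otimes A$. Let $\varepsilon$ be the counit, $S$ the antipode and $\psi=\varphi\circ S$. Let $\sigma,\sigma'$ be the modular automorphisms, characterized by $\varphi(ab)=\varphi(b\sigma(a))$ and $\psi(ab)=\psi(b\sigma'(a))$, and let $\delta\in M(A)$ be the modular element, the invertible multiplier characterized by $\varphi(S(a))=\varphi(a\delta)$ and $\varphi(S^{-1}(a))=\varphi(\delta a)$. Let $B=\widehat A=\{\varphi(\,\cdot\,c): c\in A\}$, with the evaluation pairing $\langle a,b\rangle=b(a)$. For $a\in A$, $b\in B$ put $a\triangleleft b=(b\otimes\iota)\Delta(a)\in A$ and $b\triangleright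 a=(\iota\otimes b)\Delta(a)\in A$. The product of $B$ is given by $\langle a,bb'\rangle=\langle a\triangleleft b,b'\rangle$ and the antipode of $B$ by $\langle a,S(b)\rangle=\langle S(a),b\rangle$. For $m\in M(B)$, the extended pairing $\langle\,\cdot\,,m\rangle$ is the linear functional on $A$ determined by $\langle a\triangleleft b,m\rangle=\langle a,bm\rangle$ and $\langle b\triangleright a,m\rangle=\langle a,mb\rangle$. Let $\widehat\psi,\widehat\varphi$ be the right and left integrals on $B$ given by $\widehat\psi(b)=\varepsilon(c)$ if $b=\varphi(\,\cdot\,c)$, and $\widehat\varphi(b)=\varepsilon(c)$ if $b=\psi(S(\,\cdot\,)c)$. Let $\widehat\sigma,\widehat\sigma'$ be the modular automorphisms of $\widehat\varphi,\widehat\psi$ on $B$, and let $\widehat\delta\in M(B)$ be the modular element of $B$, the invertible multiplier characterized by $\widehat\varphi(S(b))=\widehat\varphi(b\widehat\delta)$ and $\widehat\varphi(S^{-1}(b))=\widehat\varphi(\widehat\delta b)$. Then all these objects exist (including the extended pairings with $\widehat\delta$ and $\widehat\delta^{-1}$), and the following hold. 1. For all $a\in A$, $$\langle a,\widehat\delta\rangle=\varepsilon(\sigma^{-1}(a))=\varepsilon({\sigma'}^{-1}(a)),\qquad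 \langle a,\widehat\delta^{-1}\rangle=\varepsilon(\sigma(a))=\varepsilon(\sigma'(a)).$$ 2. For all $a\in A$ and $b\in B$, $$\langle a,\widehat\sigma(b)\rangle=\langle S^2(a)\delta^{-1},b\rangle,\qquad \langle a,\widehat\sigma'(b)\rangle=\langle\delta^{-1}S^{-2}(a),b\rangle.$$ 3. If $b=\varphi(\,\cdot\,c)$ and $b'=\varphi(\,\cdot\,c')$ with $c,c'\in A$, then $\widehat\psi(bb')=\varphi(S^{-1}(c')c)$. -/

import Mathlib

open scoped TensorProduct

/-! ### Multiplier algebras -/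

section MultiplierAlgebra

variable (A : Type*) [NonUnitalRing A] [Module ℂ A] [SMulCommClass ℂ A A] [IsScalarTower ℂ A A]

/-- The multiplier algebra `M(A)`: pairs `(L, R)` of linear maps with `a (L b) = (R a) b`, where
`L b` is thought of as `m b` and `R a` as `a m`. The second component carries the opposite
product, so that `(m n) b = m (n b)` and `a (m n) = (a m) n`. -/
def multiplierAlgebra : Subalgebra ℂ (Module.End ℂ A × (Module.End ℂ A)ᵐᵒᵖ) where
  carrier := {m | ∀ a b : A, a * m.1 b = m.2.unop a * b}
  mul_mem' := by
    intro m n hm hn a b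
    have h1 := hm a (n.1 b)
    have h2 := hn (m.2.unop a) b
    simpa [Module.End.mul_apply] using h1.trans h2
  add_mem' := by
    intro m n hm hn a b
    have h1 := hm a b
    have h2 := hn a b
    simp [mul_add, add_mul, h1, h2]
  algebraMap_mem' := by
    intro r a b
    simp [Prod.algebraMap_apply, Module.algebraMap_end_apply, MulOpposite.algebraMap_apply,
      mul_smul_comm, smul_mul_assoc]

/-- `M(A)` as a unital algebra. -/
abbrev Multiplier : Type _ := multiplierAlgebra A

end MultiplierAlgebra

namespace Multiplier

variable {A : Type*} [NonUnitalRing A] [Module ℂ A] [SMulCommClass ℂ A A] [IsScalarTower ℂ A A]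

/-- `m.lmul a` is the element `m a` of `A`. -/
def lmul (m : Multiplier A) : A →ₗ[ℂ] A := m.1.1

/-- `m.rmul a` is the element `a m` of `A`. -/
def rmul (m : Multiplier A) : A →ₗ[ℂ] A := m.1.2.unop

lemma compat (m : Multiplier A) (a b : A) : a * m.lmul b = m.rmul a * b := m.2 a b

/-- The canonical map `A → M(A)`. -/
def of (a : A) : Multiplier A :=
  ⟨(LinearMap.mul ℂ A a, MulOpposite.op ((LinearMap.mul ℂ A).flip a)),
    fun x y => (mul_assoc x a y).symm⟩

/-- The multiplier `m ⊗ n` of `A ⊗ A`. -/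
def tmul (m n : Multiplier A) : Multiplier (A ⊗[ℂ] A) :=
  ⟨(TensorProduct.map m.lmul n.lmul, MulOpposite.op (TensorProduct.map m.rmul n.rmul)), by
    intro x y
    induction x with
    | zero => simp
    | add x x' hx hx' =>
      simp only [add_mul, map_add] at hx hx' ⊢
      rw [hx, hx']
    | tmul a a' =>
      induction y with
      | zero => simp
      | add y y' hy hy' =>
        simp only [mul_add, map_add] at hy hy' ⊢
        rw [hy, hy']
      | tmul b b' => simp [compat]⟩

@[simp] lemma lmul_of (a b : A) : (of a).lmul b = a * b := rfl
@[simp] lemma rmul_of (a b : A) : (of a).rmul b = b * a := rfl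
@[simp] lemma lmul_one (b : A) : (1 : Multiplier A).lmul b = b := rfl
@[simp] lemma lmul_mul (m n : Multiplier A) (b : A) : (m * n).lmul b = m.lmul (n.lmul b) := rfl
@[simp] lemma lmul_tmul (m n : Multiplier A) (b c : A) :
    (tmul m n).lmul (b ⊗ₜ c) = m.lmul b ⊗ₜ n.lmul c := rfl

end Multiplier

/-! ### Regular multiplier Hopf algebras and integrals -/

/-- A regular multiplier Hopf algebra: a non-degenerate algebra `A` over `ℂ` with a homomorphism
`Δ : A → M(A ⊗ A)` such that the four canonical maps
`a ⊗ b ↦ Δ(a)(1 ⊗ b)`, `(a ⊗ 1)Δ(b)`, `Δ(a)(b ⊗ 1)`, `(1 ⊗ a)Δ(b)`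
take values in `A ⊗ A` and are bijections of `A ⊗ A` (`T₁`, `T₂`, `T₃`, `T₄`; they are determined
by `Δ`), and `Δ` is coassociative:
`(a ⊗ 1 ⊗ 1)(Δ ⊗ ι)(Δ(b)(1 ⊗ c)) = (ι ⊗ Δ)((a ⊗ 1)Δ(b))(1 ⊗ 1 ⊗ c)`. -/
structure RegularMultiplierHopfAlgebra (A : Type*) [NonUnitalRing A] [Module ℂ A]
    [SMulCommClass ℂ A A] [IsScalarTower ℂ A A] where
  eq_zero_of_mul_right : ∀ a : A, (∀ b, a * b = 0) → a = 0
  eq_zero_of_mul_left : ∀ a : A, (∀ b, b * a = 0) → a = 0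
  Δ : A →ₙₐ[ℂ] Multiplier (A ⊗[ℂ] A)
  T₁ : A ⊗[ℂ] A ≃ₗ[ℂ] A ⊗[ℂ] A
  T₁_spec : ∀ a b, Multiplier.of (T₁ (a ⊗ₜ b)) = Δ a * Multiplier.tmul 1 (Multiplier.of b)
  T₂ : A ⊗[ℂ] A ≃ₗ[ℂ] A ⊗[ℂ] A
  T₂_spec : ∀ a b, Multiplier.of (T₂ (a ⊗ₜ b)) = Multiplier.tmul (Multiplier.of a) 1 * Δ b
  T₃ : A ⊗[ℂ] A ≃ₗ[ℂ] A ⊗[ℂ] A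
  T₃_spec : ∀ a b, Multiplier.of (T₃ (a ⊗ₜ b)) = Δ a * Multiplier.tmul (Multiplier.of b) 1
  T₄ : A ⊗[ℂ] A ≃ₗ[ℂ] A ⊗[ℂ] A
  T₄_spec : ∀ a b, Multiplier.of (T₄ (a ⊗ₜ b)) = Multiplier.tmul 1 (Multiplier.of a) * Δ b
  coassoc : ∀ a b c : A,
    TensorProduct.assoc ℂ A A A
        (T₂.toLinearMap.rTensor A ((TensorProduct.assoc ℂ A A A).symm (a ⊗ₜ T₁ (b ⊗ₜ c)))) =
      T₁.toLinearMap.lTensor A (TensorProduct.assoc ℂ A A A (T₂ (a ⊗ₜ b) ⊗ₜ c))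

section Slice

variable {A : Type*} [AddCommGroup A] [Module ℂ A]

/-- The slice map `f ⊗ ι : A ⊗ A → A`. -/
def sliceL (f : A →ₗ[ℂ] ℂ) : A ⊗[ℂ] A →ₗ[ℂ] A :=
  (TensorProduct.lid ℂ A).toLinearMap ∘ₗ f.rTensor A

/-- The slice map `ι ⊗ f : A ⊗ A → A`. -/
def sliceR (f : A →ₗ[ℂ] ℂ) : A ⊗[ℂ] A →ₗ[ℂ] A :=
  (TensorProduct.rid ℂ A).toLinearMap ∘ₗ f.lTensor A

@[simp] lemma sliceL_tmul (f : A →ₗ[ℂ] ℂ) (a b : A) : sliceL f (a ⊗ₜ b) = f a • b := by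
  simp [sliceL]

@[simp] lemma sliceR_tmul (f : A →ₗ[ℂ] ℂ) (a b : A) : sliceR f (a ⊗ₜ b) = f b • a := by
  simp [sliceR]

/-- A tensor all of whose slices `(ι ⊗ g) t` vanish is zero. -/
lemma tensor_eq_zero_of_slice {N : Type*} [AddCommGroup N] [Module ℂ N] (t : A ⊗[ℂ] N)
    (h : ∀ g : N →ₗ[ℂ] ℂ, TensorProduct.rid ℂ A (g.lTensor A t) = 0) : t = 0 := by
  classical
  let 𝒞 := Module.Basis.ofVectorSpace ℂ N
  apply (TensorProduct.equivFinsuppOfBasisRight (M := A) 𝒞).injective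
  ext i
  simpa [TensorProduct.equivFinsuppOfBasisRight_apply] using h (𝒞.coord i)

/-- A jointly injective family of maps on the left leg is jointly injective on tensors. -/
lemma tensor_eq_zero_of_rTensor {N X : Type*} [AddCommGroup N] [Module ℂ N]
    (f : X → A →ₗ[ℂ] A) (hf : ∀ a, (∀ x, f x a = 0) → a = 0) (t : A ⊗[ℂ] N)
    (h : ∀ x, (f x).rTensor N t = 0) : t = 0 := by
  refine tensor_eq_zero_of_slice t fun g => hf _ fun x => ?_
  have key : f x (TensorProduct.rid ℂ A (g.lTensor A t)) =
      TensorProduct.rid ℂ A (g.lTensor A ((f x).rTensor N t)) := by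
    clear h
    induction t with
    | zero => simp
    | add s t hs ht => simp only [map_add, hs, ht]
    | tmul a n => simp
  rw [key, h x]; simp

lemma tensor_eq_zero_of_lTensor {X : Type*}
    (f : X → A →ₗ[ℂ] A) (hf : ∀ a, (∀ x, f x a = 0) → a = 0) (t : A ⊗[ℂ] A)
    (h : ∀ x, (f x).lTensor A t = 0) : t = 0 := by
  apply (TensorProduct.comm ℂ A A).injective
  rw [map_zero]
  refine tensor_eq_zero_of_rTensor f hf _ fun x => ?_
  have key : (f x).rTensor A (TensorProduct.comm ℂ A A t) =
      TensorProduct.comm ℂ A A ((f x).lTensor A t) := by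
    clear h
    induction t with
    | zero => simp
    | add s t hs ht => simp only [map_add, hs, ht]
    | tmul a n => simp
  rw [key, h x, map_zero]

lemma sliceL_lTensor (f : A →ₗ[ℂ] ℂ) (g : A →ₗ[ℂ] A) (t : A ⊗[ℂ] A) :
    sliceL f (g.lTensor A t) = g (sliceL f t) := by
  induction t with
  | zero => simp
  | add s t hs ht => simp only [map_add, hs, ht]
  | tmul a n => simp

lemma sliceL_rTensor (f : A →ₗ[ℂ] ℂ) (g : A →ₗ[ℂ] A) (t : A ⊗[ℂ] A) :
    sliceL f (g.rTensor A t) = sliceL (f ∘ₗ g) t := by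
  induction t with
  | zero => simp
  | add s t hs ht => simp only [map_add, hs, ht]
  | tmul a n => simp

lemma slice_slice (f : A →ₗ[ℂ] ℂ) (t : A ⊗[ℂ] A) : f (sliceL f t) = f (sliceR f t) := by
  induction t with
  | zero => simp
  | add s t hs ht => simp only [map_add, hs, ht]
  | tmul a n => simp [mul_comm]

end Slice

/-- An algebraic quantum group: a regular multiplier Hopf algebra with a chosen left integral
`φ`, that is a non-zero linear functional with `(ι ⊗ φ)Δ(a) = φ(a)1` in `M(A)`; the two last fields
are this equality multiplied by `b` on the right and on the left. -/
structure AlgebraicQuantumGroup (A : Type*) [NonUnitalRing A] [Module ℂ A]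
    [SMulCommClass ℂ A A] [IsScalarTower ℂ A A] extends RegularMultiplierHopfAlgebra A where
  φ : A →ₗ[ℂ] ℂ
  φ_ne_zero : φ ≠ 0
  left_invariant : ∀ a b, sliceR φ (T₃ (a ⊗ₜ b)) = φ a • b
  left_invariant' : ∀ a b, sliceR φ (T₂ (b ⊗ₜ a)) = φ a • b

namespace RegularMultiplierHopfAlgebra

variable {A : Type*} [NonUnitalRing A] [Module ℂ A] [SMulCommClass ℂ A A] [IsScalarTower ℂ A A]
  (H : RegularMultiplierHopfAlgebra A)

/-- Counit: `(ε ⊗ ι)(Δ(a)(1 ⊗ b)) = ab` and `(ι ⊗ ε)((a ⊗ 1)Δ(b)) = ab`. -/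
def IsCounit (ε : A →ₗ[ℂ] ℂ) : Prop :=
  (∀ a b, sliceL ε (H.T₁ (a ⊗ₜ b)) = a * b) ∧ ∀ a b, sliceR ε (H.T₂ (a ⊗ₜ b)) = a * b

/-- The counit of a regular multiplier Hopf algebra: the unique functional with `IsCounit`. -/
noncomputable def counit : A →ₗ[ℂ] ℂ := Classical.epsilon H.IsCounit

/-- Antipode: with `m` the multiplication, `m(S ⊗ ι)(Δ(a)(1 ⊗ b)) = ε(a)b` and
`m(ι ⊗ S)((a ⊗ 1)Δ(b)) = ε(b)a`. -/
def IsAntipode (S : A ≃ₗ[ℂ] A) : Prop :=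
  (∀ a b, LinearMap.mul' ℂ A (S.toLinearMap.rTensor A (H.T₁ (a ⊗ₜ b))) = H.counit a • b) ∧
    ∀ a b, LinearMap.mul' ℂ A (S.toLinearMap.lTensor A (H.T₂ (a ⊗ₜ b))) = H.counit b • a

/-- The antipode of a regular multiplier Hopf algebra: the unique map with `IsAntipode`. -/
noncomputable def antipode : A ≃ₗ[ℂ] A := Classical.epsilon H.IsAntipode

end RegularMultiplierHopfAlgebra

/-! ### Modular element and modular automorphisms -/

section Modular

variable {A : Type*} [NonUnitalRing A] [Module ℂ A] [SMulCommClass ℂ A A] [IsScalarTower ℂ A A]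

/-- `σ` is an automorphism of the algebra `A` and `f(ab) = f(b σ(a))` for all `a, b`. -/
def IsModularAutomorphism (f : A →ₗ[ℂ] ℂ) (σ : A ≃ₗ[ℂ] A) : Prop :=
  (∀ a b, σ (a * b) = σ a * σ b) ∧ ∀ a b, f (a * b) = f (b * σ a)

/-- The modular automorphism of a functional, when there is exactly one. -/
noncomputable def modularAutomorphism (f : A →ₗ[ℂ] ℂ) : A ≃ₗ[ℂ] A :=
  Classical.epsilon (IsModularAutomorphism f)

/-- `δ` is an invertible multiplier with `f(S(a)) = f(aδ)` and `f(S⁻¹(a)) = f(δa)`. -/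
def IsModularElement (S : A ≃ₗ[ℂ] A) (f : A →ₗ[ℂ] ℂ) (δ : (Multiplier A)ˣ) : Prop :=
  ∀ a, f (S a) = f ((δ : Multiplier A).rmul a) ∧ f (S.symm a) = f ((δ : Multiplier A).lmul a)

/-- The modular element of a left integral `f` with respect to the antipode `S`. -/
noncomputable def modularElement (S : A ≃ₗ[ℂ] A) (f : A →ₗ[ℂ] ℂ) : (Multiplier A)ˣ :=
  Classical.epsilon (IsModularElement S f)

end Modular

namespace AlgebraicQuantumGroup

variable {A : Type*} [NonUnitalRing A] [Module ℂ A] [SMulCommClass ℂ A A] [IsScalarTower ℂ A A]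
  (G : AlgebraicQuantumGroup A)

/-- The counit `ε` of `A`. -/
noncomputable abbrev ε : A →ₗ[ℂ] ℂ := G.toRegularMultiplierHopfAlgebra.counit

/-- The antipode `S` of `A`. -/
noncomputable abbrev S : A ≃ₗ[ℂ] A := G.toRegularMultiplierHopfAlgebra.antipode

/-- The right integral `ψ = φ ∘ S`. -/
noncomputable def ψ : A →ₗ[ℂ] ℂ := G.φ ∘ₗ G.S.toLinearMap

/-- The modular automorphism `σ` of `φ`. -/
noncomputable def σ : A ≃ₗ[ℂ] A := modularAutomorphism G.φ

/-- The modular automorphism `σ'` of `ψ`. -/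
noncomputable def σ' : A ≃ₗ[ℂ] A := modularAutomorphism G.ψ

/-- The modular element `δ ∈ M(A)`. -/
noncomputable def δ : (Multiplier A)ˣ := modularElement G.S G.φ

/-! ### The dual algebra -/

/-- `c ↦ φ( · c)`. -/
def fourier : A →ₗ[ℂ] (A →ₗ[ℂ] ℂ) := (LinearMap.mul ℂ A).flip.compr₂ G.φ

@[simp] lemma fourier_apply (c a : A) : G.fourier c a = G.φ (a * c) := rfl

/-- The dual `B = Â`: the space of functionals `φ( · c)` with `c ∈ A`. The pairing `⟨a, b⟩` of `A`
with `B` is evaluation, `b.1 a`. -/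
def Dual : Type _ := LinearMap.range G.fourier

instance : AddCommGroup G.Dual := inferInstanceAs (AddCommGroup (LinearMap.range G.fourier))
instance : Module ℂ G.Dual := inferInstanceAs (Module ℂ (LinearMap.range G.fourier))

variable {G}

lemma Dual.ext {b b' : G.Dual} (h : ∀ a, b.1 a = b'.1 a) : b = b' :=
  Subtype.ext (LinearMap.ext h)

@[simp] lemma Dual.add_val (b b' : G.Dual) : (b + b').1 = b.1 + b'.1 := rfl
@[simp] lemma Dual.zero_val : (0 : G.Dual).1 = 0 := rfl
@[simp] lemma Dual.smul_val (r : ℂ) (b : G.Dual) : (r • b).1 = r • b.1 := rfl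

/-- An element `c` with `b = φ( · c)`. -/
noncomputable def Dual.rep (b : G.Dual) : A := b.2.choose

lemma Dual.rep_spec (b : G.Dual) (a : A) : b.1 a = G.φ (a * b.rep) :=
  (LinearMap.congr_fun b.2.choose_spec a).symm

/-- `b.actR a` is `a ◁ b = (b ⊗ ι)Δ(a) = (φ ⊗ ι)(Δ(a)(c ⊗ 1))` where `b = φ( · c)`. -/
noncomputable def Dual.actR (b : G.Dual) : A →ₗ[ℂ] A :=
  sliceL G.φ ∘ₗ G.T₃.toLinearMap ∘ₗ (TensorProduct.mk ℂ A A).flip b.rep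

/-- `b.actL a` is `b ▷ a = (ι ⊗ b)Δ(a) = (ι ⊗ φ)(Δ(a)(1 ⊗ c))` where `b = φ( · c)`. -/
noncomputable def Dual.actL (b : G.Dual) : A →ₗ[ℂ] A :=
  sliceR G.φ ∘ₗ G.T₁.toLinearMap ∘ₗ (TensorProduct.mk ℂ A A).flip b.rep

section DualProduct

variable (G)

lemma eq_zero_of_mul_tmul (G : AlgebraicQuantumGroup A) (t : A ⊗[ℂ] A) (h : ∀ x y : A, t * (x ⊗ₜ y) = 0) : t = 0 := by
  refine tensor_eq_zero_of_rTensor (fun x => (LinearMap.mul ℂ A).flip x)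
    G.eq_zero_of_mul_right t fun x => ?_
  refine tensor_eq_zero_of_lTensor (fun y => (LinearMap.mul ℂ A).flip y)
    G.eq_zero_of_mul_right _ fun y => ?_
  rw [← h x y]
  clear h
  induction t with
  | zero => simp
  | add s t hs ht => simp only [map_add, add_mul, hs, ht]
  | tmul a n => simp

lemma eq_zero_of_tmul_mul (G : AlgebraicQuantumGroup A) (t : A ⊗[ℂ] A) (h : ∀ x y : A, (x ⊗ₜ y) * t = 0) : t = 0 := by
  refine tensor_eq_zero_of_rTensor (fun x => LinearMap.mul ℂ A x)
    G.eq_zero_of_mul_left t fun x => ?_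
  refine tensor_eq_zero_of_lTensor (fun y => LinearMap.mul ℂ A y)
    G.eq_zero_of_mul_left _ fun y => ?_
  rw [← h x y]
  clear h
  induction t with
  | zero => simp
  | add s t hs ht => simp only [map_add, mul_add, hs, ht]
  | tmul a n => simp

lemma tensor_ext_mul (G : AlgebraicQuantumGroup A) {s t : A ⊗[ℂ] A} (h : ∀ x y : A, s * (x ⊗ₜ y) = t * (x ⊗ₜ y)) : s = t :=
  sub_eq_zero.1 <| G.eq_zero_of_mul_tmul _ fun x y => by rw [sub_mul, h, sub_self]

lemma lmul_mul_assoc (G : AlgebraicQuantumGroup A) (m : Multiplier (A ⊗[ℂ] A)) (s t : A ⊗[ℂ] A) :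
    m.lmul (s * t) = m.lmul s * t := by
  refine sub_eq_zero.1 <| G.eq_zero_of_tmul_mul _ fun x y => ?_
  rw [mul_sub, Multiplier.compat, ← mul_assoc (x ⊗ₜ y), Multiplier.compat, mul_assoc, sub_self]

lemma T₁_mul (a b : A) (t : A ⊗[ℂ] A) :
    G.T₁ (a ⊗ₜ b) * t = (G.Δ a).lmul ((Multiplier.tmul 1 (Multiplier.of b)).lmul t) := by
  rw [← Multiplier.lmul_mul, ← G.T₁_spec, Multiplier.lmul_of]

lemma T₂_mul (a b : A) (t : A ⊗[ℂ] A) :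
    G.T₂ (a ⊗ₜ b) * t = (Multiplier.tmul (Multiplier.of a) 1).lmul ((G.Δ b).lmul t) := by
  rw [← Multiplier.lmul_mul, ← G.T₂_spec, Multiplier.lmul_of]

lemma T₃_mul (a b : A) (t : A ⊗[ℂ] A) :
    G.T₃ (a ⊗ₜ b) * t = (G.Δ a).lmul ((Multiplier.tmul (Multiplier.of b) 1).lmul t) := by
  rw [← Multiplier.lmul_mul, ← G.T₃_spec, Multiplier.lmul_of]

lemma lTensor_mulRight_mul (e x y : A) (t : A ⊗[ℂ] A) :
    ((LinearMap.mul ℂ A).flip e).lTensor A t * (x ⊗ₜ y) = t * (x ⊗ₜ (e * y)) := by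
  induction t with
  | zero => simp
  | add s t hs ht => simp only [map_add, add_mul, hs, ht]
  | tmul a n => simp [mul_assoc]

lemma rTensor_mulRight_mul (e x y : A) (t : A ⊗[ℂ] A) :
    ((LinearMap.mul ℂ A).flip e).rTensor A t * (x ⊗ₜ y) = t * ((e * x) ⊗ₜ y) := by
  induction t with
  | zero => simp
  | add s t hs ht => simp only [map_add, add_mul, hs, ht]
  | tmul a n => simp [mul_assoc]

lemma rTensor_mulLeft_mul (e : A) (s t : A ⊗[ℂ] A) :
    (LinearMap.mul ℂ A e).rTensor A t * s =
      (Multiplier.tmul (Multiplier.of e) 1).lmul (t * s) := by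
  induction t with
  | zero => simp
  | add s t hs ht => simp only [map_add, add_mul, hs, ht]
  | tmul a n =>
    induction s with
    | zero => simp
    | add s t hs ht => simp only [map_add, mul_add, hs, ht]
    | tmul b m => simp [mul_assoc]

lemma lTensor_T₃ (a c e : A) :
    ((LinearMap.mul ℂ A).flip e).lTensor A (G.T₃ (a ⊗ₜ c)) = (G.Δ a).lmul (c ⊗ₜ e) := by
  refine G.tensor_ext_mul fun x y => ?_
  rw [lTensor_mulRight_mul, T₃_mul, ← G.lmul_mul_assoc]
  simp

lemma rTensor_T₁ (a c e : A) :
    ((LinearMap.mul ℂ A).flip c).rTensor A (G.T₁ (a ⊗ₜ e)) = (G.Δ a).lmul (c ⊗ₜ e) := by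
  refine G.tensor_ext_mul fun x y => ?_
  rw [rTensor_mulRight_mul, T₁_mul, ← G.lmul_mul_assoc]
  simp

lemma rTensor_T₂ (a c e : A) :
    ((LinearMap.mul ℂ A).flip c).rTensor A (G.T₂ (e ⊗ₜ a)) =
      (LinearMap.mul ℂ A e).rTensor A (G.T₃ (a ⊗ₜ c)) := by
  refine G.tensor_ext_mul fun x y => ?_
  rw [rTensor_mulRight_mul, T₂_mul, rTensor_mulLeft_mul, T₃_mul]
  simp

lemma lmul_T₃ (a : A) (p q : A) : (G.Δ a).lmul (G.T₃ (p ⊗ₜ q)) = G.T₃ ((a * p) ⊗ₜ q) := by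
  refine G.tensor_ext_mul fun x y => ?_
  rw [← G.lmul_mul_assoc, T₃_mul, T₃_mul, map_mul, Multiplier.lmul_mul]

variable {G}

/-- `(a ◁ b) e = (b ⊗ ι)(Δ(a)(1 ⊗ e))`. -/
lemma Dual.actR_mul (b : G.Dual) (a e : A) : b.actR a * e = sliceL b.1 (G.T₁ (a ⊗ₜ e)) := by
  have h : b.1 = G.φ ∘ₗ (LinearMap.mul ℂ A).flip b.rep := LinearMap.ext fun x => b.rep_spec x
  rw [h, ← sliceL_rTensor, rTensor_T₁, ← lTensor_T₃, sliceL_lTensor]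
  rfl

lemma Dual.mul_mem (b b' : G.Dual) : b'.1 ∘ₗ b.actR ∈ LinearMap.range G.fourier := by
  refine ⟨sliceR G.φ (G.T₃.symm (b.rep ⊗ₜ b'.rep)), LinearMap.ext fun a => ?_⟩
  have h : b'.1 (b.actR a) = G.φ (sliceL G.φ ((G.Δ a).lmul (b.rep ⊗ₜ b'.rep))) := by
    rw [b'.rep_spec, ← lTensor_T₃, sliceL_lTensor]; rfl
  rw [fourier_apply, LinearMap.comp_apply, h]
  obtain ⟨s, hs⟩ := G.T₃.surjective (b.rep ⊗ₜ b'.rep)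
  rw [← hs, LinearEquiv.symm_apply_apply]
  clear hs h
  induction s with
  | zero => simp
  | add s t hs ht => simp only [map_add, mul_add, hs, ht]
  | tmul p q => rw [lmul_T₃, slice_slice, G.left_invariant]; simp [mul_comm, mul_smul_comm]

/-- The product of `B`: `⟨a, bb'⟩ = ⟨a ◁ b, b'⟩ = ⟨Δ(a), b ⊗ b'⟩`. -/
noncomputable instance : Mul G.Dual := ⟨fun b b' => ⟨b'.1 ∘ₗ b.actR, Dual.mul_mem b b'⟩⟩

lemma Dual.mul_val (b b' : G.Dual) (a : A) : (b * b').1 a = b'.1 (b.actR a) := rfl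

lemma Dual.rTensor_actR (b : G.Dual) (a e : A) :
    b.actR.rTensor A (G.T₁ (a ⊗ₜ e)) = G.T₁ (b.actR a ⊗ₜ e) := by
  let P : A →ₗ[ℂ] A ⊗[ℂ] A := G.T₃.toLinearMap ∘ₗ (TensorProduct.mk ℂ A A).flip b.rep
  have key : TensorProduct.assoc ℂ A A A (P.rTensor A (G.T₁ (a ⊗ₜ e))) =
      G.T₁.toLinearMap.lTensor A (TensorProduct.assoc ℂ A A A (G.T₃ (a ⊗ₜ b.rep) ⊗ₜ e)) := by
    refine sub_eq_zero.1 <| tensor_eq_zero_of_rTensor (fun x => LinearMap.mul ℂ A x)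
      G.eq_zero_of_mul_left _ fun x => ?_
    rw [map_sub, sub_eq_zero]
    have h := congrArg (((LinearMap.mul ℂ A).flip b.rep).rTensor (A ⊗[ℂ] A)) (G.coassoc x a e)
    have h1 : ∀ t : A ⊗[ℂ] A, ((LinearMap.mul ℂ A).flip b.rep).rTensor (A ⊗[ℂ] A)
        (TensorProduct.assoc ℂ A A A (G.T₂.toLinearMap.rTensor A
          ((TensorProduct.assoc ℂ A A A).symm (x ⊗ₜ t)))) =
        (LinearMap.mul ℂ A x).rTensor (A ⊗[ℂ] A)
          (TensorProduct.assoc ℂ A A A (P.rTensor A t)) := by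
      intro t
      induction t with
      | zero => simp
      | add s t hs ht => simp only [TensorProduct.tmul_add, map_add, hs, ht]
      | tmul p q =>
        have hh : ∀ (g : A →ₗ[ℂ] A) (u : A ⊗[ℂ] A),
            g.rTensor (A ⊗[ℂ] A) (TensorProduct.assoc ℂ A A A (u ⊗ₜ q)) =
              TensorProduct.assoc ℂ A A A (g.rTensor A u ⊗ₜ q) := by
          intro g u
          induction u with
          | zero => simp
          | add s t hs ht => simp only [TensorProduct.add_tmul, map_add, hs, ht]
          | tmul p q => simp
        simp only [TensorProduct.assoc_symm_tmul, LinearMap.rTensor_tmul, LinearEquiv.coe_coe]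
        rw [hh, hh, rTensor_T₂]
        rfl
    have h2 : ∀ (g : A →ₗ[ℂ] A) (u : A ⊗[ℂ] A), g.rTensor (A ⊗[ℂ] A)
        (G.T₁.toLinearMap.lTensor A (TensorProduct.assoc ℂ A A A (u ⊗ₜ e))) =
        G.T₁.toLinearMap.lTensor A (TensorProduct.assoc ℂ A A A (g.rTensor A u ⊗ₜ e)) := by
      intro g u
      induction u with
      | zero => simp
      | add s t hs ht => simp only [TensorProduct.add_tmul, map_add, hs, ht]
      | tmul p q => simp
    rw [h1, h2, rTensor_T₂, ← h2] at h
    exact h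
  have key' := congrArg
    (fun u => TensorProduct.lid ℂ (A ⊗[ℂ] A) (G.φ.rTensor (A ⊗[ℂ] A) u)) key
  have h3 : ∀ t : A ⊗[ℂ] A, TensorProduct.lid ℂ (A ⊗[ℂ] A) (G.φ.rTensor (A ⊗[ℂ] A)
      (TensorProduct.assoc ℂ A A A (P.rTensor A t))) = b.actR.rTensor A t := by
    intro t
    induction t with
    | zero => simp
    | add s t hs ht => simp only [map_add, hs, ht]
    | tmul p q =>
      have hh : ∀ u : A ⊗[ℂ] A, TensorProduct.lid ℂ (A ⊗[ℂ] A) (G.φ.rTensor (A ⊗[ℂ] A)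
          (TensorProduct.assoc ℂ A A A (u ⊗ₜ q))) = sliceL G.φ u ⊗ₜ q := by
        intro u
        induction u with
        | zero => simp
        | add s t hs ht => simp only [TensorProduct.add_tmul, map_add, hs, ht]
        | tmul p q => simp [TensorProduct.smul_tmul']
      rw [LinearMap.rTensor_tmul, hh]
      rfl
  have h4 : ∀ u : A ⊗[ℂ] A, TensorProduct.lid ℂ (A ⊗[ℂ] A) (G.φ.rTensor (A ⊗[ℂ] A)
      (G.T₁.toLinearMap.lTensor A (TensorProduct.assoc ℂ A A A (u ⊗ₜ e)))) =
      G.T₁ (sliceL G.φ u ⊗ₜ e) := by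
    intro u
    induction u with
    | zero => simp
    | add s t hs ht => simp only [TensorProduct.add_tmul, map_add, hs, ht]
    | tmul p q => simp [← TensorProduct.smul_tmul']
  simp only [h3, h4] at key'
  exact key'

lemma ext_mul (G : AlgebraicQuantumGroup A) {x y : A} (h : ∀ e, x * e = y * e) : x = y :=
  sub_eq_zero.1 <| G.eq_zero_of_mul_right _ fun e => by rw [sub_mul, h, sub_self]

lemma Dual.actR_actR (b b' : G.Dual) (a : A) : (b * b').actR a = b'.actR (b.actR a) := by
  refine ext_mul G fun e => ?_
  rw [actR_mul, actR_mul, ← rTensor_actR, sliceL_rTensor]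
  rfl

lemma Dual.actR_add (b b' : G.Dual) (a : A) : (b + b').actR a = b.actR a + b'.actR a := by
  refine ext_mul G fun e => ?_
  rw [add_mul, actR_mul, actR_mul, actR_mul]
  simp [sliceL, LinearMap.rTensor_add]

lemma Dual.actR_smul (r : ℂ) (b : G.Dual) (a : A) : (r • b).actR a = r • b.actR a := by
  refine ext_mul G fun e => ?_
  rw [smul_mul_assoc, actR_mul, actR_mul]
  simp [sliceL, LinearMap.rTensor_smul]

lemma Dual.actR_zero (a : A) : (0 : G.Dual).actR a = 0 := by
  simpa using Dual.actR_smul 0 (0 : G.Dual) a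

noncomputable instance : NonUnitalRing G.Dual where
  left_distrib b b' b'' := Dual.ext fun a => by simp [Dual.mul_val]
  right_distrib b b' b'' := Dual.ext fun a => by simp [Dual.mul_val, Dual.actR_add]
  zero_mul b := Dual.ext fun a => by simp [Dual.mul_val, Dual.actR_zero]
  mul_zero b := Dual.ext fun a => by simp [Dual.mul_val]
  mul_assoc b b' b'' := Dual.ext fun a => by simp [Dual.mul_val, Dual.actR_actR]

instance : SMulCommClass ℂ G.Dual G.Dual :=
  ⟨fun r b b' => Dual.ext fun a => by simp [Dual.mul_val]⟩

instance : IsScalarTower ℂ G.Dual G.Dual :=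
  ⟨fun r b b' => Dual.ext fun a => by simp [Dual.mul_val, Dual.actR_smul]⟩

end DualProduct

/-! ### The objects of the dual -/

/-- `F` is the functional `⟨ · , m⟩` on `A`, for `m ∈ M(B)`:
`⟨a ◁ b, m⟩ = ⟨a, bm⟩` and `⟨b ▷ a, m⟩ = ⟨a, mb⟩`. -/
def IsExtendedPairing (G : AlgebraicQuantumGroup A) (m : Multiplier G.Dual) (F : A →ₗ[ℂ] ℂ) : Prop :=
  (∀ (a : A) (b : G.Dual), F (b.actR a) = (m.rmul b).1 a) ∧
    ∀ (a : A) (b : G.Dual), F (b.actL a) = (m.lmul b).1 a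

variable (G)

/-- The extended pairing of `A` with `M(B)`: `G.pairing m a` is `⟨a, m⟩`. -/
noncomputable def pairing (m : Multiplier G.Dual) : A →ₗ[ℂ] ℂ :=
  Classical.epsilon (G.IsExtendedPairing m)

/-- Defining property of `ψ̂`: `ψ̂(b) = ε(c)` if `b = φ( · c)`. -/
def IsDualPsi (f : G.Dual →ₗ[ℂ] ℂ) : Prop :=
  ∀ (c : A) (b : G.Dual), (∀ x, b.1 x = G.φ (x * c)) → f b = G.ε c

/-- Defining property of `φ̂`: `φ̂(b) = ε(c)` if `b = ψ(S( · )c)`. -/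
def IsDualPhi (f : G.Dual →ₗ[ℂ] ℂ) : Prop :=
  ∀ (c : A) (b : G.Dual), (∀ x, b.1 x = G.ψ (G.S x * c)) → f b = G.ε c

/-- The right integral `ψ̂` on `B`. -/
noncomputable def dualψ : G.Dual →ₗ[ℂ] ℂ := Classical.epsilon G.IsDualPsi

/-- The left integral `φ̂` on `B`. -/
noncomputable def dualφ : G.Dual →ₗ[ℂ] ℂ := Classical.epsilon G.IsDualPhi

/-- The antipode of `B` is the adjoint of the antipode of `A`: `⟨a, S(b)⟩ = ⟨S(a), b⟩`. -/
def IsDualAntipode (T : G.Dual ≃ₗ[ℂ] G.Dual) : Prop :=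
  ∀ (b : G.Dual) (a : A), (T b).1 a = b.1 (G.S a)

/-- The antipode of `B`. -/
noncomputable def dualS : G.Dual ≃ₗ[ℂ] G.Dual := Classical.epsilon G.IsDualAntipode

/-- The modular automorphism `σ̂` of `φ̂`. -/
noncomputable def dualσ : G.Dual ≃ₗ[ℂ] G.Dual := modularAutomorphism G.dualφ

/-- The modular automorphism `σ̂'` of `ψ̂`. -/
noncomputable def dualσ' : G.Dual ≃ₗ[ℂ] G.Dual := modularAutomorphism G.dualψ

/-- The modular element `δ̂ ∈ M(B)`. -/
noncomputable def dualδ : (Multiplier G.Dual)ˣ := modularElement G.dualS G.dualφ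

end AlgebraicQuantumGroup

/-
The antipode is the map `(ι ⊗ φ)(Δ(a)(1 ⊗ b)) ↦ (ι ⊗ φ)((1 ⊗ a)Δ(b))`. Left and right integrals are
faithful, and the functionals `φ(c · )`, `ψ( · c)`, `ψ(c · )` all fill the same space `B` of the
functionals `φ( · c)`; comparing these descriptions of `B` gives `σ`, `σ'` and `δ`.

The Fourier transform `c ↦ φ( · c)` identifies `A` with `B`. It turns `ψ̂` into `ε` and the product
of `B` into `c ⊗ c' ↦ (ι ⊗ φ)(T₃⁻¹(c ⊗ c'))`, where `T₃(a ⊗ b) = Δ(a)(b ⊗ 1)`, and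
`m(S ⊗ ι)T₃(p ⊗ q) = ε(p)S(q)` then gives the Plancherel formula. Moving `c` around in it with the
help of `φ ∘ S = φ( · δ)` yields `σ̂'`, and conjugation with the antipode of `B` yields `σ̂`.

For `δ̂`, the identity `Δ(σ(a)) = (S² ⊗ σ)Δ(a)` shows that the character `ε ∘ σ⁻¹` satisfies
`(ι ⊗ εσ⁻¹)Δ(a) = S²σ⁻¹(a)`, so that pairing with it is multiplication of `B` by a multiplier; this
multiplier carries `φ̂` to `φ̂ ∘ S`.
-/

open LinearMap (mulLeft mulRight)

section Slice

variable {A : Type*} [AddCommGroup A] [Module ℂ A]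

lemma sliceR_lTensor (f : A →ₗ[ℂ] ℂ) (g : A →ₗ[ℂ] A) (t : A ⊗[ℂ] A) :
    sliceR f (g.lTensor A t) = sliceR (f ∘ₗ g) t :=
  LinearMap.congr_fun (TensorProduct.ext' fun a b => by simp :
    sliceR f ∘ₗ g.lTensor A = sliceR (f ∘ₗ g)) t

lemma sliceR_rTensor (f : A →ₗ[ℂ] ℂ) (g : A →ₗ[ℂ] A) (t : A ⊗[ℂ] A) :
    sliceR f (g.rTensor A t) = g (sliceR f t) :=
  LinearMap.congr_fun (TensorProduct.ext' fun a b => by simp :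
    sliceR f ∘ₗ g.rTensor A = g ∘ₗ sliceR f) t

lemma sliceL_map (f : A →ₗ[ℂ] ℂ) (g h : A →ₗ[ℂ] A) (t : A ⊗[ℂ] A) :
    sliceL f (TensorProduct.map g h t) = h (sliceL (f ∘ₗ g) t) :=
  LinearMap.congr_fun (TensorProduct.ext' fun a b => by simp :
    sliceL f ∘ₗ TensorProduct.map g h = h ∘ₗ sliceL (f ∘ₗ g)) t

lemma sliceR_map (f : A →ₗ[ℂ] ℂ) (g h : A →ₗ[ℂ] A) (t : A ⊗[ℂ] A) :
    sliceR f (TensorProduct.map g h t) = g (sliceR (f ∘ₗ h) t) :=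
  LinearMap.congr_fun (TensorProduct.ext' fun a b => by simp :
    sliceR f ∘ₗ TensorProduct.map g h = g ∘ₗ sliceR (f ∘ₗ h)) t

lemma sliceL_comm (f : A →ₗ[ℂ] ℂ) (t : A ⊗[ℂ] A) :
    sliceL f (TensorProduct.comm ℂ A A t) = sliceR f t :=
  LinearMap.congr_fun (TensorProduct.ext' fun a b => by simp :
    sliceL f ∘ₗ (TensorProduct.comm ℂ A A).toLinearMap = sliceR f) t

lemma sliceR_comm (f : A →ₗ[ℂ] ℂ) (t : A ⊗[ℂ] A) :
    sliceR f (TensorProduct.comm ℂ A A t) = sliceL f t :=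
  LinearMap.congr_fun (TensorProduct.ext' fun a b => by simp :
    sliceR f ∘ₗ (TensorProduct.comm ℂ A A).toLinearMap = sliceL f) t

lemma apply_sliceL (f g : A →ₗ[ℂ] ℂ) (t : A ⊗[ℂ] A) : g (sliceL f t) = f (sliceR g t) :=
  LinearMap.congr_fun (TensorProduct.ext' fun a b => by simp [mul_comm] :
    g ∘ₗ sliceL f = f ∘ₗ sliceR g) t

lemma sliceR_smul (r : ℂ) (f : A →ₗ[ℂ] ℂ) (t : A ⊗[ℂ] A) : sliceR (r • f) t = r • sliceR f t := by
  simp [sliceR, LinearMap.lTensor_smul]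

lemma lTensor_smulRight (f : A →ₗ[ℂ] ℂ) (q : A) (t : A ⊗[ℂ] A) :
    (f.smulRight q).lTensor A t = sliceR f t ⊗ₜ q :=
  LinearMap.congr_fun (TensorProduct.ext' fun a b => by simp :
    (f.smulRight q).lTensor A = (TensorProduct.mk ℂ A A).flip q ∘ₗ sliceR f) t

lemma sliceL_surjective {f : A →ₗ[ℂ] ℂ} (hf : f ≠ 0) : Function.Surjective (sliceL f) := by
  obtain ⟨a, ha : f a ≠ 0⟩ := DFunLike.ne_iff.1 hf
  exact fun x => ⟨((f a)⁻¹ • a) ⊗ₜ x, by simp [ha]⟩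

lemma sliceR_surjective {f : A →ₗ[ℂ] ℂ} (hf : f ≠ 0) : Function.Surjective (sliceR f) := by
  obtain ⟨a, ha : f a ≠ 0⟩ := DFunLike.ne_iff.1 hf
  exact fun x => ⟨x ⊗ₜ ((f a)⁻¹ • a), by simp [ha]⟩

lemma tensor_ext_sliceR {X : Type*} (f : X → A →ₗ[ℂ] ℂ) (hf : ∀ a, (∀ x, f x a = 0) → a = 0)
    {s t : A ⊗[ℂ] A} (h : ∀ x, sliceR (f x) s = sliceR (f x) t) : s = t := by
  rw [← sub_eq_zero, ← map_eq_zero_iff _ (TensorProduct.comm ℂ A A).injective]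
  refine tensor_eq_zero_of_slice _ fun g => hf _ fun x => ?_
  change f x (sliceR g (TensorProduct.comm ℂ A A (s - t))) = 0
  rw [sliceR_comm, apply_sliceL, map_sub, h, sub_self, map_zero]

lemma comm_rTensor {M N : Type*} [AddCommGroup M] [Module ℂ M] [AddCommGroup N] [Module ℂ N]
    (g : M →ₗ[ℂ] M) (t : M ⊗[ℂ] N) : TensorProduct.comm ℂ M N (g.rTensor N t) =
      g.lTensor N (TensorProduct.comm ℂ M N t) :=
  (TensorProduct.map_comm _ _ t).symm

lemma comm_lTensor {M N : Type*} [AddCommGroup M] [Module ℂ M] [AddCommGroup N] [Module ℂ N]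
    (g : N →ₗ[ℂ] N) (t : M ⊗[ℂ] N) : TensorProduct.comm ℂ M N (g.lTensor M t) =
      g.rTensor M (TensorProduct.comm ℂ M N t) :=
  (TensorProduct.map_comm _ _ t).symm

lemma tensor_ext_rTensor {N X : Type*} [AddCommGroup N] [Module ℂ N] (f : X → A →ₗ[ℂ] A)
    (hf : ∀ a, (∀ x, f x a = 0) → a = 0) {s t : A ⊗[ℂ] N}
    (h : ∀ x, (f x).rTensor N s = (f x).rTensor N t) : s = t :=
  sub_eq_zero.1 <| tensor_eq_zero_of_rTensor f hf _ fun x => by rw [map_sub, h, sub_self]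

lemma tensor_ext_lTensor {N X : Type*} [AddCommGroup N] [Module ℂ N] (f : X → A →ₗ[ℂ] A)
    (hf : ∀ a, (∀ x, f x a = 0) → a = 0) {s t : N ⊗[ℂ] A}
    (h : ∀ x, (f x).lTensor N s = (f x).lTensor N t) : s = t := by
  refine (TensorProduct.comm ℂ N A).injective (tensor_ext_rTensor f hf fun x => ?_)
  rw [← comm_lTensor, ← comm_lTensor, h]

/-- If all slices `(ι ⊗ fₓ) t` vanish, then `t` lies in `A ⊗ N` with `N = ⋂ₓ ker fₓ`. -/
lemma map_eq_zero_of_sliceR_eq_zero {M X : Type*} [AddCommGroup M] [Module ℂ M]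
    (f : X → A →ₗ[ℂ] ℂ) (t : A ⊗[ℂ] A) (h : ∀ x, sliceR (f x) t = 0) (g : A ⊗[ℂ] A →ₗ[ℂ] M)
    (hg : ∀ p q, (∀ x, f x q = 0) → g (p ⊗ₜ q) = 0) : g t = 0 := by
  let N : Submodule ℂ A := ⨅ x, LinearMap.ker (f x)
  have mem_N (q : A) : q ∈ N ↔ ∀ x, f x q = 0 := by simp [N]
  have lTensor_mkQ : N.mkQ.lTensor A t = 0 := by
    refine (TensorProduct.comm ℂ A (A ⧸ N)).injective ?_
    rw [map_zero]
    refine tensor_eq_zero_of_slice _ fun k => ?_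
    have slice_mkQ : TensorProduct.rid ℂ (A ⧸ N) (k.lTensor (A ⧸ N)
        (TensorProduct.comm ℂ A (A ⧸ N) (N.mkQ.lTensor A t))) = N.mkQ (sliceL k t) :=
      LinearMap.congr_fun (TensorProduct.ext' fun p q => by simp :
        (TensorProduct.rid ℂ (A ⧸ N)).toLinearMap ∘ₗ k.lTensor (A ⧸ N) ∘ₗ
          (TensorProduct.comm ℂ A (A ⧸ N)).toLinearMap ∘ₗ N.mkQ.lTensor A =
            N.mkQ ∘ₗ sliceL k) t
    rw [slice_mkQ, Submodule.mkQ_apply, Submodule.Quotient.mk_eq_zero, mem_N]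
    intro x
    rw [apply_sliceL, h, map_zero]
  obtain ⟨u, rfl⟩ :=
    (lTensor_exact A (LinearMap.exact_subtype_mkQ N) N.mkQ_surjective t).1 lTensor_mkQ
  exact LinearMap.congr_fun (TensorProduct.ext' fun p q => hg p q ((mem_N q).1 q.2) :
    g ∘ₗ N.subtype.lTensor A = 0) u

end Slice

section Mul

variable {A : Type*} [NonUnitalRing A] [Module ℂ A] [SMulCommClass ℂ A A] [IsScalarTower ℂ A A]

lemma mul'_rTensor_mulLeft (a : A) (t : A ⊗[ℂ] A) :
    LinearMap.mul' ℂ A ((mulLeft ℂ a).rTensor A t) = a * LinearMap.mul' ℂ A t :=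
  LinearMap.congr_fun (TensorProduct.ext' fun p q => by simp [mul_assoc] :
    LinearMap.mul' ℂ A ∘ₗ (mulLeft ℂ a).rTensor A = mulLeft ℂ a ∘ₗ LinearMap.mul' ℂ A) t

lemma mul'_lTensor_mulRight (a : A) (t : A ⊗[ℂ] A) :
    LinearMap.mul' ℂ A ((mulRight ℂ a).lTensor A t) = LinearMap.mul' ℂ A t * a :=
  LinearMap.congr_fun (TensorProduct.ext' fun p q => by simp [mul_assoc] :
    LinearMap.mul' ℂ A ∘ₗ (mulRight ℂ a).lTensor A = mulRight ℂ a ∘ₗ LinearMap.mul' ℂ A) t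

end Mul

section LinearEquiv

variable {R V A B : Type*}

lemma exists_linearEquiv_of_ker_eq [Ring R] [AddCommGroup V] [Module R V] [AddCommGroup A]
    [Module R A] [AddCommGroup B] [Module R B] (p : V →ₗ[R] A) (q : V →ₗ[R] B)
    (hp : Function.Surjective p) (hq : Function.Surjective q)
    (h : LinearMap.ker p = LinearMap.ker q) : ∃ e : A ≃ₗ[R] B, ∀ v, e (p v) = q v := by
  refine ⟨(p.quotKerEquivOfSurjective hp).symm ≪≫ₗ Submodule.quotEquivOfEq _ _ h ≪≫ₗ
    q.quotKerEquivOfSurjective hq, fun v => ?_⟩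
  have symm_apply : (p.quotKerEquivOfSurjective hp).symm (p v) = Submodule.Quotient.mk v :=
    (LinearEquiv.symm_apply_eq _).2 rfl
  rw [LinearEquiv.trans_apply, LinearEquiv.trans_apply, symm_apply]
  rfl

variable [Semiring R] [AddCommMonoid V] [Module R V] [AddCommMonoid A]
  [Module R A] [AddCommMonoid B] [Module R B]

lemma exists_linearEquiv_of_range_eq (p : A →ₗ[R] V) (q : B →ₗ[R] V) (hp : Function.Injective p)
    (hq : Function.Injective q) (h : LinearMap.range p = LinearMap.range q) :
    ∃ e : A ≃ₗ[R] B, ∀ v, q (e v) = p v := by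
  refine ⟨LinearEquiv.ofInjective p hp ≪≫ₗ LinearEquiv.ofEq _ _ h ≪≫ₗ
    (LinearEquiv.ofInjective q hq).symm, fun v => ?_⟩
  exact congrArg Subtype.val (LinearEquiv.apply_symm_apply (LinearEquiv.ofInjective q hq) _)

lemma range_eq_of_comp_eq {U : Type*} [AddCommMonoid U] [Module R U] {p : A →ₗ[R] V}
    {q : B →ₗ[R] V} {u : U →ₗ[R] A} {v : U →ₗ[R] B} (hu : Function.Surjective u)
    (hv : Function.Surjective v) (h : p ∘ₗ u = q ∘ₗ v) :
    LinearMap.range p = LinearMap.range q := by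
  rw [← LinearMap.range_comp_of_range_eq_top p (LinearMap.range_eq_top.2 hu), h,
    LinearMap.range_comp_of_range_eq_top q (LinearMap.range_eq_top.2 hv)]

end LinearEquiv

namespace Multiplier

section

variable {A : Type*} [NonUnitalRing A] [Module ℂ A] [SMulCommClass ℂ A A] [IsScalarTower ℂ A A]

lemma ext {m n : Multiplier A} (hl : ∀ a, m.lmul a = n.lmul a) (hr : ∀ a, m.rmul a = n.rmul a) :
    m = n :=
  Subtype.ext (Prod.ext (LinearMap.ext hl) (MulOpposite.unop_injective (LinearMap.ext hr)))

lemma of_mul (a b : A) : of (a * b) = of a * of b :=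
  ext (fun x => mul_assoc a b x) fun x => (mul_assoc x a b).symm

@[simp] lemma tmul_of_of (a b : A) : tmul (of a) (of b) = of (a ⊗ₜ[ℂ] b) :=
  ext
    (LinearMap.congr_fun <| TensorProduct.ext' fun x y =>
      (Algebra.TensorProduct.tmul_mul_tmul a x b y).symm)
    (LinearMap.congr_fun <| TensorProduct.ext' fun x y =>
      (Algebra.TensorProduct.tmul_mul_tmul x a y b).symm)

lemma tmul_mul_tmul (m n m' n' : Multiplier A) :
    tmul m n * tmul m' n' = tmul (m * m') (n * n') :=
  ext (fun t => (TensorProduct.map_map _ _ _ _ t)) fun t => (TensorProduct.map_map _ _ _ _ t)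

lemma tmul_one_mul_one_tmul (m n : Multiplier A) : tmul m 1 * tmul 1 n = tmul m n := by
  rw [tmul_mul_tmul, mul_one, one_mul]

lemma one_tmul_mul_tmul_one (m n : Multiplier A) : tmul 1 n * tmul m 1 = tmul m n := by
  rw [tmul_mul_tmul, mul_one, one_mul]

variable (A) in
/-- The canonical map `A → M(A)` as a linear map. -/
def ofLinearMap : A →ₗ[ℂ] Multiplier A where
  toFun := of
  map_add' a b := ext (fun x => add_mul a b x) fun x => mul_add x a b
  map_smul' r a := ext (fun x => smul_mul_assoc r a x) fun x => mul_smul_comm r x a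

lemma of_lTensor_mulRight (c : A) (t : A ⊗[ℂ] A) :
    of ((mulRight ℂ c).lTensor A t) = of t * tmul 1 (of c) :=
  LinearMap.congr_fun (TensorProduct.ext' fun a b => by
    simp [ofLinearMap, ← tmul_of_of, tmul_mul_tmul, of_mul] :
    ofLinearMap _ ∘ₗ (mulRight ℂ c).lTensor A =
      mulRight ℂ (tmul 1 (of c)) ∘ₗ ofLinearMap (A ⊗[ℂ] A)) t

lemma of_lTensor_mulLeft (c : A) (t : A ⊗[ℂ] A) :
    of ((mulLeft ℂ c).lTensor A t) = tmul 1 (of c) * of t :=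
  LinearMap.congr_fun (TensorProduct.ext' fun a b => by
    simp [ofLinearMap, ← tmul_of_of, tmul_mul_tmul, of_mul] :
    ofLinearMap _ ∘ₗ (mulLeft ℂ c).lTensor A =
      mulLeft ℂ (tmul 1 (of c)) ∘ₗ ofLinearMap (A ⊗[ℂ] A)) t

lemma of_rTensor_mulRight (c : A) (t : A ⊗[ℂ] A) :
    of ((mulRight ℂ c).rTensor A t) = of t * tmul (of c) 1 :=
  LinearMap.congr_fun (TensorProduct.ext' fun a b => by
    simp [ofLinearMap, ← tmul_of_of, tmul_mul_tmul, of_mul] :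
    ofLinearMap _ ∘ₗ (mulRight ℂ c).rTensor A =
      mulRight ℂ (tmul (of c) 1) ∘ₗ ofLinearMap (A ⊗[ℂ] A)) t

lemma of_rTensor_mulLeft (c : A) (t : A ⊗[ℂ] A) :
    of ((mulLeft ℂ c).rTensor A t) = tmul (of c) 1 * of t :=
  LinearMap.congr_fun (TensorProduct.ext' fun a b => by
    simp [ofLinearMap, ← tmul_of_of, tmul_mul_tmul, of_mul] :
    ofLinearMap _ ∘ₗ (mulLeft ℂ c).rTensor A =
      mulLeft ℂ (tmul (of c) 1) ∘ₗ ofLinearMap (A ⊗[ℂ] A)) t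

section Nondegenerate

variable (hR : ∀ a : A, (∀ b, a * b = 0) → a = 0) (hL : ∀ a : A, (∀ b, b * a = 0) → a = 0)

include hR in
lemma of_injective : Function.Injective (of : A → Multiplier A) := fun a b h =>
  sub_eq_zero.1 <| hR _ fun x => by
    rw [sub_mul, ← lmul_of, h, lmul_of, sub_self]

include hL in
lemma of_lmul (m : Multiplier A) (a : A) : of (m.lmul a) = m * of a := by
  refine ext (fun b => ?_) fun b => m.compat b a
  refine sub_eq_zero.1 (hL _ fun x => ?_)
  change x * (m.lmul a * b - m.lmul (a * b)) = 0
  rw [mul_sub, ← mul_assoc, compat, compat, mul_assoc, sub_self]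

include hR in
lemma of_rmul (m : Multiplier A) (a : A) : of (m.rmul a) = of a * m := by
  refine ext (fun b => (m.compat a b).symm) fun b => ?_
  refine sub_eq_zero.1 (hR _ fun x => ?_)
  change (b * m.rmul a - m.rmul (b * a)) * x = 0
  rw [sub_mul, mul_assoc, ← compat, ← compat, mul_assoc, sub_self]

end Nondegenerate

end

end Multiplier

namespace RegularMultiplierHopfAlgebra

open Multiplier

variable {A : Type*} [NonUnitalRing A] [Module ℂ A] [SMulCommClass ℂ A A] [IsScalarTower ℂ A A]
  (H : RegularMultiplierHopfAlgebra A)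

include H

lemma ext_mul_right {x y : A} (h : ∀ e, x * e = y * e) : x = y :=
  sub_eq_zero.1 <| H.eq_zero_of_mul_right _ fun e => by rw [sub_mul, h, sub_self]

lemma ext_mul_left {x y : A} (h : ∀ e, e * x = e * y) : x = y :=
  sub_eq_zero.1 <| H.eq_zero_of_mul_left _ fun e => by rw [mul_sub, h, sub_self]

lemma ext_rTensor_mulLeft {N : Type*} [AddCommGroup N] [Module ℂ N] {s t : A ⊗[ℂ] N}
    (h : ∀ x, (mulLeft ℂ x).rTensor N s = (mulLeft ℂ x).rTensor N t) : s = t :=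
  tensor_ext_rTensor (fun x => mulLeft ℂ x) H.eq_zero_of_mul_left fun x => by rw [h]

lemma ext_rTensor_mulRight {N : Type*} [AddCommGroup N] [Module ℂ N] {s t : A ⊗[ℂ] N}
    (h : ∀ x, (mulRight ℂ x).rTensor N s = (mulRight ℂ x).rTensor N t) : s = t :=
  tensor_ext_rTensor (fun x => mulRight ℂ x) H.eq_zero_of_mul_right fun x => by rw [h]

lemma ext_lTensor_mulLeft {N : Type*} [AddCommGroup N] [Module ℂ N] {s t : N ⊗[ℂ] A}
    (h : ∀ x, (mulLeft ℂ x).lTensor N s = (mulLeft ℂ x).lTensor N t) : s = t :=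
  tensor_ext_lTensor (fun x => mulLeft ℂ x) H.eq_zero_of_mul_left fun x => by rw [h]

lemma ext_lTensor_mulRight {N : Type*} [AddCommGroup N] [Module ℂ N] {s t : N ⊗[ℂ] A}
    (h : ∀ x, (mulRight ℂ x).lTensor N s = (mulRight ℂ x).lTensor N t) : s = t :=
  tensor_ext_lTensor (fun x => mulRight ℂ x) H.eq_zero_of_mul_right fun x => by rw [h]

lemma eq_zero_of_tensor_mul (s : A ⊗[ℂ] A) (h : ∀ t, s * t = 0) : s = 0 := by
  refine H.ext_rTensor_mulRight fun x => H.ext_lTensor_mulRight fun y => ?_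
  have mulRight_mulRight (u : A ⊗[ℂ] A) :
      (mulRight ℂ y).lTensor A ((mulRight ℂ x).rTensor A u) = u * (x ⊗ₜ y) :=
    LinearMap.congr_fun (TensorProduct.ext' fun a b => by simp :
      (mulRight ℂ y).lTensor A ∘ₗ (mulRight ℂ x).rTensor A = mulRight ℂ (x ⊗ₜ y)) u
  rw [mulRight_mulRight, h, map_zero, map_zero]

lemma eq_zero_of_mul_tensor (s : A ⊗[ℂ] A) (h : ∀ t, t * s = 0) : s = 0 := by
  refine H.ext_rTensor_mulLeft fun x => H.ext_lTensor_mulLeft fun y => ?_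
  have mulLeft_mulLeft (u : A ⊗[ℂ] A) :
      (mulLeft ℂ y).lTensor A ((mulLeft ℂ x).rTensor A u) = (x ⊗ₜ y) * u :=
    LinearMap.congr_fun (TensorProduct.ext' fun a b => by simp :
      (mulLeft ℂ y).lTensor A ∘ₗ (mulLeft ℂ x).rTensor A = mulLeft ℂ (x ⊗ₜ y)) u
  rw [mulLeft_mulLeft, h, map_zero, map_zero]

lemma of_tensor_injective : Function.Injective (of : A ⊗[ℂ] A → Multiplier (A ⊗[ℂ] A)) :=
  of_injective H.eq_zero_of_tensor_mul

lemma of_lmul_tensor (m : Multiplier (A ⊗[ℂ] A)) (t : A ⊗[ℂ] A) : of (m.lmul t) = m * of t :=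
  of_lmul H.eq_zero_of_mul_tensor m t

lemma of_rmul_tensor (m : Multiplier (A ⊗[ℂ] A)) (t : A ⊗[ℂ] A) : of (m.rmul t) = of t * m :=
  of_rmul H.eq_zero_of_tensor_mul m t

end RegularMultiplierHopfAlgebra

namespace RegularMultiplierHopfAlgebra

open Multiplier

variable {A : Type*} [NonUnitalRing A] [Module ℂ A] [SMulCommClass ℂ A A] [IsScalarTower ℂ A A]
  (H : RegularMultiplierHopfAlgebra A)

lemma lTensor_mulRight_T₂ (a c e : A) :
    (mulRight ℂ c).lTensor A (H.T₂ (e ⊗ₜ a)) = (mulLeft ℂ e).rTensor A (H.T₁ (a ⊗ₜ c)) :=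
  H.of_tensor_injective <| by
    rw [of_lTensor_mulRight, of_rTensor_mulLeft, H.T₁_spec, H.T₂_spec, mul_assoc]

lemma lTensor_mulRight_T₄ (a c e : A) :
    (mulRight ℂ c).lTensor A (H.T₄ (e ⊗ₜ a)) = (mulLeft ℂ e).lTensor A (H.T₁ (a ⊗ₜ c)) :=
  H.of_tensor_injective <| by
    rw [of_lTensor_mulRight, of_lTensor_mulLeft, H.T₁_spec, H.T₄_spec, mul_assoc]

lemma rTensor_mulRight_T₄ (a c e : A) :
    (mulRight ℂ c).rTensor A (H.T₄ (e ⊗ₜ a)) = (mulLeft ℂ e).lTensor A (H.T₃ (a ⊗ₜ c)) :=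
  H.of_tensor_injective <| by
    rw [of_rTensor_mulRight, of_lTensor_mulLeft, H.T₃_spec, H.T₄_spec, mul_assoc]

lemma rTensor_mulRight_T₂ (a c e : A) :
    (mulRight ℂ c).rTensor A (H.T₂ (e ⊗ₜ a)) = (mulLeft ℂ e).rTensor A (H.T₃ (a ⊗ₜ c)) :=
  H.of_tensor_injective <| by
    rw [of_rTensor_mulRight, of_rTensor_mulLeft, H.T₃_spec, H.T₂_spec, mul_assoc]

lemma lTensor_mulLeft_T₂ (a d e : A) :
    (mulLeft ℂ e).lTensor A (H.T₂ (d ⊗ₜ a)) = (mulLeft ℂ d).rTensor A (H.T₄ (e ⊗ₜ a)) :=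
  H.of_tensor_injective <| by
    rw [of_lTensor_mulLeft, of_rTensor_mulLeft, H.T₂_spec, H.T₄_spec, ← mul_assoc, ← mul_assoc,
      one_tmul_mul_tmul_one, tmul_one_mul_one_tmul]

lemma rTensor_mulRight_T₁ (a c e : A) :
    (mulRight ℂ c).rTensor A (H.T₁ (a ⊗ₜ e)) = (mulRight ℂ e).lTensor A (H.T₃ (a ⊗ₜ c)) :=
  H.of_tensor_injective <| by
    rw [of_rTensor_mulRight, of_lTensor_mulRight, H.T₁_spec, H.T₃_spec, mul_assoc, mul_assoc,
      one_tmul_mul_tmul_one, tmul_one_mul_one_tmul]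

lemma lmul_T₁ (a p q : A) : (H.Δ a).lmul (H.T₁ (p ⊗ₜ q)) = H.T₁ ((a * p) ⊗ₜ q) :=
  H.of_tensor_injective <| by
    rw [H.of_lmul_tensor, H.T₁_spec, H.T₁_spec, map_mul, mul_assoc]

lemma rmul_T₂ (a p q : A) : (H.Δ a).rmul (H.T₂ (p ⊗ₜ q)) = H.T₂ (p ⊗ₜ (q * a)) :=
  H.of_tensor_injective <| by
    rw [H.of_rmul_tensor, H.T₂_spec, H.T₂_spec, map_mul, mul_assoc]

lemma lmul_T₃ (a p q : A) : (H.Δ a).lmul (H.T₃ (p ⊗ₜ q)) = H.T₃ ((a * p) ⊗ₜ q) :=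
  H.of_tensor_injective <| by
    rw [H.of_lmul_tensor, H.T₃_spec, H.T₃_spec, map_mul, mul_assoc]

lemma rmul_T₄ (a p q : A) : (H.Δ a).rmul (H.T₄ (p ⊗ₜ q)) = H.T₄ (p ⊗ₜ (q * a)) :=
  H.of_tensor_injective <| by
    rw [H.of_rmul_tensor, H.T₄_spec, H.T₄_spec, map_mul, mul_assoc]

lemma lmul_Δ_tmul (a x y : A) :
    (H.Δ a).lmul (x ⊗ₜ y) = (mulRight ℂ x).rTensor A (H.T₁ (a ⊗ₜ y)) :=
  H.of_tensor_injective <| by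
    rw [H.of_lmul_tensor, of_rTensor_mulRight, H.T₁_spec, mul_assoc, one_tmul_mul_tmul_one,
      tmul_of_of]

lemma rmul_Δ_tmul (a x y : A) :
    (H.Δ a).rmul (x ⊗ₜ y) = (mulLeft ℂ y).lTensor A (H.T₂ (x ⊗ₜ a)) :=
  H.of_tensor_injective <| by
    rw [H.of_rmul_tensor, of_lTensor_mulLeft, H.T₂_spec, ← mul_assoc, one_tmul_mul_tmul_one,
      tmul_of_of]

section Coassociativity

/-- The map `r ⊗ s ↦ (x ⊗ 1)Δ(r) ⊗ s`, i.e. `(x ⊗ 1 ⊗ 1)(Δ ⊗ ι)`. The factor `x` makes `Δ ⊗ ι`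
take its values in `A ⊗ A ⊗ A` rather than in its multiplier algebra. -/
def rTensorT₂ (x : A) : A ⊗[ℂ] A →ₗ[ℂ] A ⊗[ℂ] (A ⊗[ℂ] A) :=
  (TensorProduct.assoc ℂ A A A).toLinearMap ∘ₗ
    (H.T₂.toLinearMap ∘ₗ TensorProduct.mk ℂ A A x).rTensor A

lemma rTensorT₂_tmul (x r s : A) :
    H.rTensorT₂ x (r ⊗ₜ s) = TensorProduct.assoc ℂ A A A (H.T₂ (x ⊗ₜ r) ⊗ₜ s) := by
  simp [rTensorT₂]

lemma rTensorT₂_T₁ (x : A) (t : A ⊗[ℂ] A) :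
    H.rTensorT₂ x (H.T₁ t) = H.T₁.toLinearMap.lTensor A (H.rTensorT₂ x t) := by
  have rTensorT₂_eq (u : A ⊗[ℂ] A) : H.rTensorT₂ x u = TensorProduct.assoc ℂ A A A
      (H.T₂.toLinearMap.rTensor A ((TensorProduct.assoc ℂ A A A).symm (x ⊗ₜ u))) := by
    induction u with
    | zero => simp
    | add s t hs ht => simp only [map_add, TensorProduct.tmul_add, hs, ht]
    | tmul r s => simp [rTensorT₂_tmul]
  refine LinearMap.congr_fun (TensorProduct.ext' fun r s => ?_ :
    H.rTensorT₂ x ∘ₗ H.T₁.toLinearMap = H.T₁.toLinearMap.lTensor A ∘ₗ H.rTensorT₂ x) t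
  exact (rTensorT₂_eq _).trans ((H.coassoc x r s).trans (by simp [rTensorT₂_tmul]))

lemma rTensorT₂_T₁_symm (x : A) (t : A ⊗[ℂ] A) :
    H.rTensorT₂ x (H.T₁.symm t) = H.T₁.symm.toLinearMap.lTensor A (H.rTensorT₂ x t) := by
  obtain ⟨t, rfl⟩ := H.T₁.surjective t
  rw [rTensorT₂_T₁, ← LinearMap.comp_apply, ← LinearMap.lTensor_comp]
  simp

lemma lTensor_rTensorT₂ {N : Type*} [AddCommGroup N] [Module ℂ N] (F : A ⊗[ℂ] A →ₗ[ℂ] N)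
    (x r s : A) : F.lTensor A (H.rTensorT₂ x (r ⊗ₜ s)) =
      (F ∘ₗ (TensorProduct.mk ℂ A A).flip s).lTensor A (H.T₂ (x ⊗ₜ r)) := by
  rw [rTensorT₂_tmul]
  exact LinearMap.congr_fun (TensorProduct.ext' fun p q => by simp :
    F.lTensor A ∘ₗ (TensorProduct.assoc ℂ A A A).toLinearMap ∘ₗ (TensorProduct.mk ℂ _ A).flip s =
      (F ∘ₗ (TensorProduct.mk ℂ A A).flip s).lTensor A) _

lemma rTensorT₂_lTensor (g : A →ₗ[ℂ] A) (x : A) (t : A ⊗[ℂ] A) :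
    H.rTensorT₂ x (g.lTensor A t) = (g.lTensor A).lTensor A (H.rTensorT₂ x t) :=
  LinearMap.congr_fun (TensorProduct.ext' fun r s => by
    rw [LinearMap.comp_apply, LinearMap.comp_apply, lTensor_rTensorT₂, LinearMap.lTensor_tmul,
      rTensorT₂_tmul]
    exact LinearMap.congr_fun (TensorProduct.ext' fun p q => by simp :
      (TensorProduct.assoc ℂ A A A).toLinearMap ∘ₗ (TensorProduct.mk ℂ _ A).flip (g s) =
        (g.lTensor A ∘ₗ (TensorProduct.mk ℂ A A).flip s).lTensor A) _ :
    H.rTensorT₂ x ∘ₗ g.lTensor A = (g.lTensor A).lTensor A ∘ₗ H.rTensorT₂ x) t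

lemma rTensorT₂_T₄ (x z a : A) : H.rTensorT₂ x (H.T₄ (z ⊗ₜ a)) =
    (H.T₄.toLinearMap ∘ₗ TensorProduct.mk ℂ A A z).lTensor A (H.T₂ (x ⊗ₜ a)) := by
  refine tensor_ext_lTensor (fun w => (mulRight ℂ w).lTensor A)
    (fun u hu => H.ext_lTensor_mulRight fun w => by rw [hu, map_zero]) fun w => ?_
  have mulRight_T₄ : (mulRight ℂ w).lTensor A ∘ₗ H.T₄.toLinearMap ∘ₗ TensorProduct.mk ℂ A A z =
      ((mulLeft ℂ z).lTensor A ∘ₗ H.T₁.toLinearMap) ∘ₗ (TensorProduct.mk ℂ A A).flip w :=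
    LinearMap.ext fun b => H.lTensor_mulRight_T₄ b w z
  rw [← rTensorT₂_lTensor, lTensor_mulRight_T₄, rTensorT₂_lTensor, rTensorT₂_T₁,
    ← LinearMap.comp_apply, ← LinearMap.lTensor_comp, lTensor_rTensorT₂,
    ← LinearMap.comp_apply (LinearMap.lTensor A _), ← LinearMap.lTensor_comp, mulRight_T₄]

lemma lTensor_sliceR_rTensorT₂ (f : A →ₗ[ℂ] ℂ) (x : A) (t : A ⊗[ℂ] A) :
    (sliceR f).lTensor A (H.rTensorT₂ x t) = H.T₂ (x ⊗ₜ sliceR f t) :=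
  LinearMap.congr_fun (TensorProduct.ext' fun r s => by
    have sliceR_mk : sliceR f ∘ₗ (TensorProduct.mk ℂ A A).flip s = f s • LinearMap.id := by
      ext; simp
    simp [lTensor_rTensorT₂, sliceR_mk, LinearMap.lTensor_smul] :
    (sliceR f).lTensor A ∘ₗ H.rTensorT₂ x =
      H.T₂.toLinearMap ∘ₗ TensorProduct.mk ℂ A A x ∘ₗ sliceR f) t

lemma lTensor_sliceL_rTensorT₂ (f : A →ₗ[ℂ] ℂ) (x : A) (t : A ⊗[ℂ] A) :
    (sliceL f).lTensor A (H.rTensorT₂ x t) =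
      (sliceR f ∘ₗ H.T₂.toLinearMap ∘ₗ TensorProduct.mk ℂ A A x).rTensor A t :=
  LinearMap.congr_fun (TensorProduct.ext' fun r s => by
    have sliceL_mk : sliceL f ∘ₗ (TensorProduct.mk ℂ A A).flip s = f.smulRight s := by
      ext; simp
    simp [lTensor_rTensorT₂, sliceL_mk, lTensor_smulRight] :
    (sliceL f).lTensor A ∘ₗ H.rTensorT₂ x =
      (sliceR f ∘ₗ H.T₂.toLinearMap ∘ₗ TensorProduct.mk ℂ A A x).rTensor A) t

lemma T₂_sliceR_T₁ (f : A →ₗ[ℂ] ℂ) (x a z : A) :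
    H.T₂ (x ⊗ₜ sliceR f (H.T₁ (a ⊗ₜ z))) =
      (sliceR f ∘ₗ H.T₁.toLinearMap ∘ₗ (TensorProduct.mk ℂ A A).flip z).lTensor A
        (H.T₂ (x ⊗ₜ a)) := by
  rw [← lTensor_sliceR_rTensorT₂, rTensorT₂_T₁, ← LinearMap.comp_apply,
    ← LinearMap.lTensor_comp, lTensor_rTensorT₂]
  rfl

lemma T₂_sliceR_T₄ (f : A →ₗ[ℂ] ℂ) (x a z : A) :
    H.T₂ (x ⊗ₜ sliceR f (H.T₄ (z ⊗ₜ a))) =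
      (sliceR f ∘ₗ H.T₄.toLinearMap ∘ₗ TensorProduct.mk ℂ A A z).lTensor A
        (H.T₂ (x ⊗ₜ a)) := by
  rw [← lTensor_sliceR_rTensorT₂, rTensorT₂_T₄, ← LinearMap.comp_apply, ← LinearMap.lTensor_comp]

end Coassociativity

end RegularMultiplierHopfAlgebra

/-! ### The counit and the antipode -/

section Counit

namespace RegularMultiplierHopfAlgebra

variable {A : Type*} [NonUnitalRing A] [Module ℂ A] [SMulCommClass ℂ A A] [IsScalarTower ℂ A A]
  (H : RegularMultiplierHopfAlgebra A)

lemma lTensor_mul'_T₁_symm (c : A) (t : A ⊗[ℂ] A) :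
    (LinearMap.mul' ℂ A ∘ₗ H.T₁.symm.toLinearMap ∘ₗ
      (TensorProduct.mk ℂ A A).flip c).lTensor A (H.T₂ t) = LinearMap.mul' ℂ A t ⊗ₜ c := by
  refine LinearMap.congr_fun (TensorProduct.ext' fun a b => ?_ :
    (LinearMap.mul' ℂ A ∘ₗ H.T₁.symm.toLinearMap ∘ₗ (TensorProduct.mk ℂ A A).flip c).lTensor A ∘ₗ
      H.T₂.toLinearMap = (TensorProduct.mk ℂ A A).flip c ∘ₗ LinearMap.mul' ℂ A) t
  have mul'_mk (s : A) : LinearMap.mul' ℂ A ∘ₗ (TensorProduct.mk ℂ A A).flip s = mulRight ℂ s := by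
    ext
    simp
  have lTensor_mul' (u : A ⊗[ℂ] A) :
      (LinearMap.mul' ℂ A).lTensor A (H.rTensorT₂ a u) = (mulLeft ℂ a).rTensor A (H.T₁ u) :=
    LinearMap.congr_fun (TensorProduct.ext' fun r s => by
      simpa [lTensor_rTensorT₂, mul'_mk] using H.lTensor_mulRight_T₂ r s a :
      (LinearMap.mul' ℂ A).lTensor A ∘ₗ H.rTensorT₂ a =
        (mulLeft ℂ a).rTensor A ∘ₗ H.T₁.toLinearMap) u
  have h := lTensor_mul' (H.T₁.symm (b ⊗ₜ c))
  rw [rTensorT₂_T₁_symm, ← LinearMap.comp_apply, ← LinearMap.lTensor_comp,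
    lTensor_rTensorT₂] at h
  simpa [LinearMap.comp_assoc] using h

lemma rTensor_mul'_T₂_symm (b : A) (t : A ⊗[ℂ] A) :
    (LinearMap.mul' ℂ A ∘ₗ H.T₂.symm.toLinearMap).rTensor A
      ((TensorProduct.assoc ℂ A A A).symm (H.T₁.toLinearMap.lTensor A
        (TensorProduct.assoc ℂ A A A (H.T₂ t ⊗ₜ b)))) = (mulRight ℂ b).lTensor A (H.T₂ t) := by
  induction t with
  | zero => simp
  | add s t hs ht => simp only [map_add, TensorProduct.add_tmul, hs, ht]
  | tmul r s =>
    have mul'_T₂_symm : (LinearMap.mul' ℂ A ∘ₗ H.T₂.symm.toLinearMap) ∘ₗ H.T₂.toLinearMap =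
        LinearMap.mul' ℂ A := by
      ext; simp
    rw [← H.coassoc, LinearEquiv.symm_apply_apply, ← LinearMap.comp_apply,
      ← LinearMap.rTensor_comp, mul'_T₂_symm, lTensor_mulRight_T₂]
    exact LinearMap.congr_fun (TensorProduct.ext' fun p q => by simp :
      (LinearMap.mul' ℂ A).rTensor A ∘ₗ (TensorProduct.assoc ℂ A A A).symm.toLinearMap ∘ₗ
        TensorProduct.mk ℂ A _ r = (mulLeft ℂ r).rTensor A) _

/-- The functional `ε` is determined by `m(T₂⁻¹(c ⊗ q)) = ε(q)c`, for any one `c ≠ 0`. -/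
lemma exists_isCounit : ∃ ε, H.IsCounit ε := by
  rcases subsingleton_or_nontrivial A with _ | _
  · exact ⟨0, fun _ _ => Subsingleton.elim _ _, fun _ _ => Subsingleton.elim _ _⟩
  obtain ⟨c, hc⟩ := exists_ne (0 : A)
  obtain ⟨g, hg⟩ := Module.Projective.exists_dual_eq_one ℂ hc
  let ε : A →ₗ[ℂ] ℂ := g ∘ₗ LinearMap.mul' ℂ A ∘ₗ H.T₂.symm.toLinearMap ∘ₗ
    TensorProduct.mk ℂ A A c
  have mul'_T₁_symm (q d : A) : LinearMap.mul' ℂ A (H.T₁.symm (q ⊗ₜ d)) = ε q • d := by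
    simpa [hg, ε] using congrArg (sliceL g) (H.lTensor_mul'_T₁_symm d (H.T₂.symm (c ⊗ₜ q)))
  have sliceR_T₂ (t : A ⊗[ℂ] A) : sliceR ε (H.T₂ t) = LinearMap.mul' ℂ A t := by
    have h := congrArg (sliceR g) (H.lTensor_mul'_T₁_symm c t)
    have smulRight_ε : LinearMap.mul' ℂ A ∘ₗ H.T₁.symm.toLinearMap ∘ₗ
        (TensorProduct.mk ℂ A A).flip c = ε.smulRight c :=
      LinearMap.ext fun q => by simp [mul'_T₁_symm]
    rw [smulRight_ε, lTensor_smulRight] at h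
    simpa [hg] using h
  have mul'_T₂_symm (p q : A) : LinearMap.mul' ℂ A (H.T₂.symm (p ⊗ₜ q)) = ε q • p := by
    rw [← sliceR_T₂, LinearEquiv.apply_symm_apply, sliceR_tmul]
  have rTensor_mul'_T₂_symm_mk (t : A ⊗[ℂ] A) :
      (LinearMap.mul' ℂ A ∘ₗ H.T₂.symm.toLinearMap).rTensor A
        ((TensorProduct.assoc ℂ A A A).symm (c ⊗ₜ t)) = c ⊗ₜ sliceL ε t :=
    LinearMap.congr_fun (TensorProduct.ext' fun p q => by
      simp [mul'_T₂_symm, TensorProduct.smul_tmul] :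
      (LinearMap.mul' ℂ A ∘ₗ H.T₂.symm.toLinearMap).rTensor A ∘ₗ
        (TensorProduct.assoc ℂ A A A).symm.toLinearMap ∘ₗ TensorProduct.mk ℂ A _ c =
        TensorProduct.mk ℂ A A c ∘ₗ sliceL ε) t
  refine ⟨ε, fun a b => ?_, fun a b => by simp [sliceR_T₂]⟩
  have h := congrArg (sliceL g) (H.rTensor_mul'_T₂_symm b (H.T₂.symm (c ⊗ₜ a)))
  simpa [rTensor_mul'_T₂_symm_mk, hg] using h

lemma isCounit_counit : H.IsCounit H.counit := Classical.epsilon_spec H.exists_isCounit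

lemma sliceL_counit_T₁ (a b : A) : sliceL H.counit (H.T₁ (a ⊗ₜ b)) = a * b :=
  H.isCounit_counit.1 a b

lemma sliceR_counit_T₂ (a b : A) : sliceR H.counit (H.T₂ (a ⊗ₜ b)) = a * b :=
  H.isCounit_counit.2 a b

lemma mul'_T₁_symm (t : A ⊗[ℂ] A) : LinearMap.mul' ℂ A (H.T₁.symm t) = sliceL H.counit t := by
  rw [← LinearMap.congr_fun (TensorProduct.ext' H.sliceL_counit_T₁ :
    sliceL H.counit ∘ₗ H.T₁.toLinearMap = LinearMap.mul' ℂ A)]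
  simp

lemma counit_mul (a b : A) : H.counit (a * b) = H.counit a * H.counit b := by
  rcases subsingleton_or_nontrivial A with _ | _
  · simp [Subsingleton.elim (_ : A) 0]
  obtain ⟨c, hc⟩ := exists_ne (0 : A)
  have sliceL_lmul (x : A) (t : A ⊗[ℂ] A) :
      sliceL H.counit ((H.Δ x).lmul t) = x * sliceL H.counit t := by
    obtain ⟨t, rfl⟩ := H.T₁.surjective t
    refine LinearMap.congr_fun (TensorProduct.ext' fun r s => ?_ :
      sliceL H.counit ∘ₗ (H.Δ x).lmul ∘ₗ H.T₁.toLinearMap =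
        mulLeft ℂ x ∘ₗ sliceL H.counit ∘ₗ H.T₁.toLinearMap) t
    simp [lmul_T₁, sliceL_counit_T₁, mul_assoc]
  have sliceL_comp_mulRight (t : A ⊗[ℂ] A) :
      sliceL (H.counit ∘ₗ mulRight ℂ b) t = H.counit b • sliceL H.counit t := by
    obtain ⟨t, rfl⟩ := H.T₁.surjective t
    refine LinearMap.congr_fun (TensorProduct.ext' fun r s => ?_ :
      sliceL (H.counit ∘ₗ mulRight ℂ b) ∘ₗ H.T₁.toLinearMap =
        H.counit b • sliceL H.counit ∘ₗ H.T₁.toLinearMap) t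
    simp [← sliceL_rTensor, ← lmul_Δ_tmul, sliceL_lmul, sliceL_counit_T₁, mul_smul_comm]
  have h := sliceL_comp_mulRight (a ⊗ₜ c)
  simp only [sliceL_tmul, smul_smul] at h
  simpa [mul_comm] using smul_left_injective ℂ hc h

lemma counit_ne_zero [Nontrivial A] : H.counit ≠ 0 := by
  intro h
  obtain ⟨c, hc⟩ := exists_ne (0 : A)
  refine hc (H.eq_zero_of_mul_left _ fun e => ?_)
  rw [← sliceR_counit_T₂, h]
  simp [sliceR]

include H in
lemma linearMap_ext_mul {M : Type*} [AddCommGroup M] [Module ℂ M] {f g : A →ₗ[ℂ] M}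
    (h : ∀ a b, f (a * b) = g (a * b)) : f = g := by
  rcases subsingleton_or_nontrivial A with _ | _
  · exact LinearMap.ext fun x => by simp [Subsingleton.elim x 0]
  refine LinearMap.ext fun x => ?_
  obtain ⟨t, rfl⟩ := ((sliceL_surjective H.counit_ne_zero).comp H.T₁.surjective) x
  exact LinearMap.congr_fun (TensorProduct.ext' fun p q => by simp [H.sliceL_counit_T₁, h] :
    f ∘ₗ sliceL H.counit ∘ₗ H.T₁.toLinearMap = g ∘ₗ sliceL H.counit ∘ₗ H.T₁.toLinearMap) t

lemma sliceR_counit_T₁ (a b : A) : sliceR H.counit (H.T₁ (a ⊗ₜ b)) = H.counit b • a := by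
  have counit_comp_mulRight : H.counit ∘ₗ mulRight ℂ b = H.counit b • H.counit :=
    LinearMap.ext fun x => by simp [counit_mul, mul_comm]
  refine H.ext_mul_left fun e => ?_
  have h := congrArg (sliceR H.counit) (H.lTensor_mulRight_T₂ a b e)
  rw [sliceR_lTensor, sliceR_rTensor, counit_comp_mulRight, sliceR_smul, sliceR_counit_T₂] at h
  simpa [mul_smul_comm] using h.symm

lemma sliceR_counit_T₃ (a b : A) : sliceR H.counit (H.T₃ (a ⊗ₜ b)) = a * b := by
  refine H.ext_mul_left fun e => ?_
  have h := congrArg (sliceR H.counit) (H.rTensor_mulRight_T₂ a b e)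
  rw [sliceR_rTensor, sliceR_rTensor, sliceR_counit_T₂] at h
  simpa [mul_assoc] using h.symm

lemma sliceL_counit_T₄ (a b : A) : sliceL H.counit (H.T₄ (a ⊗ₜ b)) = a * b := by
  refine H.ext_mul_right fun e => ?_
  have h := congrArg (sliceL H.counit) (H.lTensor_mulRight_T₄ b e a)
  rw [sliceL_lTensor, sliceL_lTensor, sliceL_counit_T₁] at h
  simpa [mul_assoc] using h

end RegularMultiplierHopfAlgebra

end Counit

section Antipode

namespace RegularMultiplierHopfAlgebra

variable {A : Type*} [NonUnitalRing A] [Module ℂ A] [SMulCommClass ℂ A A] [IsScalarTower ℂ A A]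
  (H : RegularMultiplierHopfAlgebra A)

/-- Left invariance `(ι ⊗ f)Δ(a) = f(a)1`, multiplied by `b` on the left to stay inside `A`. -/
def IsLeftInvariant (f : A →ₗ[ℂ] ℂ) : Prop := ∀ a b, sliceR f (H.T₂ (b ⊗ₜ a)) = f a • b

/-- Right invariance `(f ⊗ ι)Δ(a) = f(a)1`, multiplied by `b` on the right to stay inside `A`. -/
def IsRightInvariant (f : A →ₗ[ℂ] ℂ) : Prop := ∀ a b, sliceL f (H.T₁ (a ⊗ₜ b)) = f a • b

/-- The bilinear map `(t, a) ↦ Δ(a) t`. -/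
def lmulΔ : A ⊗[ℂ] A →ₗ[ℂ] A →ₗ[ℂ] A ⊗[ℂ] A :=
  LinearMap.mk₂ ℂ (fun t a => (H.Δ a).lmul t) (fun _ _ _ => map_add _ _ _)
    (fun _ _ _ => map_smul _ _ _) (fun _ _ _ => by rw [map_add]; rfl)
    (fun _ _ _ => by rw [map_smul]; rfl)

/-- The bilinear map `(t, a) ↦ t Δ(a)`. -/
def rmulΔ : A ⊗[ℂ] A →ₗ[ℂ] A →ₗ[ℂ] A ⊗[ℂ] A :=
  LinearMap.mk₂ ℂ (fun t a => (H.Δ a).rmul t) (fun _ _ _ => map_add _ _ _)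
    (fun _ _ _ => map_smul _ _ _) (fun _ _ _ => by rw [map_add]; rfl)
    (fun _ _ _ => by rw [map_smul]; rfl)

@[simp] lemma lmulΔ_apply (t : A ⊗[ℂ] A) (a : A) : H.lmulΔ t a = (H.Δ a).lmul t := rfl

@[simp] lemma rmulΔ_apply (t : A ⊗[ℂ] A) (a : A) : H.rmulΔ t a = (H.Δ a).rmul t := rfl

lemma rTensor_mulLeft_T₁_comm (f : A →ₗ[ℂ] ℂ) (a x : A) (t : A ⊗[ℂ] A) :
    (mulLeft ℂ x).rTensor A (H.T₁ (TensorProduct.comm ℂ A A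
        ((sliceR f ∘ₗ H.T₁.toLinearMap ∘ₗ TensorProduct.mk ℂ A A a).lTensor A t))) =
      (sliceR f ∘ₗ H.lmulΔ t).lTensor A (H.T₂ (x ⊗ₜ a)) := by
  induction t with
  | zero => simp
  | add s t hs ht => simp only [map_add, hs, ht, LinearMap.comp_add, LinearMap.lTensor_add,
      LinearMap.add_apply]
  | tmul y z =>
    have sliceR_lmulΔ : sliceR f ∘ₗ H.lmulΔ (y ⊗ₜ z) =
        mulRight ℂ y ∘ₗ sliceR f ∘ₗ H.T₁.toLinearMap ∘ₗ (TensorProduct.mk ℂ A A).flip z :=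
      LinearMap.ext fun b => by simp [lmul_Δ_tmul, sliceR_rTensor]
    simp only [LinearMap.lTensor_tmul, TensorProduct.comm_tmul, LinearMap.comp_apply,
      LinearEquiv.coe_coe, TensorProduct.mk_apply]
    rw [← lTensor_mulRight_T₂, T₂_sliceR_T₁, ← LinearMap.comp_apply, ← LinearMap.lTensor_comp,
      sliceR_lmulΔ]

lemma rTensor_mulLeft_T₄ (f : A →ₗ[ℂ] ℂ) (b x : A) (t : A ⊗[ℂ] A) :
    (mulLeft ℂ x).rTensor A (H.T₄
        ((sliceR f ∘ₗ H.T₄.toLinearMap ∘ₗ (TensorProduct.mk ℂ A A).flip b).lTensor A t)) =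
      (sliceR f ∘ₗ H.rmulΔ t).lTensor A (H.T₂ (x ⊗ₜ b)) := by
  induction t with
  | zero => simp
  | add s t hs ht => simp only [map_add, hs, ht, LinearMap.comp_add, LinearMap.lTensor_add,
      LinearMap.add_apply]
  | tmul y z =>
    have sliceR_rmulΔ : sliceR f ∘ₗ H.rmulΔ (y ⊗ₜ z) =
        mulLeft ℂ y ∘ₗ sliceR f ∘ₗ H.T₄.toLinearMap ∘ₗ TensorProduct.mk ℂ A A z :=
      LinearMap.ext fun a => by simp [rmul_Δ_tmul, lTensor_mulLeft_T₂, sliceR_rTensor]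
    simp only [LinearMap.lTensor_tmul, LinearMap.comp_apply, LinearEquiv.coe_coe,
      TensorProduct.mk_apply, LinearMap.flip_apply]
    rw [← lTensor_mulLeft_T₂, T₂_sliceR_T₄, ← LinearMap.comp_apply, ← LinearMap.lTensor_comp,
      sliceR_rmulΔ]

namespace IsLeftInvariant

variable {H} {f : A →ₗ[ℂ] ℂ} (hf : H.IsLeftInvariant f)
include hf

lemma sliceR_T₃ (a b : A) : sliceR f (H.T₃ (a ⊗ₜ b)) = f a • b := by
  refine H.ext_mul_left fun e => ?_
  have h := congrArg (sliceR f) (H.rTensor_mulRight_T₂ a b e)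
  rw [sliceR_rTensor, sliceR_rTensor, hf] at h
  simpa [mul_smul_comm, smul_mul_assoc] using h.symm

lemma T₁_comm_lTensor_T₃ (a b q : A) :
    H.T₁ (TensorProduct.comm ℂ A A
        ((sliceR f ∘ₗ H.T₁.toLinearMap ∘ₗ TensorProduct.mk ℂ A A a).lTensor A (H.T₃ (b ⊗ₜ q)))) =
      sliceR f (H.T₁ (a ⊗ₜ b)) ⊗ₜ q := by
  refine H.ext_rTensor_mulLeft fun x => ?_
  have sliceR_lmulΔ : sliceR f ∘ₗ H.lmulΔ (H.T₃ (b ⊗ₜ q)) = (f ∘ₗ mulRight ℂ b).smulRight q :=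
    LinearMap.ext fun c => by simp [lmul_T₃, hf.sliceR_T₃]
  rw [rTensor_mulLeft_T₁_comm, sliceR_lmulΔ, lTensor_smulRight, ← sliceR_lTensor,
    lTensor_mulRight_T₂, sliceR_rTensor]
  simp

lemma T₄_lTensor_T₂ (a b q : A) :
    H.T₄ ((sliceR f ∘ₗ H.T₄.toLinearMap ∘ₗ (TensorProduct.mk ℂ A A).flip b).lTensor A
        (H.T₂ (q ⊗ₜ a))) =
      sliceR f (H.T₄ (a ⊗ₜ b)) ⊗ₜ q := by
  refine H.ext_rTensor_mulLeft fun x => ?_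
  have sliceR_rmulΔ : sliceR f ∘ₗ H.rmulΔ (H.T₂ (q ⊗ₜ a)) = (f ∘ₗ mulLeft ℂ a).smulRight q :=
    LinearMap.ext fun c => by simp [rmul_T₂, hf _ _]
  rw [rTensor_mulLeft_T₄, sliceR_rmulΔ, lTensor_smulRight, ← sliceR_lTensor,
    lTensor_mulLeft_T₂, sliceR_rTensor]
  simp

/-- In Sweedler notation `S(a₁ f(a₂ b)) q = b₁ f(a b₂) q`, where `S` will be the antipode. -/
lemma sliceL_counit_T₁_symm (t : A ⊗[ℂ] A) (q : A) :
    sliceL H.counit (H.T₁.symm (sliceR f (H.T₁ t) ⊗ₜ q)) = sliceR f (H.T₄ t) * q := by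
  induction t with
  | zero => simp
  | add s t hs ht => simp only [map_add, TensorProduct.add_tmul, hs, ht, add_mul]
  | tmul a b =>
    have counit_comp : H.counit ∘ₗ sliceR f ∘ₗ H.T₁.toLinearMap ∘ₗ TensorProduct.mk ℂ A A a =
        f ∘ₗ mulLeft ℂ a :=
      LinearMap.ext fun z => by simp [← apply_sliceL H.counit f, sliceL_counit_T₁]
    rw [← hf.T₁_comm_lTensor_T₃, LinearEquiv.symm_apply_apply, sliceL_comm, sliceR_lTensor,
      counit_comp, ← sliceR_lTensor, ← rTensor_mulRight_T₄, sliceR_rTensor]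
    simp

/-- In Sweedler notation `q S⁻¹(b₁ f(a b₂)) = q a₁ f(a₂ b)`. -/
lemma sliceR_counit_T₄_symm (t : A ⊗[ℂ] A) (q : A) :
    sliceR H.counit (H.T₄.symm (sliceR f (H.T₄ t) ⊗ₜ q)) = q * sliceR f (H.T₁ t) := by
  induction t with
  | zero => simp
  | add s t hs ht => simp only [map_add, TensorProduct.add_tmul, hs, ht, mul_add]
  | tmul a b =>
    have counit_comp : H.counit ∘ₗ sliceR f ∘ₗ H.T₄.toLinearMap ∘ₗ
        (TensorProduct.mk ℂ A A).flip b = f ∘ₗ mulRight ℂ b :=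
      LinearMap.ext fun z => by simp [← apply_sliceL H.counit f, sliceL_counit_T₄]
    rw [← hf.T₄_lTensor_T₂, LinearEquiv.symm_apply_apply, sliceR_lTensor, counit_comp,
      ← sliceR_lTensor, lTensor_mulRight_T₂, sliceR_rTensor]
    simp

lemma exists_mul_eq_sliceL_counit (hf₀ : f ≠ 0) : ∃ S : A ≃ₗ[ℂ] A,
    ∀ x q, S x * q = sliceL H.counit (H.T₁.symm (x ⊗ₜ q)) := by
  have hp : Function.Surjective (sliceR f ∘ₗ H.T₁.toLinearMap) :=
    (sliceR_surjective hf₀).comp H.T₁.surjective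
  have hq : Function.Surjective (sliceR f ∘ₗ H.T₄.toLinearMap) :=
    (sliceR_surjective hf₀).comp H.T₄.surjective
  have ker_eq : LinearMap.ker (sliceR f ∘ₗ H.T₁.toLinearMap) =
      LinearMap.ker (sliceR f ∘ₗ H.T₄.toLinearMap) := by
    ext t
    simp only [LinearMap.mem_ker, LinearMap.comp_apply, LinearEquiv.coe_coe]
    refine ⟨fun h => H.eq_zero_of_mul_right _ fun q => ?_,
      fun h => H.eq_zero_of_mul_left _ fun q => ?_⟩
    · rw [← hf.sliceL_counit_T₁_symm, h, TensorProduct.zero_tmul, map_zero, map_zero]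
    · rw [← hf.sliceR_counit_T₄_symm, h, TensorProduct.zero_tmul, map_zero, map_zero]
  obtain ⟨S, hS⟩ := exists_linearEquiv_of_ker_eq _ _ hp hq ker_eq
  refine ⟨S, fun x q => ?_⟩
  obtain ⟨t, rfl⟩ := hp x
  rw [hS]
  exact (hf.sliceL_counit_T₁_symm t q).symm

end IsLeftInvariant

lemma rTensor_mulLeft_T₁_symm {S : A →ₗ[ℂ] A}
    (hS : ∀ x q, S x * q = sliceL H.counit (H.T₁.symm (x ⊗ₜ q))) (a b c : A) :
    (mulLeft ℂ a).rTensor A (H.T₁.symm (b ⊗ₜ c)) =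
      (mulRight ℂ c ∘ₗ S).lTensor A (H.T₂ (a ⊗ₜ b)) := by
  have sliceR_counit : sliceR H.counit ∘ₗ H.T₂.toLinearMap ∘ₗ TensorProduct.mk ℂ A A a =
      mulLeft ℂ a :=
    LinearMap.ext fun b => by simp [sliceR_counit_T₂]
  have sliceL_counit : (sliceL H.counit ∘ₗ H.T₁.symm.toLinearMap) ∘ₗ
      (TensorProduct.mk ℂ A A).flip c = mulRight ℂ c ∘ₗ S :=
    LinearMap.ext fun b => by simp [hS]
  have h := congrArg ((sliceL H.counit).lTensor A) (H.rTensorT₂_T₁_symm a (b ⊗ₜ c))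
  rwa [lTensor_sliceL_rTensorT₂, ← LinearMap.comp_apply (LinearMap.lTensor A _),
    ← LinearMap.lTensor_comp, lTensor_rTensorT₂, sliceR_counit, sliceL_counit] at h

lemma isAntipode_of_mul_eq {S : A ≃ₗ[ℂ] A}
    (hS : ∀ x q, S x * q = sliceL H.counit (H.T₁.symm (x ⊗ₜ q))) : H.IsAntipode S := by
  refine ⟨fun a b => ?_, fun a b => H.ext_mul_right fun c => ?_⟩
  · have mul'_rTensor (t : A ⊗[ℂ] A) :
        LinearMap.mul' ℂ A (S.toLinearMap.rTensor A t) = sliceL H.counit (H.T₁.symm t) :=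
      LinearMap.congr_fun (TensorProduct.ext' fun p q => by simp [hS] :
        LinearMap.mul' ℂ A ∘ₗ S.toLinearMap.rTensor A =
          sliceL H.counit ∘ₗ H.T₁.symm.toLinearMap) t
    simp [mul'_rTensor]
  · have h := congrArg (LinearMap.mul' ℂ A)
      (H.rTensor_mulLeft_T₁_symm (S := S.toLinearMap) hS a b c)
    rw [mul'_rTensor_mulLeft, mul'_T₁_symm, LinearMap.lTensor_comp, LinearMap.comp_apply,
      mul'_lTensor_mulRight] at h
    rw [← h]
    simp [mul_smul_comm, smul_mul_assoc]

variable {H} in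
lemma IsLeftInvariant.isAntipode_antipode {f : A →ₗ[ℂ] ℂ} (hf : H.IsLeftInvariant f)
    (hf₀ : f ≠ 0) : H.IsAntipode H.antipode := by
  obtain ⟨S, hS⟩ := hf.exists_mul_eq_sliceL_counit hf₀
  exact Classical.epsilon_spec ⟨S, H.isAntipode_of_mul_eq hS⟩

namespace IsAntipode

variable {H} {S : A ≃ₗ[ℂ] A} (hS : H.IsAntipode S)
include hS

lemma mul_eq (x q : A) : S x * q = sliceL H.counit (H.T₁.symm (x ⊗ₜ q)) := by
  have mul'_rTensor (t : A ⊗[ℂ] A) :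
      LinearMap.mul' ℂ A (S.toLinearMap.rTensor A (H.T₁ t)) = sliceL H.counit t :=
    LinearMap.congr_fun (TensorProduct.ext' fun p q => by simp [hS.1] :
      LinearMap.mul' ℂ A ∘ₗ S.toLinearMap.rTensor A ∘ₗ H.T₁.toLinearMap = sliceL H.counit) t
  rw [← mul'_rTensor]
  simp

lemma map_mul (x y : A) : S (x * y) = S y * S x := by
  refine H.ext_mul_right fun q => ?_
  have lmul_T₁' (a : A) (t : A ⊗[ℂ] A) :
      (H.Δ a).lmul (H.T₁ t) = H.T₁ ((mulLeft ℂ a).rTensor A t) :=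
    LinearMap.congr_fun (TensorProduct.ext' fun p q => by simp [lmul_T₁] :
      (H.Δ a).lmul ∘ₗ H.T₁.toLinearMap = H.T₁.toLinearMap ∘ₗ (mulLeft ℂ a).rTensor A) t
  have counit_comp (r : A) : H.counit ∘ₗ mulLeft ℂ r = H.counit r • H.counit :=
    LinearMap.ext fun x => by simp [counit_mul]
  have sliceL_counit (u : A ⊗[ℂ] A) :
      sliceL H.counit (H.T₁.symm ((mulRight ℂ y).rTensor A (H.T₁ u))) =
        S y * sliceL H.counit u := by
    refine LinearMap.congr_fun (TensorProduct.ext' fun r s => ?_ :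
      sliceL H.counit ∘ₗ H.T₁.symm.toLinearMap ∘ₗ (mulRight ℂ y).rTensor A ∘ₗ H.T₁.toLinearMap =
        mulLeft ℂ (S y) ∘ₗ sliceL H.counit) u
    simp only [LinearMap.comp_apply, LinearEquiv.coe_coe, LinearMap.mulLeft_apply, sliceL_tmul]
    rw [← lmul_Δ_tmul, ← H.T₁.apply_symm_apply (y ⊗ₜ s), lmul_T₁', LinearEquiv.symm_apply_apply,
      sliceL_rTensor, counit_comp, mul_smul_comm, hS.mul_eq]
    simp [sliceL, LinearMap.rTensor_smul]
  have h := sliceL_counit (H.T₁.symm (x ⊗ₜ q))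
  rw [LinearEquiv.apply_symm_apply, ← hS.mul_eq] at h
  rw [mul_assoc, ← h, hS.mul_eq]
  simp

lemma symm_map_mul (x y : A) : S.symm (x * y) = S.symm y * S.symm x :=
  S.injective (by simp [hS.map_mul])

lemma counit_apply (x : A) : H.counit (S x) = H.counit x := by
  rcases subsingleton_or_nontrivial A with _ | _
  · simp [Subsingleton.elim x 0]
  obtain ⟨q, hq : H.counit q ≠ 0⟩ := DFunLike.ne_iff.1 H.counit_ne_zero
  have counit_sliceL (t : A ⊗[ℂ] A) :
      H.counit (sliceL H.counit (H.T₁ t)) = H.counit (sliceL H.counit t) :=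
    LinearMap.congr_fun (TensorProduct.ext' fun a b => by simp [sliceL_counit_T₁, counit_mul] :
      H.counit ∘ₗ sliceL H.counit ∘ₗ H.T₁.toLinearMap = H.counit ∘ₗ sliceL H.counit) t
  refine mul_right_cancel₀ hq ?_
  rw [← counit_mul, hS.mul_eq, ← counit_sliceL, LinearEquiv.apply_symm_apply]
  simp

lemma counit_symm_apply (x : A) : H.counit (S.symm x) = H.counit x := by
  rw [← hS.counit_apply, LinearEquiv.apply_symm_apply]

lemma apply_sliceR_T₁ {f : A →ₗ[ℂ] ℂ} (hf : H.IsLeftInvariant f) (t : A ⊗[ℂ] A) :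
    S (sliceR f (H.T₁ t)) = sliceR f (H.T₄ t) :=
  H.ext_mul_right fun q => by rw [hS.mul_eq, hf.sliceL_counit_T₁_symm]

lemma mul'_rTensor_T₃ (a b : A) :
    LinearMap.mul' ℂ A (S.toLinearMap.rTensor A (H.T₃ (a ⊗ₜ b))) = H.counit a • S b := by
  refine H.ext_mul_right fun e => ?_
  have lTensor_rTensor (t : A ⊗[ℂ] A) : (mulRight ℂ e).lTensor A (S.toLinearMap.rTensor A t) =
      S.toLinearMap.rTensor A ((mulRight ℂ e).lTensor A t) :=
    LinearMap.congr_fun (TensorProduct.ext' fun p q => by simp :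
      (mulRight ℂ e).lTensor A ∘ₗ S.toLinearMap.rTensor A =
        S.toLinearMap.rTensor A ∘ₗ (mulRight ℂ e).lTensor A) t
  have rTensor_mulRight (t : A ⊗[ℂ] A) : S.toLinearMap.rTensor A ((mulRight ℂ b).rTensor A t) =
      (mulLeft ℂ (S b)).rTensor A (S.toLinearMap.rTensor A t) :=
    LinearMap.congr_fun (TensorProduct.ext' fun p q => by simp [hS.map_mul] :
      S.toLinearMap.rTensor A ∘ₗ (mulRight ℂ b).rTensor A =
        (mulLeft ℂ (S b)).rTensor A ∘ₗ S.toLinearMap.rTensor A) t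
  rw [← mul'_lTensor_mulRight, lTensor_rTensor, ← rTensor_mulRight_T₁, rTensor_mulRight,
    mul'_rTensor_mulLeft, hS.1]
  simp [mul_smul_comm, smul_mul_assoc]

end IsAntipode

end RegularMultiplierHopfAlgebra

end Antipode

/-! ### Faithfulness of the integrals -/

section Contraction

variable {A : Type*} [NonUnitalRing A] [Module ℂ A] [SMulCommClass ℂ A A] [IsScalarTower ℂ A A]

/-- The bilinear map `(y ⊗ z, x) ↦ f(xz) y`. -/
def sliceRMul (f : A →ₗ[ℂ] ℂ) : A ⊗[ℂ] A →ₗ[ℂ] A →ₗ[ℂ] A :=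
  ((LinearMap.lTensorHom A ∘ₗ LinearMap.mul ℂ A).compr₂ (sliceR f)).flip

lemma sliceRMul_apply (f : A →ₗ[ℂ] ℂ) (w : A ⊗[ℂ] A) (x : A) :
    sliceRMul f w x = sliceR f ((mulLeft ℂ x).lTensor A w) := rfl

lemma sliceRMul_tmul (f : A →ₗ[ℂ] ℂ) (y z : A) :
    sliceRMul f (y ⊗ₜ z) = (f ∘ₗ mulRight ℂ z).smulRight y :=
  LinearMap.ext fun x => by simp [sliceRMul_apply]

end Contraction

namespace AlgebraicQuantumGroup

variable {A : Type*} [NonUnitalRing A] [Module ℂ A] [SMulCommClass ℂ A A] [IsScalarTower ℂ A A]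
  (G : AlgebraicQuantumGroup A)

section AntipodeCoproduct

lemma isLeftInvariant_φ : G.IsLeftInvariant G.φ := G.left_invariant'

lemma isAntipode_S : G.IsAntipode G.S := G.isLeftInvariant_φ.isAntipode_antipode G.φ_ne_zero

lemma sliceR_φ_T₁_surjective : Function.Surjective (sliceR G.φ ∘ₗ G.T₁.toLinearMap) :=
  (sliceR_surjective G.φ_ne_zero).comp G.T₁.surjective

lemma S_sliceR_φ_T₁ (t : A ⊗[ℂ] A) : G.S (sliceR G.φ (G.T₁ t)) = sliceR G.φ (G.T₄ t) :=
  G.isAntipode_S.apply_sliceR_T₁ G.isLeftInvariant_φ t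

/-- The map `S ⊗ S`. -/
noncomputable def SS : A ⊗[ℂ] A →ₗ[ℂ] A ⊗[ℂ] A :=
  TensorProduct.map G.S.toLinearMap G.S.toLinearMap

lemma SS_rTensor_mulLeft (c : A) (t : A ⊗[ℂ] A) :
    G.SS ((mulLeft ℂ c).rTensor A t) = (mulRight ℂ (G.S c)).rTensor A (G.SS t) :=
  LinearMap.congr_fun (TensorProduct.ext' fun p q => by simp [SS, G.isAntipode_S.map_mul] :
    G.SS ∘ₗ (mulLeft ℂ c).rTensor A = (mulRight ℂ (G.S c)).rTensor A ∘ₗ G.SS) t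

lemma SS_rTensor_mulRight (c : A) (t : A ⊗[ℂ] A) :
    G.SS ((mulRight ℂ c).rTensor A t) = (mulLeft ℂ (G.S c)).rTensor A (G.SS t) :=
  LinearMap.congr_fun (TensorProduct.ext' fun p q => by simp [SS, G.isAntipode_S.map_mul] :
    G.SS ∘ₗ (mulRight ℂ c).rTensor A = (mulLeft ℂ (G.S c)).rTensor A ∘ₗ G.SS) t

lemma SS_lTensor_mulRight (c : A) (t : A ⊗[ℂ] A) :
    G.SS ((mulRight ℂ c).lTensor A t) = (mulLeft ℂ (G.S c)).lTensor A (G.SS t) :=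
  LinearMap.congr_fun (TensorProduct.ext' fun p q => by simp [SS, G.isAntipode_S.map_mul] :
    G.SS ∘ₗ (mulRight ℂ c).lTensor A = (mulLeft ℂ (G.S c)).lTensor A ∘ₗ G.SS) t

lemma map_S_sliceRMul_T₂ (x c : A) (w : A ⊗[ℂ] A) :
    TensorProduct.map G.S.toLinearMap (sliceRMul G.φ w) (G.T₂ (x ⊗ₜ c)) =
      (mulRight ℂ (G.S x)).rTensor A (TensorProduct.comm ℂ A A
        ((sliceR G.φ ∘ₗ G.T₄.toLinearMap ∘ₗ TensorProduct.mk ℂ A A c).lTensor A w)) := by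
  induction w with
  | zero => simp
  | add s t hs ht => simp only [map_add, TensorProduct.map_add_right, LinearMap.add_apply, hs, ht]
  | tmul y z =>
    rw [sliceRMul_tmul, ← LinearMap.rTensor_comp_lTensor, LinearMap.comp_apply, lTensor_smulRight,
      ← sliceR_lTensor, RegularMultiplierHopfAlgebra.lTensor_mulRight_T₂, sliceR_rTensor]
    simp [G.isAntipode_S.map_mul, S_sliceR_φ_T₁]

lemma SS_T₁ (a b : A) :
    G.SS (G.T₁ (a ⊗ₜ b)) = TensorProduct.comm ℂ A A (G.T₂ (G.S b ⊗ₜ G.S a)) := by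
  obtain ⟨t, rfl⟩ := G.sliceR_φ_T₁_surjective a
  induction t with
  | zero => simp
  | add s t hs ht => simp only [map_add, TensorProduct.add_tmul, TensorProduct.tmul_add, hs, ht]
  | tmul c d =>
    refine G.ext_rTensor_mulRight fun x' => ?_
    obtain ⟨x, rfl⟩ := G.S.surjective x'
    have sliceRMul_T₂ : sliceRMul G.φ (G.T₂ (G.S b ⊗ₜ d)) = G.S.toLinearMap ∘ₗ mulRight ℂ b ∘ₗ
        sliceR G.φ ∘ₗ G.T₁.toLinearMap ∘ₗ (TensorProduct.mk ℂ A A).flip d := by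
      refine LinearMap.ext fun e => ?_
      rw [sliceRMul_apply, G.lTensor_mulLeft_T₂, sliceR_rTensor]
      simp [G.isAntipode_S.map_mul, S_sliceR_φ_T₁]
    simp only [LinearMap.comp_apply, LinearEquiv.coe_coe]
    rw [← SS_rTensor_mulLeft, ← G.lTensor_mulRight_T₂, G.T₂_sliceR_T₁, S_sliceR_φ_T₁,
      G.T₂_sliceR_T₄, ← map_S_sliceRMul_T₂, SS, sliceRMul_T₂,
      ← LinearMap.comp_apply (LinearMap.lTensor A _), ← LinearMap.lTensor_comp,
      ← LinearMap.comp_apply, LinearMap.map_comp_lTensor]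

lemma SS_T₂ (a b : A) :
    G.SS (G.T₂ (b ⊗ₜ a)) = TensorProduct.comm ℂ A A (G.T₁ (G.S a ⊗ₜ G.S b)) := by
  refine G.ext_lTensor_mulLeft fun x' => ?_
  obtain ⟨x, rfl⟩ := G.S.surjective x'
  rw [← SS_lTensor_mulRight, G.lTensor_mulRight_T₂, SS_rTensor_mulLeft, SS_T₁, ← comm_lTensor,
    G.lTensor_mulRight_T₂, comm_rTensor]

lemma SS_T₃ (a b : A) :
    G.SS (G.T₃ (a ⊗ₜ b)) = TensorProduct.comm ℂ A A (G.T₄ (G.S b ⊗ₜ G.S a)) := by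
  refine G.ext_lTensor_mulLeft fun x' => ?_
  obtain ⟨x, rfl⟩ := G.S.surjective x'
  rw [← SS_lTensor_mulRight, ← G.rTensor_mulRight_T₁, SS_rTensor_mulRight, SS_T₁, ← comm_lTensor,
    G.lTensor_mulLeft_T₂, comm_rTensor]

variable {G} {f : A →ₗ[ℂ] ℂ}

lemma isRightInvariant_comp_S (hf : G.IsLeftInvariant f) :
    G.IsRightInvariant (f ∘ₗ G.S.toLinearMap) := by
  intro a b
  refine G.S.injective ?_
  have h : sliceL f (G.SS (G.T₁ (a ⊗ₜ b))) =
      G.S (sliceL (f ∘ₗ G.S.toLinearMap) (G.T₁ (a ⊗ₜ b))) := sliceL_map _ _ _ _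
  rw [SS_T₁, sliceL_comm, hf] at h
  simpa using h.symm

lemma isRightInvariant_comp_S_symm (hf : G.IsLeftInvariant f) :
    G.IsRightInvariant (f ∘ₗ G.S.symm.toLinearMap) := by
  intro a b
  obtain ⟨a, rfl⟩ := G.S.surjective a
  obtain ⟨b, rfl⟩ := G.S.surjective b
  have h : sliceR (f ∘ₗ G.S.symm.toLinearMap) (G.SS (G.T₂ (b ⊗ₜ a))) =
      G.S (sliceR ((f ∘ₗ G.S.symm.toLinearMap) ∘ₗ G.S.toLinearMap) (G.T₂ (b ⊗ₜ a))) :=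
    sliceR_map _ _ _ _
  rw [SS_T₂, sliceR_comm, LinearMap.comp_assoc] at h
  simpa [hf a b] using h

lemma isLeftInvariant_comp_S (hf : G.IsRightInvariant f) :
    G.IsLeftInvariant (f ∘ₗ G.S.toLinearMap) := by
  intro a b
  refine G.S.injective ?_
  have h : sliceR f (G.SS (G.T₂ (b ⊗ₜ a))) =
      G.S (sliceR (f ∘ₗ G.S.toLinearMap) (G.T₂ (b ⊗ₜ a))) := sliceR_map _ _ _ _
  rw [SS_T₂, sliceR_comm, hf] at h
  simpa using h.symm

variable (G)

lemma isRightInvariant_ψ : G.IsRightInvariant G.ψ := isRightInvariant_comp_S G.isLeftInvariant_φ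

end AntipodeCoproduct

section Faithfulness

lemma exists_φ_mul_ne_zero : ∃ a b, G.φ (a * b) ≠ 0 := by
  by_contra! h
  exact G.φ_ne_zero (G.linearMap_ext_mul h)

variable {G} {a : A}

lemma sliceR_φ_T₄_eq_zero (ha : ∀ b, G.φ (b * a) = 0) (b : A) :
    sliceR G.φ (G.T₄ (b ⊗ₜ a)) = 0 := by
  rw [← S_sliceR_φ_T₁, map_eq_zero_iff _ G.S.injective]
  refine G.eq_zero_of_mul_left _ fun e => ?_
  have φ_comp : G.φ ∘ₗ mulRight ℂ a = 0 := LinearMap.ext ha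
  have h := congrArg (sliceR G.φ) (G.lTensor_mulRight_T₂ b a e)
  rw [sliceR_rTensor, sliceR_lTensor, φ_comp] at h
  simpa [sliceR] using h.symm

lemma sliceR_φ_T₁_eq_zero (ha : ∀ b, G.φ (a * b) = 0) (b : A) :
    sliceR G.φ (G.T₁ (a ⊗ₜ b)) = 0 := by
  rw [← map_eq_zero_iff _ G.S.injective, S_sliceR_φ_T₁]
  refine G.eq_zero_of_mul_left _ fun e => ?_
  have φ_comp : G.φ ∘ₗ mulLeft ℂ a = 0 := LinearMap.ext ha
  have h := congrArg (sliceR G.φ) (G.lTensor_mulLeft_T₂ b e a)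
  rw [sliceR_rTensor, sliceR_lTensor, φ_comp] at h
  simpa [sliceR] using h.symm

lemma sliceR_φ_mulRight_T₂_eq_zero (ha : ∀ b, G.φ (a * b) = 0) (b e : A) :
    sliceR (G.φ ∘ₗ mulRight ℂ b) (G.T₂ (e ⊗ₜ a)) = 0 := by
  rw [← sliceR_lTensor, G.lTensor_mulRight_T₂, sliceR_rTensor, sliceR_φ_T₁_eq_zero ha, map_zero]

lemma ε_eq_zero_of_φ_mul_left (ha : ∀ b, G.φ (b * a) = 0) : G.ε a = 0 := by
  obtain ⟨c, d, hcd⟩ := G.exists_φ_mul_ne_zero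
  have h := map_eq_zero_of_sliceR_eq_zero (fun b => G.φ ∘ₗ mulLeft ℂ b)
    (G.T₃ (a ⊗ₜ G.S.symm d))
    (fun b => by rw [← sliceR_lTensor, ← G.rTensor_mulRight_T₄, sliceR_rTensor,
      sliceR_φ_T₄_eq_zero ha, map_zero])
    (G.φ ∘ₗ mulLeft ℂ c ∘ₗ LinearMap.mul' ℂ A ∘ₗ G.S.toLinearMap.rTensor A)
    (fun p q hq => by simpa [mul_assoc] using hq (c * G.S p))
  simp only [LinearMap.comp_apply, G.isAntipode_S.mul'_rTensor_T₃] at h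
  simpa [hcd] using h

lemma ε_eq_zero_of_φ_mul_right (ha : ∀ b, G.φ (a * b) = 0) : G.ε a = 0 := by
  obtain ⟨c, d, hcd⟩ := G.exists_φ_mul_ne_zero
  have h := map_eq_zero_of_sliceR_eq_zero (fun b => G.φ ∘ₗ mulRight ℂ b) (G.T₂ (G.S c ⊗ₜ a))
    (fun b => sliceR_φ_mulRight_T₂_eq_zero ha b _)
    (G.φ ∘ₗ mulRight ℂ d ∘ₗ G.S.symm.toLinearMap ∘ₗ LinearMap.mul' ℂ A ∘ₗ
      G.S.toLinearMap.lTensor A)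
    (fun p q hq => by
      simpa [G.isAntipode_S.symm_map_mul, mul_assoc] using hq (G.S.symm p * d))
  simp only [LinearMap.comp_apply, G.isAntipode_S.2] at h
  simpa [hcd] using h

lemma eq_zero_of_φ_mul_left (ha : ∀ b, G.φ (b * a) = 0) : a = 0 := by
  refine G.eq_zero_of_mul_left _ fun e => ?_
  rw [← G.sliceR_counit_T₂]
  exact map_eq_zero_of_sliceR_eq_zero (fun b => G.φ ∘ₗ mulLeft ℂ b) (G.T₂ (e ⊗ₜ a))
    (fun b => by rw [← sliceR_lTensor, G.lTensor_mulLeft_T₂, sliceR_rTensor,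
      sliceR_φ_T₄_eq_zero ha, map_zero])
    (sliceR G.ε) fun p q hq => by simp [ε_eq_zero_of_φ_mul_left hq]

lemma eq_zero_of_φ_mul_right (ha : ∀ b, G.φ (a * b) = 0) : a = 0 := by
  refine G.eq_zero_of_mul_left _ fun e => ?_
  rw [← G.sliceR_counit_T₂]
  exact map_eq_zero_of_sliceR_eq_zero (fun b => G.φ ∘ₗ mulRight ℂ b) (G.T₂ (e ⊗ₜ a))
    (fun b => sliceR_φ_mulRight_T₂_eq_zero ha b e)
    (sliceR G.ε) fun p q hq => by simp [ε_eq_zero_of_φ_mul_right hq]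

lemma ext_φ_left {x y : A} (h : ∀ b, G.φ (b * x) = G.φ (b * y)) : x = y :=
  sub_eq_zero.1 <| eq_zero_of_φ_mul_left fun b => by rw [mul_sub, map_sub, h, sub_self]

lemma ext_φ_right {x y : A} (h : ∀ b, G.φ (x * b) = G.φ (y * b)) : x = y :=
  sub_eq_zero.1 <| eq_zero_of_φ_mul_right fun b => by rw [sub_mul, map_sub, h, sub_self]

end Faithfulness

end AlgebraicQuantumGroup

/-! ### The modular automorphisms and the modular element -/

section Modular

variable {A : Type*} [NonUnitalRing A] [Module ℂ A] {f : A →ₗ[ℂ] ℂ} {σ σ' : A ≃ₗ[ℂ] A}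

lemma isModularAutomorphism_of_faithful (hf : ∀ a, (∀ b, f (b * a) = 0) → a = 0)
    (hσ : ∀ a b, f (a * b) = f (b * σ a)) : IsModularAutomorphism f σ := by
  refine ⟨fun a b => sub_eq_zero.1 <| hf _ fun x => ?_, hσ⟩
  rw [mul_sub, map_sub, ← hσ, mul_assoc, hσ, mul_assoc, hσ, mul_assoc, sub_self]

lemma isModularAutomorphism_unique (hf : ∀ a, (∀ b, f (b * a) = 0) → a = 0)
    (hσ : ∀ a b, f (a * b) = f (b * σ a)) (hσ' : ∀ a b, f (a * b) = f (b * σ' a)) : σ = σ' :=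
  LinearEquiv.ext fun a => sub_eq_zero.1 <| hf _ fun x => by
    rw [mul_sub, map_sub, ← hσ, hσ', sub_self]

lemma modularAutomorphism_eq (hf : ∀ a, (∀ b, f (b * a) = 0) → a = 0)
    (hσ : ∀ a b, f (a * b) = f (b * σ a)) :
    modularAutomorphism f = σ :=
  isModularAutomorphism_unique hf
    (Classical.epsilon_spec ⟨σ, isModularAutomorphism_of_faithful hf hσ⟩).2 hσ

end Modular

section FunctionalMul

variable {A : Type*} [NonUnitalRing A] [Module ℂ A] [SMulCommClass ℂ A A] [IsScalarTower ℂ A A]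

/-- The map `c ↦ f(· c)`; for `f = φ` it is the Fourier transform. -/
def functionalMulR (f : A →ₗ[ℂ] ℂ) : A →ₗ[ℂ] (A →ₗ[ℂ] ℂ) := (LinearMap.mul ℂ A).flip.compr₂ f

/-- The map `c ↦ f(c ·)`. -/
def functionalMulL (f : A →ₗ[ℂ] ℂ) : A →ₗ[ℂ] (A →ₗ[ℂ] ℂ) := (LinearMap.mul ℂ A).compr₂ f

@[simp] lemma functionalMulL_apply (f : A →ₗ[ℂ] ℂ) (c x : A) :
    functionalMulL f c x = f (c * x) := rfl

end FunctionalMul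

lemma comp_linearEquiv_ne_zero {R M M' N : Type*} [Semiring R] [AddCommMonoid M] [Module R M]
    [AddCommMonoid M'] [Module R M'] [AddCommMonoid N] [Module R N] {f : M →ₗ[R] N} (hf : f ≠ 0)
    (e : M' ≃ₗ[R] M) : f ∘ₗ e.toLinearMap ≠ 0 := fun h =>
  hf <| LinearMap.ext fun x => by simpa using LinearMap.congr_fun h (e.symm x)

section IntegralRange

namespace RegularMultiplierHopfAlgebra

variable {A : Type*} [NonUnitalRing A] [Module ℂ A] [SMulCommClass ℂ A A] [IsScalarTower ℂ A A]
  {H : RegularMultiplierHopfAlgebra A} {f g : A →ₗ[ℂ] ℂ}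

lemma IsRightInvariant.sliceL_T₄ (hf : H.IsRightInvariant f) (a b : A) :
    sliceL f (H.T₄ (b ⊗ₜ a)) = f a • b := by
  refine H.ext_mul_right fun e => ?_
  have h := congrArg (sliceL f) (H.lTensor_mulRight_T₄ a e b)
  rw [sliceL_lTensor, sliceL_lTensor, hf] at h
  simpa [mul_smul_comm, smul_mul_assoc] using h

lemma IsLeftInvariant.apply_sliceR_lmul_T₃ (hf : H.IsLeftInvariant f) (g : A →ₗ[ℂ] ℂ) (x : A)
    (s : A ⊗[ℂ] A) : g (sliceR f ((H.Δ x).lmul (H.T₃ s))) = f (x * sliceR g s) :=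
  LinearMap.congr_fun (TensorProduct.ext' fun p q => by
    simp [lmul_T₃, hf.sliceR_T₃, mul_comm] :
    g ∘ₗ sliceR f ∘ₗ (H.Δ x).lmul ∘ₗ H.T₃.toLinearMap = f ∘ₗ mulLeft ℂ x ∘ₗ sliceR g) s

lemma IsRightInvariant.apply_sliceR_lmul_T₁ (hg : H.IsRightInvariant g) (f : A →ₗ[ℂ] ℂ) (x : A)
    (s : A ⊗[ℂ] A) : g (sliceR f ((H.Δ x).lmul (H.T₁ s))) = g (x * sliceR f s) :=
  LinearMap.congr_fun (TensorProduct.ext' fun p q => by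
    simp [lmul_T₁, ← apply_sliceL g f, hg _ _, mul_comm] :
    g ∘ₗ sliceR f ∘ₗ (H.Δ x).lmul ∘ₗ H.T₁.toLinearMap = g ∘ₗ mulLeft ℂ x ∘ₗ sliceR f) s

lemma IsLeftInvariant.apply_sliceR_rmul_T₂ (hf : H.IsLeftInvariant f) (g : A →ₗ[ℂ] ℂ) (x : A)
    (s : A ⊗[ℂ] A) : g (sliceR f ((H.Δ x).rmul (H.T₂ s))) = f (sliceL g s * x) :=
  LinearMap.congr_fun (TensorProduct.ext' fun p q => by
    simp [rmul_T₂, hf _ _, mul_comm] :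
    g ∘ₗ sliceR f ∘ₗ (H.Δ x).rmul ∘ₗ H.T₂.toLinearMap = f ∘ₗ mulRight ℂ x ∘ₗ sliceL g) s

lemma IsRightInvariant.apply_sliceR_rmul_T₄ (hg : H.IsRightInvariant g) (f : A →ₗ[ℂ] ℂ) (x : A)
    (s : A ⊗[ℂ] A) : g (sliceR f ((H.Δ x).rmul (H.T₄ s))) = g (sliceL f s * x) :=
  LinearMap.congr_fun (TensorProduct.ext' fun p q => by
    simp [rmul_T₄, ← apply_sliceL g f, hg.sliceL_T₄, mul_comm] :
    g ∘ₗ sliceR f ∘ₗ (H.Δ x).rmul ∘ₗ H.T₄.toLinearMap = g ∘ₗ mulRight ℂ x ∘ₗ sliceL f) s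

lemma range_functionalMulR_eq (hf : H.IsLeftInvariant f) (hg : H.IsRightInvariant g)
    (hf₀ : f ≠ 0) (hg₀ : g ≠ 0) :
    LinearMap.range (functionalMulR f) = LinearMap.range (functionalMulR g) := by
  refine range_eq_of_comp_eq (u := sliceR g)
    (v := sliceR f ∘ₗ (H.T₃.trans H.T₁.symm).toLinearMap) (sliceR_surjective hg₀)
    ((sliceR_surjective hf₀).comp (H.T₃.trans H.T₁.symm).surjective)
    (LinearMap.ext fun s => LinearMap.ext fun x => ?_)
  have h := hg.apply_sliceR_lmul_T₁ f x (H.T₁.symm (H.T₃ s))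
  rw [LinearEquiv.apply_symm_apply, hf.apply_sliceR_lmul_T₃] at h
  exact h

lemma range_functionalMulL_eq (hf : H.IsLeftInvariant f) (hg : H.IsRightInvariant g)
    (hf₀ : f ≠ 0) (hg₀ : g ≠ 0) :
    LinearMap.range (functionalMulL f) = LinearMap.range (functionalMulL g) := by
  refine range_eq_of_comp_eq (u := sliceL g)
    (v := sliceL f ∘ₗ (H.T₂.trans H.T₄.symm).toLinearMap) (sliceL_surjective hg₀)
    ((sliceL_surjective hf₀).comp (H.T₂.trans H.T₄.symm).surjective)
    (LinearMap.ext fun s => LinearMap.ext fun x => ?_)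
  have h := hg.apply_sliceR_rmul_T₄ f x (H.T₄.symm (H.T₂ s))
  rw [LinearEquiv.apply_symm_apply, hf.apply_sliceR_rmul_T₂] at h
  exact h

variable (H)

lemma exists_eq_smul_id {R : A →ₗ[ℂ] A} (map_mul : ∀ a b, R (a * b) = a * R b)
    (lTensor_T₂ : ∀ a b, R.lTensor A (H.T₂ (a ⊗ₜ b)) = H.T₂ (a ⊗ₜ R b)) :
    ∃ k : ℂ, R = k • LinearMap.id := by
  rcases subsingleton_or_nontrivial A with _ | _
  · exact ⟨0, LinearMap.ext fun x => Subsingleton.elim _ _⟩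
  have sliceR_counit_comp (t : A ⊗[ℂ] A) : sliceR (H.counit ∘ₗ R) t = R (sliceR H.counit t) := by
    obtain ⟨s, rfl⟩ := H.T₂.surjective t
    exact LinearMap.congr_fun (TensorProduct.ext' fun a b => by
      simp [← sliceR_lTensor, lTensor_T₂, H.sliceR_counit_T₂, map_mul] :
      sliceR (H.counit ∘ₗ R) ∘ₗ H.T₂.toLinearMap = R ∘ₗ sliceR H.counit ∘ₗ H.T₂.toLinearMap) s
  obtain ⟨v, hv : H.counit v ≠ 0⟩ := DFunLike.ne_iff.1 H.counit_ne_zero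
  refine ⟨(H.counit v)⁻¹ * H.counit (R v), LinearMap.ext fun u => ?_⟩
  have h := sliceR_counit_comp (u ⊗ₜ v)
  simp only [sliceR_tmul, LinearMap.comp_apply, map_smul] at h
  rw [LinearMap.smul_apply, LinearMap.id_apply, mul_smul, h, smul_smul, inv_mul_cancel₀ hv,
    one_smul]

end RegularMultiplierHopfAlgebra

end IntegralRange

namespace AlgebraicQuantumGroup

open RegularMultiplierHopfAlgebra

variable {A : Type*} [NonUnitalRing A] [Module ℂ A] [SMulCommClass ℂ A A] [IsScalarTower ℂ A A]
  (G : AlgebraicQuantumGroup A)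

lemma ψ_ne_zero : G.ψ ≠ 0 := comp_linearEquiv_ne_zero G.φ_ne_zero _

lemma functionalMulR_φ_injective : Function.Injective (functionalMulR G.φ) :=
  fun _ _ h => G.ext_φ_left fun b => LinearMap.congr_fun h b

lemma functionalMulL_φ_injective : Function.Injective (functionalMulL G.φ) :=
  fun _ _ h => G.ext_φ_right fun b => LinearMap.congr_fun h b

section Uniqueness

variable {G} {f : A →ₗ[ℂ] ℂ} (hf : G.IsLeftInvariant f)
include hf

lemma exists_φ_mul_eq : ∃ R : A →ₗ[ℂ] A, ∀ x b, G.φ (x * R b) = f (x * b) := by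
  by_cases hf₀ : f = 0
  · exact ⟨0, by simp [hf₀]⟩
  have range_eq : LinearMap.range (functionalMulR f) = LinearMap.range (functionalMulR G.φ) :=
    (range_functionalMulR_eq hf G.isRightInvariant_ψ hf₀ G.ψ_ne_zero).trans
      (range_functionalMulR_eq G.isLeftInvariant_φ G.isRightInvariant_ψ G.φ_ne_zero
        G.ψ_ne_zero).symm
  obtain ⟨L, hL⟩ := (functionalMulR G.φ).exists_leftInverse_of_injective
    (LinearMap.ker_eq_bot.2 G.functionalMulR_φ_injective)
  refine ⟨L ∘ₗ functionalMulR f, fun x b => ?_⟩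
  obtain ⟨c, hc⟩ : functionalMulR f b ∈ LinearMap.range (functionalMulR G.φ) :=
    range_eq ▸ LinearMap.mem_range_self _ b
  have L_apply : L (functionalMulR f b) = c := hc ▸ LinearMap.congr_fun hL c
  rw [LinearMap.comp_apply, L_apply]
  exact LinearMap.congr_fun hc x

lemma lTensor_T₂_of_φ_mul_eq {R : A →ₗ[ℂ] A} (hR : ∀ x b, G.φ (x * R b) = f (x * b)) (a b : A) :
    R.lTensor A (G.T₂ (a ⊗ₜ b)) = G.T₂ (a ⊗ₜ R b) := by
  have φ_comp_mulRight (c : A) : G.φ ∘ₗ mulRight ℂ (R c) = f ∘ₗ mulRight ℂ c :=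
    LinearMap.ext fun x => hR x c
  have φ_comp_mulLeft (c : A) : (G.φ ∘ₗ mulLeft ℂ c) ∘ₗ R = f ∘ₗ mulLeft ℂ c :=
    LinearMap.ext fun x => hR c x
  have sliceR_T₁ (c d : A) : sliceR G.φ (G.T₁ (c ⊗ₜ R d)) = sliceR f (G.T₁ (c ⊗ₜ d)) := by
    refine G.ext_mul_left fun e => ?_
    have hφ := congrArg (sliceR G.φ) (G.lTensor_mulRight_T₂ c (R d) e)
    have hf := congrArg (sliceR f) (G.lTensor_mulRight_T₂ c d e)
    rw [sliceR_rTensor, sliceR_lTensor] at hφ hf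
    rw [φ_comp_mulRight] at hφ
    exact hφ.symm.trans hf
  refine tensor_ext_sliceR (fun c => G.φ ∘ₗ mulLeft ℂ c)
    (fun c h => G.eq_zero_of_φ_mul_left h) fun c => ?_
  rw [sliceR_lTensor, φ_comp_mulLeft, ← sliceR_lTensor, ← sliceR_lTensor, G.lTensor_mulLeft_T₂,
    G.lTensor_mulLeft_T₂, sliceR_rTensor, sliceR_rTensor, ← S_sliceR_φ_T₁, sliceR_T₁,
    G.isAntipode_S.apply_sliceR_T₁ hf]

lemma exists_eq_smul_φ : ∃ k : ℂ, f = k • G.φ := by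
  obtain ⟨R, hR⟩ := exists_φ_mul_eq hf
  have R_mul (a b : A) : R (a * b) = a * R b := G.ext_φ_left fun x => by
    rw [hR, ← mul_assoc, ← mul_assoc, hR]
  obtain ⟨k, rfl⟩ := G.exists_eq_smul_id R_mul (lTensor_T₂_of_φ_mul_eq hf hR)
  refine ⟨k, G.linearMap_ext_mul fun x u => ?_⟩
  rw [← hR]
  simp [mul_smul_comm]

end Uniqueness

section ModularAutomorphisms

lemma ψ_apply (a : A) : G.ψ a = G.φ (G.S a) := rfl

lemma S_sliceL_ψ (t : A ⊗[ℂ] A) : G.S (sliceL G.ψ t) = sliceL G.φ (G.SS t) :=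
  (sliceL_map G.φ G.S.toLinearMap G.S.toLinearMap t).symm

lemma S_sliceL_ψ_T₂ (t : A ⊗[ℂ] A) : G.S (sliceL G.ψ (G.T₂ t)) = sliceL G.ψ (G.T₃ t) :=
  LinearMap.congr_fun (TensorProduct.ext' fun a x => G.S.injective <| by
    simp [S_sliceL_ψ, SS_T₂, SS_T₃, sliceL_comm, S_sliceR_φ_T₁] :
    G.S.toLinearMap ∘ₗ sliceL G.ψ ∘ₗ G.T₂.toLinearMap = sliceL G.ψ ∘ₗ G.T₃.toLinearMap) t

/-- Both sides equal `ψ(a₁ x₁) φ(x₂ b)`. -/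
lemma φ_mul_sliceL_T₃ (a b x : A) : G.φ (x * sliceL G.φ (G.T₃ (b ⊗ₜ G.S a))) =
    G.ψ (sliceR (G.φ ∘ₗ G.S.symm.toLinearMap) (G.T₄ (G.S b ⊗ₜ a)) * x) := by
  have h₁ := congrArg (fun t => G.φ (sliceR G.φ t)) (G.rTensor_mulRight_T₄ b (G.S a) x)
  have h₂ := congrArg (fun t => G.ψ (sliceR G.φ t)) (G.lTensor_mulRight_T₂ x b a)
  have h₃ := congrArg (fun t => G.ψ (sliceR (G.φ ∘ₗ G.S.symm.toLinearMap) t))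
    (G.rTensor_mulRight_T₄ a x (G.S b))
  simp only [sliceR_rTensor, ← apply_sliceL, sliceL_lTensor] at h₁ h₂ h₃
  rw [← S_sliceL_ψ_T₂] at h₃
  simp only [LinearMap.mulRight_apply, LinearMap.mulLeft_apply, ← G.isAntipode_S.map_mul,
    LinearMap.comp_apply, LinearEquiv.coe_coe, LinearEquiv.symm_apply_apply] at h₁ h₂ h₃
  rw [← h₁, ← S_sliceR_φ_T₁, ← G.isAntipode_S.map_mul, ← ψ_apply, h₃, h₂]

lemma range_functionalMulR_φ_eq_functionalMulL_ψ :
    LinearMap.range (functionalMulR G.φ) = LinearMap.range (functionalMulL G.ψ) := by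
  let lTensorS := G.S.lTensor A
  let rTensorS := G.S.rTensor A
  refine range_eq_of_comp_eq (u := sliceL G.φ ∘ₗ (lTensorS.trans G.T₃).toLinearMap)
    (v := sliceR (G.φ ∘ₗ G.S.symm.toLinearMap) ∘ₗ (rTensorS.trans G.T₄).toLinearMap)
    ((sliceL_surjective G.φ_ne_zero).comp (lTensorS.trans G.T₃).surjective)
    ((sliceR_surjective (comp_linearEquiv_ne_zero G.φ_ne_zero _)).comp
      (rTensorS.trans G.T₄).surjective) ?_
  exact TensorProduct.ext' fun b a => LinearMap.ext fun x => G.φ_mul_sliceL_T₃ a b x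

lemma isModularAutomorphism_σ : IsModularAutomorphism G.φ G.σ := by
  obtain ⟨e, he⟩ := exists_linearEquiv_of_range_eq (functionalMulL G.φ) (functionalMulR G.φ)
    G.functionalMulL_φ_injective G.functionalMulR_φ_injective
    ((range_functionalMulL_eq G.isLeftInvariant_φ G.isRightInvariant_ψ G.φ_ne_zero
      G.ψ_ne_zero).trans G.range_functionalMulR_φ_eq_functionalMulL_ψ.symm)
  exact Classical.epsilon_spec ⟨e, isModularAutomorphism_of_faithful
    (fun a h => G.eq_zero_of_φ_mul_left h) fun a b => (LinearMap.congr_fun (he a) b).symm⟩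

lemma σ_mul (a b : A) : G.σ (a * b) = G.σ a * G.σ b := G.isModularAutomorphism_σ.1 a b

lemma σ_symm_mul (a b : A) : G.σ.symm (a * b) = G.σ.symm a * G.σ.symm b :=
  G.σ.injective (by simp [σ_mul])

lemma φ_mul_comm (a b : A) : G.φ (a * b) = G.φ (b * G.σ a) := G.isModularAutomorphism_σ.2 a b

lemma φ_mul_comm_symm (a b : A) : G.φ (a * b) = G.φ (G.σ.symm b * a) := by
  rw [φ_mul_comm (a := G.σ.symm b), LinearEquiv.apply_symm_apply]

lemma eq_zero_of_ψ_mul_left {a : A} (h : ∀ b, G.ψ (b * a) = 0) : a = 0 := by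
  rw [← map_eq_zero_iff _ G.S.injective]
  refine G.eq_zero_of_φ_mul_right fun b => ?_
  have := h (G.S.symm b)
  simpa [ψ_apply, G.isAntipode_S.map_mul] using this

lemma ψ_mul_comm (a b : A) : G.ψ (a * b) = G.ψ (b * G.S.symm (G.σ.symm (G.S a))) := by
  simp only [ψ_apply, G.isAntipode_S.map_mul, LinearEquiv.apply_symm_apply]
  rw [φ_mul_comm_symm]

lemma isModularAutomorphism_σ' : IsModularAutomorphism G.ψ G.σ' :=
  Classical.epsilon_spec ⟨G.S.trans (G.σ.symm.trans G.S.symm),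
    isModularAutomorphism_of_faithful (fun _ h => G.eq_zero_of_ψ_mul_left h) G.ψ_mul_comm⟩

lemma σ'_apply (a : A) : G.σ' a = G.S.symm (G.σ.symm (G.S a)) :=
  LinearEquiv.congr_fun (modularAutomorphism_eq (σ := G.S.trans (G.σ.symm.trans G.S.symm))
    (fun _ h => G.eq_zero_of_ψ_mul_left h) G.ψ_mul_comm) a

lemma σ'_symm_apply (a : A) : G.σ'.symm a = G.S.symm (G.σ (G.S a)) := by
  rw [LinearEquiv.symm_apply_eq, σ'_apply]
  simp

end ModularAutomorphisms

end AlgebraicQuantumGroup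

namespace Multiplier

variable {A : Type*} [NonUnitalRing A] [Module ℂ A] [SMulCommClass ℂ A A] [IsScalarTower ℂ A A]

@[simp] lemma rmul_mul (m n : Multiplier A) (b : A) : (m * n).rmul b = n.rmul (m.rmul b) := rfl

@[simp] lemma rmul_one (b : A) : (1 : Multiplier A).rmul b = b := rfl

lemma lmul_apply_mul (hA : ∀ a : A, (∀ b, b * a = 0) → a = 0) (m : Multiplier A) (a b : A) :
    m.lmul (a * b) = m.lmul a * b :=
  sub_eq_zero.1 <| hA _ fun e => by
    rw [mul_sub, m.compat, ← mul_assoc, ← mul_assoc, m.compat, sub_self]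

lemma rmul_apply_mul (hA : ∀ a : A, (∀ b, a * b = 0) → a = 0) (m : Multiplier A) (a b : A) :
    m.rmul (a * b) = a * m.rmul b :=
  sub_eq_zero.1 <| hA _ fun e => by
    rw [sub_mul, ← m.compat, mul_assoc, mul_assoc, ← m.compat, sub_self]

/-- The invertible multiplier with left multiplication `L` and right multiplication `R`. -/
def unitOfEquiv (L R : A ≃ₗ[ℂ] A) (h : ∀ a b, a * L b = R a * b) : (Multiplier A)ˣ where
  val := ⟨(L.toLinearMap, MulOpposite.op R.toLinearMap), h⟩
  inv := ⟨(L.symm.toLinearMap, MulOpposite.op R.symm.toLinearMap), fun a b => by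
    simpa using (h (R.symm a) (L.symm b)).symm⟩
  val_inv := ext (fun x => L.apply_symm_apply x) fun x => R.symm_apply_apply x
  inv_val := ext (fun x => L.symm_apply_apply x) fun x => R.apply_symm_apply x

/-- Left multiplication by an invertible multiplier. -/
def lmulEquiv (u : (Multiplier A)ˣ) : A ≃ₗ[ℂ] A :=
  LinearEquiv.ofLinearMap (u : Multiplier A).lmul (↑u⁻¹ : Multiplier A).lmul
    (LinearMap.ext fun x => by simp [← lmul_mul]) (LinearMap.ext fun x => by simp [← lmul_mul])

/-- Right multiplication by an invertible multiplier. -/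
def rmulEquiv (u : (Multiplier A)ˣ) : A ≃ₗ[ℂ] A :=
  LinearEquiv.ofLinearMap (u : Multiplier A).rmul (↑u⁻¹ : Multiplier A).rmul
    (LinearMap.ext fun x => by simp [← rmul_mul]) (LinearMap.ext fun x => by simp [← rmul_mul])

end Multiplier

namespace RegularMultiplierHopfAlgebra

variable {A : Type*} [NonUnitalRing A] [Module ℂ A] [SMulCommClass ℂ A A] [IsScalarTower ℂ A A]
  (H : RegularMultiplierHopfAlgebra A)

lemma mul_sliceL_T₁ (f : A →ₗ[ℂ] ℂ) (a b c : A) :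
    a * sliceL f (H.T₁ (c ⊗ₜ b)) = sliceL f (H.T₄ (a ⊗ₜ c)) * b := by
  have h := congrArg (sliceL f) (H.lTensor_mulRight_T₄ c b a)
  rw [sliceL_lTensor, sliceL_lTensor] at h
  exact h.symm

lemma sliceL_T₁_mul (f : A →ₗ[ℂ] ℂ) (c a b : A) :
    sliceL f (H.T₁ (c ⊗ₜ (a * b))) = sliceL f (H.T₁ (c ⊗ₜ a)) * b :=
  H.ext_mul_left fun e => by rw [mul_sliceL_T₁, ← mul_assoc, ← mul_assoc, mul_sliceL_T₁]

end RegularMultiplierHopfAlgebra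

namespace AlgebraicQuantumGroup

open RegularMultiplierHopfAlgebra

variable {A : Type*} [NonUnitalRing A] [Module ℂ A] [SMulCommClass ℂ A A] [IsScalarTower ℂ A A]
  (G : AlgebraicQuantumGroup A)

section ModularElement

lemma φ_sliceL_φ_T₄ (a c : A) : G.φ (sliceL G.φ (G.T₄ (a ⊗ₜ c))) = G.φ (G.S a) * G.φ c := by
  rw [apply_sliceL, ← S_sliceR_φ_T₁, ← ψ_apply, ← apply_sliceL, G.isRightInvariant_ψ, map_smul,
    smul_eq_mul, ψ_apply]

lemma φ_sliceL_φ_T₁ (c a : A) :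
    G.φ (sliceL G.φ (G.T₁ (c ⊗ₜ a))) = G.φ c * G.φ (G.S.symm a) := by
  have h := congrArg G.φ (isRightInvariant_comp_S_symm G.isLeftInvariant_φ |>.sliceL_T₄ a c)
  rw [apply_sliceL, ← S_sliceR_φ_T₁, LinearMap.comp_apply, LinearEquiv.coe_coe,
    LinearEquiv.symm_apply_apply, ← apply_sliceL] at h
  simpa [mul_comm] using h

lemma sliceL_φ_T₁_of_φ_mul_eq {L : A → A}
    (hL : ∀ a x, G.φ (L a * x) = G.φ (G.S.symm (a * x))) (c a : A) :
    sliceL G.φ (G.T₁ (c ⊗ₜ a)) = G.φ c • L a := by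
  refine G.ext_φ_right fun x => ?_
  rw [← sliceL_T₁_mul, φ_sliceL_φ_T₁, smul_mul_assoc, map_smul, hL, smul_eq_mul]

lemma exists_φ_mul_eq_φ_S :
    ∃ R : A ≃ₗ[ℂ] A, ∀ a x, G.φ (x * R a) = G.φ (G.S (x * a)) := by
  obtain ⟨R, hR⟩ := exists_linearEquiv_of_range_eq (functionalMulR G.ψ) (functionalMulR G.φ)
    ((injective_iff_map_eq_zero _).2 fun a h =>
      G.eq_zero_of_ψ_mul_left fun b => LinearMap.congr_fun h b)
    G.functionalMulR_φ_injective
    (range_functionalMulR_eq G.isLeftInvariant_φ G.isRightInvariant_ψ G.φ_ne_zero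
      G.ψ_ne_zero).symm
  exact ⟨R, fun a x => LinearMap.congr_fun (hR a) x⟩

lemma exists_φ_mul_eq_φ_S_symm :
    ∃ L : A ≃ₗ[ℂ] A, ∀ a x, G.φ (L a * x) = G.φ (G.S.symm (a * x)) := by
  have injective : Function.Injective (functionalMulL (G.φ ∘ₗ G.S.symm.toLinearMap)) := by
    refine (injective_iff_map_eq_zero _).2 fun a h => ?_
    rw [← map_eq_zero_iff _ G.S.symm.injective]
    refine G.eq_zero_of_φ_mul_left fun b => ?_
    have := LinearMap.congr_fun h (G.S b)
    simpa [G.isAntipode_S.symm_map_mul] using this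
  obtain ⟨L, hL⟩ := exists_linearEquiv_of_range_eq _ (functionalMulL G.φ) injective
    G.functionalMulL_φ_injective
    (range_functionalMulL_eq G.isLeftInvariant_φ
      (isRightInvariant_comp_S_symm G.isLeftInvariant_φ) G.φ_ne_zero
      (comp_linearEquiv_ne_zero G.φ_ne_zero _)).symm
  exact ⟨L, fun a x => LinearMap.congr_fun (hL a) x⟩

lemma exists_φ_ne_zero : ∃ a, G.φ a ≠ 0 := DFunLike.ne_iff.1 G.φ_ne_zero

lemma exists_isModularElement : ∃ δ, IsModularElement G.S G.φ δ := by
  obtain ⟨c, hc⟩ := G.exists_φ_ne_zero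
  obtain ⟨R, hR⟩ := G.exists_φ_mul_eq_φ_S
  obtain ⟨L, hL⟩ := G.exists_φ_mul_eq_φ_S_symm
  have sliceL_T₁ (a : A) : sliceL G.φ (G.T₁ (c ⊗ₜ a)) = G.φ c • L a :=
    G.sliceL_φ_T₁_of_φ_mul_eq hL c a
  have sliceL_T₄ (a : A) : sliceL G.φ (G.T₄ (a ⊗ₜ c)) = G.φ c • R a := by
    refine G.ext_φ_left fun x => ?_
    have T₄_mul : sliceL G.φ (G.T₄ ((x * a) ⊗ₜ c)) = x * sliceL G.φ (G.T₄ (a ⊗ₜ c)) :=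
      G.ext_mul_right fun e => by rw [← mul_sliceL_T₁, mul_assoc, mul_assoc, ← mul_sliceL_T₁]
    rw [← T₄_mul, φ_sliceL_φ_T₄, mul_smul_comm, map_smul, hR, smul_eq_mul, mul_comm]
  have compat (a b : A) : a * L b = R a * b := smul_right_injective A hc <| by
    change G.φ c • (a * L b) = G.φ c • (R a * b)
    rw [← mul_smul_comm, ← smul_mul_assoc, ← sliceL_T₁, ← sliceL_T₄, mul_sliceL_T₁]
  refine ⟨Multiplier.unitOfEquiv L R compat, fun a => ⟨mul_left_cancel₀ hc ?_,
    mul_left_cancel₀ hc ?_⟩⟩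
  · rw [mul_comm, ← φ_sliceL_φ_T₄, sliceL_T₄, map_smul, smul_eq_mul]
    rfl
  · rw [← φ_sliceL_φ_T₁, sliceL_T₁, map_smul, smul_eq_mul]
    rfl

lemma isModularElement_δ : IsModularElement G.S G.φ G.δ :=
  Classical.epsilon_spec G.exists_isModularElement

/-- The map `x ↦ δx`. -/
noncomputable def δL : A ≃ₗ[ℂ] A := Multiplier.lmulEquiv G.δ

/-- The map `x ↦ xδ`. -/
noncomputable def δR : A ≃ₗ[ℂ] A := Multiplier.rmulEquiv G.δ

lemma mul_δL (a b : A) : a * G.δL b = G.δR a * b := Multiplier.compat _ a b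

lemma δL_mul (a b : A) : G.δL (a * b) = G.δL a * b :=
  Multiplier.lmul_apply_mul G.eq_zero_of_mul_left _ a b

lemma δR_mul (a b : A) : G.δR (a * b) = a * G.δR b :=
  Multiplier.rmul_apply_mul G.eq_zero_of_mul_right _ a b

lemma δL_symm_mul (a b : A) : G.δL.symm (a * b) = G.δL.symm a * b :=
  Multiplier.lmul_apply_mul G.eq_zero_of_mul_left _ a b

lemma δR_symm_mul (a b : A) : G.δR.symm (a * b) = a * G.δR.symm b :=
  Multiplier.rmul_apply_mul G.eq_zero_of_mul_right _ a b

lemma mul_δL_symm (a b : A) : a * G.δL.symm b = G.δR.symm a * b := Multiplier.compat _ a b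

lemma δL_symm_δR (x : A) : G.δL.symm (G.δR x) = G.δR (G.δL.symm x) := G.ext_mul_left fun a => by
  rw [mul_δL_symm, ← δR_mul, ← mul_δL_symm, δR_mul]

lemma φ_S (x : A) : G.φ (G.S x) = G.φ (G.δR x) := (G.isModularElement_δ x).1

lemma φ_S_symm (x : A) : G.φ (G.S.symm x) = G.φ (G.δL x) := (G.isModularElement_δ x).2

lemma sliceL_φ_T₁ (a e : A) : sliceL G.φ (G.T₁ (a ⊗ₜ e)) = G.φ a • G.δL e :=
  G.sliceL_φ_T₁_of_φ_mul_eq (fun _ _ => by rw [φ_S_symm, δL_mul]) a e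

lemma ε_δL (x : A) : G.ε (G.δL x) = G.ε x := by
  obtain ⟨a, ha⟩ := G.exists_φ_ne_zero
  have h := congrArg G.ε (G.sliceL_φ_T₁ a x)
  rw [apply_sliceL, G.sliceR_counit_T₁, map_smul, map_smul, smul_eq_mul, smul_eq_mul,
    mul_comm] at h
  exact (mul_left_cancel₀ ha h).symm

lemma exists_ε_ne_zero : ∃ a, G.ε a ≠ 0 := by
  obtain ⟨a, ha⟩ := G.exists_φ_ne_zero
  have : Nontrivial A := ⟨a, 0, fun h => ha (by rw [h, map_zero])⟩
  exact DFunLike.ne_iff.1 G.counit_ne_zero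

lemma ε_δR (x : A) : G.ε (G.δR x) = G.ε x := by
  obtain ⟨a, ha⟩ := G.exists_ε_ne_zero
  have h := congrArg G.ε (G.mul_δL x a)
  rw [G.counit_mul, G.counit_mul, ε_δL] at h
  exact (mul_right_cancel₀ ha h).symm

lemma ε_δR_symm (x : A) : G.ε (G.δR.symm x) = G.ε x := by
  rw [← ε_δR, LinearEquiv.apply_symm_apply]

lemma S_δR_symm (x : A) : G.S (G.δR.symm x) = G.δL (G.S x) := by
  refine G.ext_φ_right fun y => ?_
  obtain ⟨y, rfl⟩ := G.S.surjective y
  rw [← G.isAntipode_S.map_mul, ← δL_mul, ← G.isAntipode_S.map_mul, ← φ_S_symm, φ_S, δR_mul]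
  simp

lemma S_δL_symm (x : A) : G.S (G.δL.symm x) = G.δR (G.S x) := by
  refine G.ext_mul_right fun y => ?_
  obtain ⟨y, rfl⟩ := G.S.surjective y
  rw [← G.isAntipode_S.map_mul, mul_δL_symm, G.isAntipode_S.map_mul, S_δR_symm, mul_δL]

lemma S_δL (x : A) : G.S (G.δL x) = G.δR.symm (G.S x) := by
  rw [LinearEquiv.eq_symm_apply, ← S_δL_symm, LinearEquiv.symm_apply_apply]

lemma φ_S_S (x : A) : G.φ (G.S (G.S x)) = G.φ (G.δR (G.δL.symm x)) := by
  rw [φ_S, ← S_δL_symm, φ_S]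

end ModularElement

section ScalingConstant

lemma exists_scalingConstant : ∃ k : ℂ, k ≠ 0 ∧ ∀ x, G.φ (G.S (G.S x)) = k * G.φ x := by
  obtain ⟨k, hk⟩ := exists_eq_smul_φ (isLeftInvariant_comp_S G.isRightInvariant_ψ)
  refine ⟨k, ?_, fun x => LinearMap.congr_fun hk x⟩
  rintro rfl
  exact comp_linearEquiv_ne_zero G.ψ_ne_zero G.S (hk.trans (zero_smul ℂ G.φ))

/-- Van Daele's scaling constant, the number `τ` with `φ ∘ S² = τφ`. -/
noncomputable def τ : ℂ := G.exists_scalingConstant.choose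

lemma τ_ne_zero : G.τ ≠ 0 := G.exists_scalingConstant.choose_spec.1

lemma φ_S_S_eq_τ_mul (x : A) : G.φ (G.S (G.S x)) = G.τ * G.φ x :=
  G.exists_scalingConstant.choose_spec.2 x

lemma φ_δR (x : A) : G.φ (G.δR x) = G.τ * G.φ (G.δL x) := by
  rw [← φ_S_S_eq_τ_mul, φ_S_S, LinearEquiv.symm_apply_apply]

lemma σ_S_S (a : A) : G.σ (G.S (G.S a)) = G.S (G.S (G.σ a)) := by
  refine G.ext_φ_left fun b => ?_
  obtain ⟨b, rfl⟩ := G.S.surjective b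
  obtain ⟨b, rfl⟩ := G.S.surjective b
  simp only [← φ_mul_comm, ← G.isAntipode_S.map_mul, φ_S_S_eq_τ_mul]

lemma δL_σ (a : A) : G.δL (G.σ a) = G.τ • G.σ (G.δL a) := by
  refine G.ext_φ_left fun b => ?_
  rw [mul_δL, ← φ_mul_comm, ← δR_mul, φ_δR, mul_smul_comm, map_smul, ← φ_mul_comm, δL_mul,
    smul_eq_mul]

lemma σ'_apply_eq_δ_conj (a : A) : G.σ' a = G.δR.symm (G.δL (G.σ a)) :=
  LinearEquiv.congr_fun (modularAutomorphism_eq (f := G.ψ)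
    (σ := G.σ.trans (G.δL.trans G.δR.symm)) (fun _ h => G.eq_zero_of_ψ_mul_left h) fun a b => by
      simp only [ψ_apply, φ_S, LinearEquiv.trans_apply]
      rw [δR_mul, δR_mul, LinearEquiv.apply_symm_apply, φ_mul_comm, mul_δL]) a

end ScalingConstant

end AlgebraicQuantumGroup

/-! ### The coproduct and the modular automorphisms -/

namespace AlgebraicQuantumGroup

open RegularMultiplierHopfAlgebra

variable {A : Type*} [NonUnitalRing A] [Module ℂ A] [SMulCommClass ℂ A A] [IsScalarTower ℂ A A]
  (G : AlgebraicQuantumGroup A)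

section ModularCoproduct

/-- The square `S²` of the antipode. -/
noncomputable def antipodeSq : A ≃ₗ[ℂ] A := G.S.trans G.S

lemma antipodeSq_apply (a : A) : G.antipodeSq a = G.S (G.S a) := rfl

lemma antipodeSq_mul (a b : A) : G.antipodeSq (a * b) = G.antipodeSq a * G.antipodeSq b := by
  simp [antipodeSq_apply, G.isAntipode_S.map_mul]

lemma ε_antipodeSq (x : A) : G.ε (G.antipodeSq x) = G.ε x := by
  rw [antipodeSq_apply, G.isAntipode_S.counit_apply, G.isAntipode_S.counit_apply]

lemma σ_symm_antipodeSq (a : A) : G.σ.symm (G.antipodeSq a) = G.antipodeSq (G.σ.symm a) := by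
  rw [LinearEquiv.symm_apply_eq, antipodeSq_apply, antipodeSq_apply, σ_S_S,
    LinearEquiv.apply_symm_apply]

lemma σ'_symm_antipodeSq (a : A) :
    G.σ'.symm (G.antipodeSq a) = G.antipodeSq (G.σ'.symm a) := by
  simp only [σ'_symm_apply, antipodeSq_apply, σ_S_S, LinearEquiv.symm_apply_apply,
    LinearEquiv.apply_symm_apply]

lemma sliceR_φ_T₄_eq_sliceR_φ_T₁ (a b : A) :
    sliceR G.φ (G.T₄ (a ⊗ₜ b)) = sliceR G.φ (G.T₁ (b ⊗ₜ G.σ a)) := by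
  refine G.ext_mul_left fun e => ?_
  have h₄ := congrArg (sliceR G.φ) (G.lTensor_mulLeft_T₂ b e a)
  have h₁ := congrArg (sliceR G.φ) (G.lTensor_mulRight_T₂ b (G.σ a) e)
  have φ_comp : G.φ ∘ₗ mulLeft ℂ a = G.φ ∘ₗ mulRight ℂ (G.σ a) :=
    LinearMap.ext fun x => G.φ_mul_comm a x
  rw [sliceR_rTensor, sliceR_lTensor] at h₁ h₄
  rw [φ_comp] at h₄
  exact h₄.symm.trans h₁

lemma map_antipodeSq_σ_T₂ (a c : A) :
    TensorProduct.map G.antipodeSq.toLinearMap G.σ.toLinearMap (G.T₂ (c ⊗ₜ a)) =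
      G.T₂ (G.antipodeSq c ⊗ₜ G.σ a) := by
  refine tensor_ext_sliceR (fun b => G.φ ∘ₗ mulLeft ℂ b)
    (fun _ h => G.eq_zero_of_φ_mul_left h) fun b => ?_
  have φ_comp_σ : (G.φ ∘ₗ mulLeft ℂ b) ∘ₗ G.σ.toLinearMap = G.φ ∘ₗ mulRight ℂ b :=
    LinearMap.ext fun x => (G.φ_mul_comm x b).symm
  rw [sliceR_map, φ_comp_σ, ← sliceR_lTensor, ← sliceR_lTensor, G.lTensor_mulRight_T₂,
    G.lTensor_mulLeft_T₂, sliceR_rTensor, sliceR_rTensor]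
  simp only [LinearMap.mulLeft_apply, LinearEquiv.coe_coe]
  rw [antipodeSq_mul, G.antipodeSq_apply (sliceR G.φ _), S_sliceR_φ_T₁,
    sliceR_φ_T₄_eq_sliceR_φ_T₁, S_sliceR_φ_T₁]

lemma map_antipodeSq_σ_T₃ (a c : A) :
    TensorProduct.map G.antipodeSq.toLinearMap G.σ.toLinearMap (G.T₃ (a ⊗ₜ c)) =
      G.T₃ (G.σ a ⊗ₜ G.antipodeSq c) := by
  have rTensor_mulLeft (e : A) (t : A ⊗[ℂ] A) :
      (mulLeft ℂ (G.antipodeSq e)).rTensor A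
          (TensorProduct.map G.antipodeSq.toLinearMap G.σ.toLinearMap t) =
        TensorProduct.map G.antipodeSq.toLinearMap G.σ.toLinearMap
          ((mulLeft ℂ e).rTensor A t) :=
    LinearMap.congr_fun (TensorProduct.ext' fun p q => by simp [antipodeSq_mul] :
      (mulLeft ℂ (G.antipodeSq e)).rTensor A ∘ₗ TensorProduct.map _ _ =
        TensorProduct.map G.antipodeSq.toLinearMap G.σ.toLinearMap ∘ₗ (mulLeft ℂ e).rTensor A) t
  have rTensor_mulRight (e : A) (t : A ⊗[ℂ] A) :
      (mulRight ℂ (G.antipodeSq e)).rTensor A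
          (TensorProduct.map G.antipodeSq.toLinearMap G.σ.toLinearMap t) =
        TensorProduct.map G.antipodeSq.toLinearMap G.σ.toLinearMap
          ((mulRight ℂ e).rTensor A t) :=
    LinearMap.congr_fun (TensorProduct.ext' fun p q => by simp [antipodeSq_mul] :
      (mulRight ℂ (G.antipodeSq e)).rTensor A ∘ₗ TensorProduct.map _ _ =
        TensorProduct.map G.antipodeSq.toLinearMap G.σ.toLinearMap ∘ₗ (mulRight ℂ e).rTensor A) t
  refine G.ext_rTensor_mulLeft fun e' => ?_
  obtain ⟨e, rfl⟩ := G.antipodeSq.surjective e'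
  rw [rTensor_mulLeft, ← G.rTensor_mulRight_T₂, ← G.rTensor_mulRight_T₂, ← rTensor_mulRight,
    map_antipodeSq_σ_T₂]

lemma map_σ'_symm_antipodeSq_T₁ (a c : A) :
    TensorProduct.map G.σ'.symm.toLinearMap G.antipodeSq.toLinearMap (G.T₁ (a ⊗ₜ c)) =
      G.T₁ (G.σ'.symm a ⊗ₜ G.antipodeSq c) := by
  have SS_map (t : A ⊗[ℂ] A) :
      G.SS (TensorProduct.map G.σ'.symm.toLinearMap G.antipodeSq.toLinearMap t) =
        TensorProduct.map G.σ.toLinearMap G.antipodeSq.toLinearMap (G.SS t) :=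
    LinearMap.congr_fun (TensorProduct.ext' fun p q => by
      simp [SS, σ'_symm_apply, antipodeSq_apply] :
      G.SS ∘ₗ TensorProduct.map G.σ'.symm.toLinearMap G.antipodeSq.toLinearMap =
        TensorProduct.map G.σ.toLinearMap G.antipodeSq.toLinearMap ∘ₗ G.SS) t
  refine (TensorProduct.congr G.S G.S).injective (?_ : G.SS _ = G.SS _)
  rw [SS_map, SS_T₁, SS_T₁, TensorProduct.map_comm, map_antipodeSq_σ_T₂, σ'_symm_apply,
    LinearEquiv.apply_symm_apply]
  rfl

end ModularCoproduct

section ModularCharacter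

/-- The homomorphism `ε ∘ σ⁻¹`, which turns out to be the extended pairing with the modular
element of the dual. -/
noncomputable def modularCharacter : A →ₗ[ℂ] ℂ := G.ε ∘ₗ G.σ.symm.toLinearMap

lemma modularCharacter_apply (x : A) : G.modularCharacter x = G.ε (G.σ.symm x) := rfl

lemma modularCharacter_mul (x y : A) :
    G.modularCharacter (x * y) = G.modularCharacter x * G.modularCharacter y := by
  simp [modularCharacter_apply, σ_symm_mul, G.counit_mul]

lemma modularCharacter_σ (x : A) : G.modularCharacter (G.σ x) = G.ε x := by
  simp [modularCharacter_apply]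

lemma modularCharacter_δL (x : A) :
    G.modularCharacter (G.δL x) = G.τ * G.modularCharacter x := by
  obtain ⟨x, rfl⟩ := G.σ.surjective x
  rw [δL_σ, map_smul, modularCharacter_σ, modularCharacter_σ, ε_δL, smul_eq_mul]

lemma modularCharacter_δR (x : A) :
    G.modularCharacter (G.δR x) = G.τ * G.modularCharacter x := by
  obtain ⟨a, ha⟩ := G.exists_ε_ne_zero
  have h := congrArg G.modularCharacter (G.mul_δL x (G.σ a))
  rw [modularCharacter_mul, modularCharacter_mul, modularCharacter_δL, modularCharacter_σ,
    mul_left_comm, ← mul_assoc] at h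
  exact (mul_right_cancel₀ ha h).symm

lemma modularCharacter_σ' (x : A) : G.modularCharacter (G.σ' x) = G.ε x := by
  have h := G.modularCharacter_δR (G.σ' x)
  rw [σ'_apply_eq_δ_conj, LinearEquiv.apply_symm_apply, modularCharacter_δL,
    modularCharacter_σ] at h
  rw [σ'_apply_eq_δ_conj]
  exact (mul_left_cancel₀ G.τ_ne_zero h).symm

lemma ε_σ'_symm (x : A) : G.ε (G.σ'.symm x) = G.modularCharacter x := by
  rw [← modularCharacter_σ', LinearEquiv.apply_symm_apply]

lemma ε_σ' (x : A) : G.ε (G.σ' x) = G.ε (G.σ x) := by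
  rw [σ'_apply_eq_δ_conj, ε_δR_symm, ε_δL]

lemma modularCharacter_S (x : A) : G.modularCharacter (G.S x) = G.ε (G.σ x) := by
  rw [← ε_σ'_symm, σ'_symm_apply, G.isAntipode_S.counit_symm_apply, σ_S_S,
    G.isAntipode_S.counit_apply, G.isAntipode_S.counit_apply]

lemma sliceR_modularCharacter_T₃ (a c : A) :
    sliceR G.modularCharacter (G.T₃ (a ⊗ₜ c)) = G.antipodeSq (G.σ.symm a) * c := by
  obtain ⟨a, rfl⟩ := G.σ.surjective a
  obtain ⟨c, rfl⟩ := G.antipodeSq.surjective c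
  have comp_σ : G.modularCharacter ∘ₗ G.σ.toLinearMap = G.ε :=
    LinearMap.ext G.modularCharacter_σ
  rw [← map_antipodeSq_σ_T₃, sliceR_map, comp_σ, G.sliceR_counit_T₃]
  simp [antipodeSq_mul]

lemma sliceR_ε_σ_T₃ (a c : A) : sliceR (G.ε ∘ₗ G.σ.toLinearMap) (G.T₃ (a ⊗ₜ c)) =
    G.antipodeSq.symm (G.σ a) * c := by
  apply G.antipodeSq.injective
  have h := congrArg (sliceR G.ε) (G.map_antipodeSq_σ_T₃ a c)
  rw [sliceR_map, G.sliceR_counit_T₃] at h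
  simpa [antipodeSq_mul] using h

lemma sliceL_modularCharacter_T₁ (a c : A) :
    sliceL G.modularCharacter (G.T₁ (a ⊗ₜ c)) = G.antipodeSq.symm (G.σ'.symm a) * c := by
  apply G.antipodeSq.injective
  have h := congrArg (sliceL G.ε) (G.map_σ'_symm_antipodeSq_T₁ a c)
  have ε_comp : G.ε ∘ₗ G.σ'.symm.toLinearMap = G.modularCharacter := LinearMap.ext G.ε_σ'_symm
  rw [sliceL_map, G.sliceL_counit_T₁, ε_comp] at h
  simpa [antipodeSq_mul] using h

lemma sliceL_ε_σ_T₁ (a c : A) : sliceL (G.ε ∘ₗ G.σ.toLinearMap) (G.T₁ (a ⊗ₜ c)) =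
    G.antipodeSq (G.σ' a) * c := by
  obtain ⟨a, rfl⟩ := G.σ'.symm.surjective a
  obtain ⟨c, rfl⟩ := G.antipodeSq.surjective c
  have comp_σ'_symm : (G.ε ∘ₗ G.σ.toLinearMap) ∘ₗ G.σ'.symm.toLinearMap = G.ε :=
    LinearMap.ext fun x => by simp [← ε_σ']
  rw [← map_σ'_symm_antipodeSq_T₁, sliceL_map, comp_σ'_symm, G.sliceL_counit_T₁]
  simp [antipodeSq_mul]

end ModularCharacter

end AlgebraicQuantumGroup

/-! ### The dual -/

section ModularElement

variable {B : Type*} [NonUnitalRing B] [Module ℂ B] {f : B →ₗ[ℂ] ℂ} {S : B ≃ₗ[ℂ] B}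

lemma IsModularElement.unique [SMulCommClass ℂ B B] [IsScalarTower ℂ B B] {u v : (Multiplier B)ˣ}
    (hl : ∀ a, (∀ b, f (b * a) = 0) → a = 0) (hr : ∀ a, (∀ b, f (a * b) = 0) → a = 0)
    (hu : IsModularElement S f u) (hv : IsModularElement S f v) : u = v := by
  have eq_zero_of_mul_left (a : B) (h : ∀ b, b * a = 0) : a = 0 :=
    hl a fun b => by rw [h, map_zero]
  have eq_zero_of_mul_right (a : B) (h : ∀ b, a * b = 0) : a = 0 :=
    hr a fun b => by rw [h, map_zero]
  refine Units.ext (Multiplier.ext (fun a => sub_eq_zero.1 (hr _ fun b => ?_)) fun a =>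
    sub_eq_zero.1 (hl _ fun b => ?_))
  · rw [sub_mul, map_sub, ← Multiplier.lmul_apply_mul eq_zero_of_mul_left,
      ← Multiplier.lmul_apply_mul eq_zero_of_mul_left, ← (hu _).2, ← (hv _).2, sub_self]
  · rw [mul_sub, map_sub, ← Multiplier.rmul_apply_mul eq_zero_of_mul_right,
      ← Multiplier.rmul_apply_mul eq_zero_of_mul_right, ← (hu _).1, ← (hv _).1, sub_self]

end ModularElement

namespace AlgebraicQuantumGroup

open RegularMultiplierHopfAlgebra

variable {A : Type*} [NonUnitalRing A] [Module ℂ A] [SMulCommClass ℂ A A] [IsScalarTower ℂ A A]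
  (G : AlgebraicQuantumGroup A)

section Fourier

/-- The Fourier transform `c ↦ φ( · c)` as an isomorphism of `A` onto its dual. -/
noncomputable def fourierEquiv : A ≃ₗ[ℂ] G.Dual :=
  LinearEquiv.ofInjective G.fourier G.functionalMulR_φ_injective

lemma fourierEquiv_val (c x : A) : (G.fourierEquiv c).1 x = G.φ (x * c) := rfl

lemma eq_fourierEquiv {b : G.Dual} {c : A} (h : ∀ x, b.1 x = G.φ (x * c)) :
    b = G.fourierEquiv c := Dual.ext h

lemma rep_fourierEquiv (c : A) : (G.fourierEquiv c).rep = c :=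
  G.ext_φ_left fun x => by rw [← Dual.rep_spec, fourierEquiv_val]

lemma actR_fourierEquiv (c a : A) :
    (G.fourierEquiv c).actR a = sliceL G.φ (G.T₃ (a ⊗ₜ c)) :=
  congrArg (fun d => sliceL G.φ (G.T₃ (a ⊗ₜ d))) (G.rep_fourierEquiv c)

lemma actL_fourierEquiv (c a : A) :
    (G.fourierEquiv c).actL a = sliceR G.φ (G.T₁ (a ⊗ₜ c)) :=
  congrArg (fun d => sliceR G.φ (G.T₁ (a ⊗ₜ d))) (G.rep_fourierEquiv c)

lemma fourierEquiv_mul (c c' : A) : G.fourierEquiv c * G.fourierEquiv c' =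
    G.fourierEquiv (sliceR G.φ (G.T₃.symm (c ⊗ₜ c'))) := by
  refine Dual.ext fun a => ?_
  rw [Dual.mul_val, actR_fourierEquiv, fourierEquiv_val, fourierEquiv_val,
    ← G.isLeftInvariant_φ.apply_sliceR_lmul_T₃, LinearEquiv.apply_symm_apply, ← slice_slice,
    ← lTensor_T₃, sliceL_lTensor]
  rfl

variable {G}

lemma Dual.mul_actL (b : G.Dual) (a e : A) : e * b.actL a = sliceR b.1 (G.T₂ (e ⊗ₜ a)) := by
  obtain ⟨c, rfl⟩ := G.fourierEquiv.surjective b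
  have h := congrArg (sliceR G.φ) (G.lTensor_mulRight_T₂ a c e)
  rw [sliceR_lTensor, sliceR_rTensor] at h
  rw [actL_fourierEquiv]
  exact h.symm

lemma Dual.val_actL (b b' : G.Dual) (a : A) : b.1 (b'.actL a) = b'.1 (b.actR a) := by
  obtain ⟨c, rfl⟩ := G.fourierEquiv.surjective b
  obtain ⟨c', rfl⟩ := G.fourierEquiv.surjective b'
  rw [actL_fourierEquiv, actR_fourierEquiv, fourierEquiv_val, fourierEquiv_val]
  have h := slice_slice G.φ ((G.Δ a).lmul (c ⊗ₜ c'))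
  rw [← lTensor_T₃, sliceL_lTensor, lTensor_T₃, ← rTensor_T₁, sliceR_rTensor] at h
  exact h.symm

lemma Dual.actL_actR (b b' : G.Dual) (a : A) : b'.actL (b.actR a) = b.actR (b'.actL a) := by
  obtain ⟨c', rfl⟩ := G.fourierEquiv.surjective b'
  rw [actL_fourierEquiv, actL_fourierEquiv, ← Dual.rTensor_actR, sliceR_rTensor]

end Fourier

section DualIntegrals

lemma isDualPsi_dualψ : G.IsDualPsi G.dualψ :=
  Classical.epsilon_spec (p := G.IsDualPsi) ⟨G.ε ∘ₗ G.fourierEquiv.symm.toLinearMap,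
    fun c b h => by rw [G.eq_fourierEquiv h]; simp⟩

lemma dualψ_fourierEquiv (c : A) : G.dualψ (G.fourierEquiv c) = G.ε c :=
  G.isDualPsi_dualψ c _ fun _ => rfl

lemma S_symm_mul'_rTensor_T₃ (t : A ⊗[ℂ] A) :
    G.S.symm (LinearMap.mul' ℂ A (G.S.toLinearMap.rTensor A (G.T₃ t))) = sliceL G.ε t :=
  LinearMap.congr_fun (TensorProduct.ext' fun p q => by
    simp [G.isAntipode_S.mul'_rTensor_T₃ p q] :
    G.S.symm.toLinearMap ∘ₗ LinearMap.mul' ℂ A ∘ₗ G.S.toLinearMap.rTensor A ∘ₗ G.T₃.toLinearMap =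
      sliceL G.ε) t

lemma dualψ_fourierEquiv_mul (c c' : A) :
    G.dualψ (G.fourierEquiv c * G.fourierEquiv c') = G.φ (G.S.symm c' * c) := by
  rw [fourierEquiv_mul, dualψ_fourierEquiv, ← apply_sliceL, ← S_symm_mul'_rTensor_T₃,
    LinearEquiv.apply_symm_apply]
  simp [G.isAntipode_S.symm_map_mul]

lemma φ_S_mul (a c : A) : G.φ (G.S a * c) = G.φ (a * G.δL (G.σ (G.S.symm c))) := by
  rw [mul_δL, ← φ_mul_comm, ← δR_mul, ← φ_S, G.isAntipode_S.map_mul,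
    LinearEquiv.apply_symm_apply]

lemma isDualAntipode_dualS : G.IsDualAntipode G.dualS :=
  Classical.epsilon_spec (p := G.IsDualAntipode)
    ⟨G.fourierEquiv.symm.trans ((G.S.symm.trans (G.σ.trans G.δL)).trans G.fourierEquiv),
      fun b a => by
        obtain ⟨c, rfl⟩ := G.fourierEquiv.surjective b
        simp [fourierEquiv_val, φ_S_mul]⟩

lemma dualS_val (b : G.Dual) (a : A) : (G.dualS b).1 a = b.1 (G.S a) :=
  G.isDualAntipode_dualS b a

lemma dualS_fourierEquiv (c : A) :
    G.dualS (G.fourierEquiv c) = G.fourierEquiv (G.δL (G.σ (G.S.symm c))) :=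
  G.eq_fourierEquiv fun a => by rw [dualS_val, fourierEquiv_val, φ_S_mul]

lemma dualS_fourierEquiv_δR_val (c x : A) :
    (G.dualS (G.fourierEquiv (G.δR c))).1 x = G.ψ (G.S x * c) := by
  rw [dualS_val, fourierEquiv_val, ψ_apply, φ_S, δR_mul]

lemma isDualPhi_dualφ : G.IsDualPhi G.dualφ := by
  refine Classical.epsilon_spec (p := G.IsDualPhi)
    ⟨G.ε ∘ₗ G.fourierEquiv.symm.toLinearMap ∘ₗ G.dualS.symm.toLinearMap, fun c b h => ?_⟩
  have b_eq : b = G.dualS (G.fourierEquiv (G.δR c)) :=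
    Dual.ext fun x => by rw [h, dualS_fourierEquiv_δR_val]
  simp [b_eq, ε_δR]

lemma dualφ_dualS (b : G.Dual) : G.dualφ (G.dualS b) = G.dualψ b := by
  obtain ⟨c, rfl⟩ := G.fourierEquiv.surjective b
  obtain ⟨c, rfl⟩ := G.δR.surjective c
  rw [dualψ_fourierEquiv, ε_δR]
  exact G.isDualPhi_dualφ _ _ fun x => G.dualS_fourierEquiv_δR_val c x

lemma dualφ_fourierEquiv (c : A) :
    G.dualφ (G.fourierEquiv c) = G.τ⁻¹ * G.modularCharacter c := by
  obtain ⟨c, rfl⟩ := (G.S.symm.trans (G.σ.trans G.δL)).surjective c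
  simp only [LinearEquiv.trans_apply]
  rw [← dualS_fourierEquiv, dualφ_dualS, dualψ_fourierEquiv, modularCharacter_δL,
    modularCharacter_σ, G.isAntipode_S.counit_symm_apply, inv_mul_cancel_left₀ G.τ_ne_zero]

lemma S_actR_dualS (b : G.Dual) (a : A) : G.S ((G.dualS b).actR a) = b.actL (G.S a) := by
  refine G.ext_mul_left fun e => ?_
  obtain ⟨e, rfl⟩ := G.S.surjective e
  have dualS_eq : (G.dualS b).1 = b.1 ∘ₗ G.S.toLinearMap := LinearMap.ext (G.dualS_val b)
  have slice_SS : sliceL b.1 (G.SS (G.T₁ (a ⊗ₜ e))) =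
      G.S (sliceL (b.1 ∘ₗ G.S.toLinearMap) (G.T₁ (a ⊗ₜ e))) :=
    sliceL_map b.1 G.S.toLinearMap G.S.toLinearMap _
  rw [← G.isAntipode_S.map_mul, Dual.actR_mul, Dual.mul_actL, dualS_eq, ← slice_SS, SS_T₁,
    sliceL_comm]

lemma dualS_mul (b b' : G.Dual) : G.dualS (b * b') = G.dualS b' * G.dualS b :=
  Dual.ext fun a => by
    rw [dualS_val, Dual.mul_val, Dual.mul_val, dualS_val, S_actR_dualS, Dual.val_actL]

lemma eq_zero_of_dualψ_mul_left (b : G.Dual) (h : ∀ b', G.dualψ (b' * b) = 0) : b = 0 := by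
  obtain ⟨c, rfl⟩ := G.fourierEquiv.surjective b
  rw [map_eq_zero_iff _ G.fourierEquiv.injective, ← map_eq_zero_iff _ G.S.symm.injective]
  exact G.eq_zero_of_φ_mul_right fun x => by rw [← dualψ_fourierEquiv_mul, h]

lemma eq_zero_of_dualψ_mul_right (b : G.Dual) (h : ∀ b', G.dualψ (b * b') = 0) : b = 0 := by
  obtain ⟨c, rfl⟩ := G.fourierEquiv.surjective b
  rw [map_eq_zero_iff _ G.fourierEquiv.injective]
  exact G.eq_zero_of_φ_mul_left fun x => by
    rw [← G.S.symm_apply_apply x, ← dualψ_fourierEquiv_mul, h]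

lemma eq_zero_of_dualφ_mul_left (b : G.Dual) (h : ∀ b', G.dualφ (b' * b) = 0) : b = 0 := by
  obtain ⟨b, rfl⟩ := G.dualS.surjective b
  rw [map_eq_zero_iff _ G.dualS.injective]
  exact G.eq_zero_of_dualψ_mul_right _ fun x => by rw [← dualφ_dualS, dualS_mul, h]

lemma eq_zero_of_dualφ_mul_right (b : G.Dual) (h : ∀ b', G.dualφ (b * b') = 0) : b = 0 := by
  obtain ⟨b, rfl⟩ := G.dualS.surjective b
  rw [map_eq_zero_iff _ G.dualS.injective]
  exact G.eq_zero_of_dualψ_mul_left _ fun x => by rw [← dualφ_dualS, dualS_mul, h]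

end DualIntegrals

section DualModularAutomorphisms

lemma dualψ_mul_comm (b b' : G.Dual) : G.dualψ (b * b') =
    G.dualψ (b' *
      (G.fourierEquiv.symm.trans ((G.antipodeSq.trans G.δR.symm).trans G.fourierEquiv)) b) := by
  obtain ⟨c, rfl⟩ := G.fourierEquiv.surjective b
  obtain ⟨c', rfl⟩ := G.fourierEquiv.surjective b'
  simp only [LinearEquiv.trans_apply, LinearEquiv.symm_apply_apply, antipodeSq_apply]
  rw [dualψ_fourierEquiv_mul, dualψ_fourierEquiv_mul, ← S_δL, LinearEquiv.symm_apply_apply,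
    ← δL_mul, ← φ_S_symm, G.isAntipode_S.symm_map_mul, LinearEquiv.symm_apply_apply]

lemma isModularAutomorphism_dualσ' : IsModularAutomorphism G.dualψ G.dualσ' :=
  Classical.epsilon_spec (p := IsModularAutomorphism G.dualψ)
    ⟨_, isModularAutomorphism_of_faithful G.eq_zero_of_dualψ_mul_left
      G.dualψ_mul_comm⟩

lemma dualσ'_fourierEquiv (c : A) :
    G.dualσ' (G.fourierEquiv c) = G.fourierEquiv (G.δR.symm (G.S (G.S c))) := by
  rw [dualσ', modularAutomorphism_eq G.eq_zero_of_dualψ_mul_left G.dualψ_mul_comm]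
  simp [antipodeSq_apply]

lemma dualσ'_val (b : G.Dual) (a : A) :
    (G.dualσ' b).1 a = b.1 (G.δL.symm (G.S.symm (G.S.symm a))) := by
  obtain ⟨c, rfl⟩ := G.fourierEquiv.surjective b
  obtain ⟨a, rfl⟩ := G.antipodeSq.surjective a
  rw [dualσ'_fourierEquiv, fourierEquiv_val, fourierEquiv_val, antipodeSq_apply,
    LinearEquiv.symm_apply_apply, LinearEquiv.symm_apply_apply, ← δR_symm_mul,
    ← G.isAntipode_S.map_mul, ← G.isAntipode_S.map_mul, ← δL_symm_mul, ← S_δL, ← S_δR_symm,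
    φ_S_S, ← δL_symm_δR, LinearEquiv.apply_symm_apply]

lemma dualφ_mul_comm (b b' : G.Dual) : G.dualφ (b * b') =
    G.dualφ (b' * (G.dualS.symm.trans (G.dualσ'.symm.trans G.dualS)) b) := by
  obtain ⟨x, rfl⟩ := G.dualS.surjective b
  obtain ⟨y, rfl⟩ := G.dualS.surjective b'
  simp only [LinearEquiv.trans_apply, LinearEquiv.symm_apply_apply]
  rw [← dualS_mul, ← dualS_mul, dualφ_dualS, dualφ_dualS, G.isModularAutomorphism_dualσ'.2 _ y,
    LinearEquiv.apply_symm_apply]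

lemma isModularAutomorphism_dualσ : IsModularAutomorphism G.dualφ G.dualσ :=
  Classical.epsilon_spec (p := IsModularAutomorphism G.dualφ)
    ⟨_, isModularAutomorphism_of_faithful G.eq_zero_of_dualφ_mul_left G.dualφ_mul_comm⟩

lemma dualσ_eq : G.dualσ = G.dualS.symm.trans (G.dualσ'.symm.trans G.dualS) :=
  modularAutomorphism_eq G.eq_zero_of_dualφ_mul_left G.dualφ_mul_comm

lemma dualσ_val (b : G.Dual) (a : A) :
    (G.dualσ b).1 a = b.1 (G.δR.symm (G.S (G.S a))) := by
  obtain ⟨x, rfl⟩ := G.dualS.surjective b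
  obtain ⟨z, rfl⟩ := G.dualσ'.surjective x
  rw [dualσ_eq]
  simp only [LinearEquiv.trans_apply, LinearEquiv.symm_apply_apply]
  rw [dualS_val, dualS_val, dualσ'_val, LinearEquiv.symm_apply_apply, ← S_δL,
    LinearEquiv.symm_apply_apply, LinearEquiv.symm_apply_apply]

end DualModularAutomorphisms

section DualModularElement

/-- Right multiplication by the modular element of the dual, which is adjoint to `S² ∘ σ⁻¹`. -/
noncomputable def dualδR : G.Dual ≃ₗ[ℂ] G.Dual :=
  G.fourierEquiv.symm.trans ((G.antipodeSq.symm.trans (G.σ.trans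
    (LinearEquiv.smulOfNeZero ℂ A G.τ G.τ_ne_zero))).trans G.fourierEquiv)

/-- Left multiplication by the modular element of the dual, which is adjoint to
`S⁻² ∘ σ'⁻¹`. -/
noncomputable def dualδL : G.Dual ≃ₗ[ℂ] G.Dual :=
  G.fourierEquiv.symm.trans ((G.antipodeSq.trans (G.δR.symm.trans (G.σ.trans (G.δL.trans
    (LinearEquiv.smulOfNeZero ℂ A G.τ⁻¹ (inv_ne_zero G.τ_ne_zero)))))).trans G.fourierEquiv)

lemma dualδR_fourierEquiv (c : A) :
    G.dualδR (G.fourierEquiv c) = G.fourierEquiv (G.τ • G.σ (G.antipodeSq.symm c)) := by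
  simp [dualδR]

lemma dualδL_fourierEquiv (c : A) : G.dualδL (G.fourierEquiv c) =
    G.fourierEquiv (G.τ⁻¹ • G.δL (G.σ (G.δR.symm (G.antipodeSq c)))) := by
  simp [dualδL]

lemma dualδR_val (b : G.Dual) (a : A) :
    (G.dualδR b).1 a = b.1 (G.antipodeSq (G.σ.symm a)) := by
  obtain ⟨c, rfl⟩ := G.fourierEquiv.surjective b
  obtain ⟨c, rfl⟩ := G.antipodeSq.surjective c
  rw [dualδR_fourierEquiv, fourierEquiv_val, fourierEquiv_val, LinearEquiv.symm_apply_apply,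
    mul_smul_comm, map_smul, ← φ_mul_comm, ← antipodeSq_mul, antipodeSq_apply, φ_S_S_eq_τ_mul,
    G.φ_mul_comm_symm c a, smul_eq_mul]

lemma φ_mul_δL_σ_δR_symm (x y : A) :
    G.φ (G.σ' x * G.δL (G.σ (G.δR.symm y))) = G.φ (x * y) := by
  rw [mul_δL, ← φ_mul_comm, ← δR_mul, ← φ_S, G.isAntipode_S.map_mul, S_δR_symm, σ'_apply,
    LinearEquiv.apply_symm_apply, ← G.φ_mul_comm_symm, ← δL_mul, ← G.isAntipode_S.map_mul,
    ← φ_S_symm, LinearEquiv.symm_apply_apply]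

lemma dualδL_val (b : G.Dual) (a : A) :
    (G.dualδL b).1 a = b.1 (G.antipodeSq.symm (G.σ'.symm a)) := by
  obtain ⟨c, rfl⟩ := G.fourierEquiv.surjective b
  obtain ⟨a, rfl⟩ := G.σ'.surjective a
  obtain ⟨a, rfl⟩ := G.antipodeSq.surjective a
  rw [dualδL_fourierEquiv, fourierEquiv_val, fourierEquiv_val, LinearEquiv.symm_apply_apply,
    LinearEquiv.symm_apply_apply, mul_smul_comm, map_smul, φ_mul_δL_σ_δR_symm,
    ← antipodeSq_mul, antipodeSq_apply, φ_S_S_eq_τ_mul, smul_eq_mul,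
    inv_mul_cancel_left₀ G.τ_ne_zero]

lemma modularCharacter_actR (b : G.Dual) (a : A) :
    G.modularCharacter (b.actR a) = (G.dualδR b).1 a := by
  obtain ⟨c, rfl⟩ := G.fourierEquiv.surjective b
  rw [dualδR_val, actR_fourierEquiv, apply_sliceL, sliceR_modularCharacter_T₃, fourierEquiv_val]

lemma modularCharacter_actL (b : G.Dual) (a : A) :
    G.modularCharacter (b.actL a) = (G.dualδL b).1 a := by
  obtain ⟨c, rfl⟩ := G.fourierEquiv.surjective b
  rw [dualδL_val, actL_fourierEquiv, ← apply_sliceL, sliceL_modularCharacter_T₁,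
    fourierEquiv_val]

lemma mul_dualδL (b b' : G.Dual) : b * G.dualδL b' = G.dualδR b * b' := Dual.ext fun a => by
  rw [Dual.mul_val, Dual.mul_val, ← modularCharacter_actL, ← Dual.val_actL,
    ← modularCharacter_actR, Dual.actL_actR]

lemma dualφ_dualδR (b : G.Dual) : G.dualφ (G.dualδR b) = G.dualφ (G.dualS b) := by
  obtain ⟨c, rfl⟩ := G.fourierEquiv.surjective b
  rw [dualφ_dualS, dualψ_fourierEquiv, dualδR_fourierEquiv, dualφ_fourierEquiv, map_smul,
    modularCharacter_σ, smul_eq_mul, inv_mul_cancel_left₀ G.τ_ne_zero, ← ε_antipodeSq,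
    LinearEquiv.apply_symm_apply]

lemma dualφ_dualδL (b : G.Dual) : G.dualφ (G.dualδL b) = G.dualφ (G.dualS.symm b) := by
  obtain ⟨b, rfl⟩ := G.dualS.surjective b
  obtain ⟨c, rfl⟩ := G.fourierEquiv.surjective b
  obtain ⟨c, rfl⟩ := G.S.surjective c
  rw [LinearEquiv.symm_apply_apply, dualS_fourierEquiv, dualδL_fourierEquiv, dualφ_fourierEquiv,
    dualφ_fourierEquiv, map_smul, modularCharacter_δL, modularCharacter_σ, ε_δR_symm,
    ε_antipodeSq, ε_δL, modularCharacter_S, smul_eq_mul, inv_mul_cancel_left₀ G.τ_ne_zero,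
    LinearEquiv.symm_apply_apply]

lemma isModularElement_unitOfEquiv : IsModularElement G.dualS G.dualφ
    (Multiplier.unitOfEquiv G.dualδL G.dualδR G.mul_dualδL) :=
  fun b => ⟨(G.dualφ_dualδR b).symm, (G.dualφ_dualδL b).symm⟩

lemma isModularElement_dualδ : IsModularElement G.dualS G.dualφ G.dualδ :=
  Classical.epsilon_spec (p := IsModularElement G.dualS G.dualφ)
    ⟨_, G.isModularElement_unitOfEquiv⟩

lemma dualδ_eq : G.dualδ = Multiplier.unitOfEquiv G.dualδL G.dualδR G.mul_dualδL :=
  G.isModularElement_dualδ.unique G.eq_zero_of_dualφ_mul_left G.eq_zero_of_dualφ_mul_right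
    G.isModularElement_unitOfEquiv

end DualModularElement

section ExtendedPairing

namespace IsExtendedPairing

variable {G} {m : Multiplier G.Dual} {f g : A →ₗ[ℂ] ℂ}

lemma unique (hf : G.IsExtendedPairing m f) (hg : G.IsExtendedPairing m g) : f = g := by
  have surjective : Function.Surjective (sliceL G.φ ∘ₗ G.T₃.toLinearMap) :=
    (sliceL_surjective G.φ_ne_zero).comp G.T₃.surjective
  refine (LinearMap.cancel_right surjective).1 (TensorProduct.ext' fun a c => ?_)
  change f (sliceL G.φ (G.T₃ (a ⊗ₜ c))) = g (sliceL G.φ (G.T₃ (a ⊗ₜ c)))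
  rw [← actR_fourierEquiv, hf.1, hg.1]

lemma pairing_eq (hf : G.IsExtendedPairing m f) : G.pairing m = f :=
  (Classical.epsilon_spec (p := G.IsExtendedPairing m) ⟨f, hf⟩).unique hf

end IsExtendedPairing

lemma isExtendedPairing_dualδ : G.IsExtendedPairing ↑G.dualδ G.modularCharacter := by
  rw [dualδ_eq]
  exact ⟨fun a b => G.modularCharacter_actR b a, fun a b => G.modularCharacter_actL b a⟩

lemma dualδR_symm_val (b : G.Dual) (a : A) :
    (G.dualδR.symm b).1 a = b.1 (G.antipodeSq.symm (G.σ a)) := by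
  obtain ⟨b, rfl⟩ := G.dualδR.surjective b
  rw [LinearEquiv.symm_apply_apply, dualδR_val, ← σ_symm_antipodeSq,
    LinearEquiv.apply_symm_apply, LinearEquiv.symm_apply_apply]

lemma dualδL_symm_val (b : G.Dual) (a : A) :
    (G.dualδL.symm b).1 a = b.1 (G.antipodeSq (G.σ' a)) := by
  obtain ⟨b, rfl⟩ := G.dualδL.surjective b
  rw [LinearEquiv.symm_apply_apply, dualδL_val, σ'_symm_antipodeSq,
    LinearEquiv.symm_apply_apply, LinearEquiv.symm_apply_apply]

lemma ε_σ_actR (b : G.Dual) (a : A) : G.ε (G.σ (b.actR a)) = (G.dualδR.symm b).1 a := by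
  obtain ⟨c, rfl⟩ := G.fourierEquiv.surjective b
  rw [dualδR_symm_val, fourierEquiv_val, ← sliceR_ε_σ_T₃, ← apply_sliceL, actR_fourierEquiv]
  rfl

lemma ε_σ_actL (b : G.Dual) (a : A) : G.ε (G.σ (b.actL a)) = (G.dualδL.symm b).1 a := by
  obtain ⟨c, rfl⟩ := G.fourierEquiv.surjective b
  rw [dualδL_symm_val, fourierEquiv_val, ← sliceL_ε_σ_T₁, apply_sliceL, actL_fourierEquiv]
  rfl

lemma isExtendedPairing_dualδ_inv :
    G.IsExtendedPairing ↑G.dualδ⁻¹ (G.ε ∘ₗ G.σ.toLinearMap) := by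
  rw [dualδ_eq]
  exact ⟨fun a b => G.ε_σ_actR b a, fun a b => G.ε_σ_actL b a⟩

end ExtendedPairing

end AlgebraicQuantumGroup

theorem proposition2p3 {A : Type*} [NonUnitalRing A] [Module ℂ A] [SMulCommClass ℂ A A]
    [IsScalarTower ℂ A A] (G : AlgebraicQuantumGroup A) :
    -- the objects in the formulas exist, that is, they have their defining properties
    (G.IsCounit G.ε ∧ G.IsAntipode G.S ∧
      IsModularAutomorphism G.φ G.σ ∧ IsModularAutomorphism G.ψ G.σ' ∧
      IsModularElement G.S G.φ G.δ ∧
      G.IsDualPhi G.dualφ ∧ G.IsDualPsi G.dualψ ∧ G.IsDualAntipode G.dualS ∧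
      IsModularAutomorphism G.dualφ G.dualσ ∧ IsModularAutomorphism G.dualψ G.dualσ' ∧
      IsModularElement G.dualS G.dualφ G.dualδ ∧
      G.IsExtendedPairing ↑G.dualδ (G.pairing ↑G.dualδ) ∧
      G.IsExtendedPairing ↑G.dualδ⁻¹ (G.pairing ↑G.dualδ⁻¹)) ∧
    -- the pairing with the dual modular element and its inverse
    (∀ a : A, G.pairing ↑G.dualδ a = G.ε (G.σ.symm a) ∧
      G.ε (G.σ.symm a) = G.ε (G.σ'.symm a)) ∧
    (∀ a : A, G.pairing ↑G.dualδ⁻¹ a = G.ε (G.σ a) ∧ G.ε (G.σ a) = G.ε (G.σ' a)) ∧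
    -- the dual modular automorphisms
    (∀ (a : A) (b : G.Dual), (G.dualσ b).1 a =
      b.1 ((↑G.δ⁻¹ : Multiplier A).rmul (G.S (G.S a)))) ∧
    (∀ (a : A) (b : G.Dual), (G.dualσ' b).1 a =
      b.1 ((↑G.δ⁻¹ : Multiplier A).lmul (G.S.symm (G.S.symm a)))) ∧
    -- the Plancherel formula
    (∀ (c c' : A) (b b' : G.Dual), (∀ x, b.1 x = G.φ (x * c)) → (∀ x, b'.1 x = G.φ (x * c')) →
      G.dualψ (b * b') = G.φ (G.S.symm c' * c)) := by
  have hδ := G.isExtendedPairing_dualδ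
  have hδ_inv := G.isExtendedPairing_dualδ_inv
  rw [hδ.pairing_eq, hδ_inv.pairing_eq]
  exact ⟨⟨G.isCounit_counit, G.isAntipode_S, G.isModularAutomorphism_σ,
      G.isModularAutomorphism_σ', G.isModularElement_δ, G.isDualPhi_dualφ, G.isDualPsi_dualψ,
      G.isDualAntipode_dualS, G.isModularAutomorphism_dualσ, G.isModularAutomorphism_dualσ',
      G.isModularElement_dualδ, hδ, hδ_inv⟩,
    fun a => ⟨G.modularCharacter_apply a, (G.ε_σ'_symm a).symm⟩,
    fun a => ⟨rfl, (G.ε_σ' a).symm⟩,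
    fun a b => G.dualσ_val b a,
    fun a b => G.dualσ'_val b a,
    fun c c' b b' hb hb' => by
      rw [G.eq_fourierEquiv hb, G.eq_fourierEquiv hb', G.dualψ_fourierEquiv_mul]⟩
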